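/- **Setting.** Let $k$ be a continuous symmetric positive semidefinite kernel on $\mathbb R^D$ with $k(x,x)<v$ for all $x$, and let $\sigma^2>0$. Let $N$ covariates $\mathbf X=(\mathbf x_1,\dots,\mathbf x_N)$ have a joint distribution whose marginals are all equal to one probability measure $\mu_x$ on $\mathbb R^D$ with a density. Let $\lambda_1\ge\lambda_2\ge\dots\ge0$ be the eigenvalues, with multiplicity (padded with zeros), of the operator $(\mathcal Kg)(x)=\int k(x,x')g(x')\,d\mu_x(x')$ on $L^2(\mu_x)$. Write $K=(k(\mathbf x_i,\mathbf x_j))_{i,j}$. Let $P$ be the posterior Gaussian process for the prior $\mathcal{GP}(0,k)$ and observations $\mathbf y=f(\mathbf X)+\mathcal N(0,\sigma^2I)$. For a set $Z$ of $\mathbf M$ of the covariates (the inducing points), let $Q$ be the sparse variational approximation with these inducing points: $Q$ minimises $\mathrm{KL}(Q\|P)$ among the Gaussian processes under which $f(Z)$ has an arbitrary Gaussian law $q$ and whose conditional law given $f(Z)$ is that of the prior. Here $\mathrm{KL}(Q\|P)$ is the divergence between the laws of the processes. **Algorithm** (recursive ridge leverage Nyström sampling with rank parameter $S$ and oversampling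 constant $\kappa$). On an index set $T$ with failure parameter $\delta$: if $|T|\le192\log(1/\delta)$, return all of $T$ with weights $1$. Otherwise let $T'\subseteq T$ contain each index independently with probability $\tfrac12$; run the algorithm on $T'$ with failure parameter $\delta/3$, and let $W$ be the diagonal matrix of the weights that it returns ($0$ for indices that are not selected). Put $\omega=\frac1S\sum_{m>S}\lambda_m(WKW)$ (eigenvalues in non-increasing order), $$\tilde\ell_i=\min\Big\{1,\tfrac1\omega\big(K-KW(WKW+\omega I)^{-1}WK\big)_{ii}\Big\}\quad(i\in T)$$ (the limit as $\omega\downarrow0$ if $\omega=0$), and $p_i=\min\{1,\kappa\,\tilde\ell_i\log(\sum_{j\in T}\tilde\ell_j/\delta)\}$, read as $0$ if negative. Select each $i\in T$ independently with probability $p_i$ and give it weight $p_i^{-1/2}$. The inducing points are the $\mathbf x_i$ selected by a run on $T=\{1,\dots,N\}$; given $\mathbf X$, the randomness of the algorithm is independent of $\mathbf y$. **Theorem.** There is a universal constant $\kappa_0>0$, and for every $\kappa\ge\kappa_0$ a constant $c>0$ depending only on $\kappa$, such that in the above setting, for all $D,N$, every integer $S\ge1$ and every $\delta\in(0,1/32)$,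 we have $\sum_m\lambda_m<\infty$ and the following hold. 1. If $\mathbb E[\|\mathbf y\|_2^2\mid\mathbf X]\le RN$ almost surely, where $R\ge0$, then with probability at least $1-5\delta$ $$\mathbf M<cS\log(S/\delta)\quad\text{and}\quad \mathrm{KL}(Q\|P)\le\frac12\Big(N+\frac{RN}{\sigma^2}\Big)\frac{N\sum_{m=S+1}^\infty\lambda_m}{S\delta^2\sigma^2}.$$ 2. If instead, conditionally on $\mathbf X$, $\mathbf y\sim\mathcal N(0,K+\sigma^2I)$, then with probability at least $1-5\delta$ $$\mathbf M<cS\log(S/\delta)\quad\text{and}\quad \mathrm{KL}(Q\|P)\le\frac{N^2\sum_{m=S+1}^\infty\lambda_m}{S\delta^2\sigma^2}.$$ The probabilities are over the covariates, the observations and the randomness of the algorithm. -/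

import Mathlib

open MeasureTheory ProbabilityTheory Matrix
open scoped ENNReal

noncomputable section

/-! ### Covariance functions and the kernel operator on `L²(μ)` -/

/-- A symmetric positive semidefinite covariance function: every finite kernel matrix is symmetric
positive semidefinite (`Matrix.PosSemidef` over an arbitrary, possibly infinite index type). -/
def IsCovarianceFunction {D : ℕ}
    (k : EuclideanSpace ℝ (Fin D) → EuclideanSpace ℝ (Fin D) → ℝ) : Prop :=
  (Matrix.of k).PosSemidef

theorem IsCovarianceFunction.abs_le {D : ℕ}
    {k : EuclideanSpace ℝ (Fin D) → EuclideanSpace ℝ (Fin D) → ℝ} (hk : IsCovarianceFunction k)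
    {v : ℝ} (hv : ∀ x, k x x < v) (x y : EuclideanSpace ℝ (Fin D)) : |k x y| ≤ v := by
  have h := hk.submatrix ![x, y]
  have hs : k y x = k x y := by simpa using hk.1.apply x y
  have hd : 0 ≤ k x x * k y y - k x y * k y x := by
    have h2 := h.det_nonneg
    rw [Matrix.det_fin_two] at h2
    simpa using h2
  have hx : 0 ≤ k x x := by simpa using hk.diag_nonneg (i := x)
  have hy : 0 ≤ k y y := by simpa using hk.diag_nonneg (i := y)
  rw [hs] at hd
  have hvx := hv x
  have hvy := hv y
  apply abs_le_of_sq_le_sq _ (by linarith)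
  nlinarith

theorem kernelOperator_memLp {D : ℕ}
    (k : EuclideanSpace ℝ (Fin D) → EuclideanSpace ℝ (Fin D) → ℝ)
    (hcont : Continuous fun z : EuclideanSpace ℝ (Fin D) × EuclideanSpace ℝ (Fin D) => k z.1 z.2)
    (v : ℝ) (hbd : ∀ x y, |k x y| ≤ v)
    (μ : Measure (EuclideanSpace ℝ (Fin D))) [IsFiniteMeasure μ] (g : Lp ℝ 2 μ) :
    MemLp (fun x => ∫ x', k x x' * g x' ∂μ) 2 μ := by
  have hgi : Integrable (fun x => g x) μ := (Lp.memLp g).integrable (by norm_num)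
  refine MemLp.of_bound (C := ∫ x', v * ‖g x'‖ ∂μ) ?_ ?_
  · have : StronglyMeasurable fun z : EuclideanSpace ℝ (Fin D) × EuclideanSpace ℝ (Fin D) =>
        k z.1 z.2 * g z.2 :=
      hcont.stronglyMeasurable.mul ((Lp.stronglyMeasurable g).comp_measurable measurable_snd)
    exact (this.integral_prod_right (ν := μ)).aestronglyMeasurable
  · refine Filter.Eventually.of_forall fun x => ?_
    refine norm_integral_le_of_norm_le (hgi.norm.const_mul v) (Filter.Eventually.of_forall ?_)
    intro x'
    rw [norm_mul]
    exact mul_le_mul_of_nonneg_right (hbd x x') (norm_nonneg _)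

theorem kernelOperator_integrable {D : ℕ}
    (k : EuclideanSpace ℝ (Fin D) → EuclideanSpace ℝ (Fin D) → ℝ)
    (hcont : Continuous fun z : EuclideanSpace ℝ (Fin D) × EuclideanSpace ℝ (Fin D) => k z.1 z.2)
    (v : ℝ) (hbd : ∀ x y, |k x y| ≤ v)
    (μ : Measure (EuclideanSpace ℝ (Fin D))) [IsFiniteMeasure μ] (g : Lp ℝ 2 μ)
    (x : EuclideanSpace ℝ (Fin D)) : Integrable (fun x' => k x x' * g x') μ := by
  have hgi : Integrable (fun x => g x) μ := (Lp.memLp g).integrable (by norm_num)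
  have hkx : Continuous fun x' => k x x' := hcont.comp (by fun_prop : Continuous fun x' => (x, x'))
  exact hgi.bdd_mul hkx.aestronglyMeasurable (Filter.Eventually.of_forall (hbd x))

/-- The kernel operator `(𝒦 g)(x) = ∫ k(x, x') g(x') dμ(x')` on `L²(μ)`. -/
def kernelOperator {D : ℕ}
    (k : EuclideanSpace ℝ (Fin D) → EuclideanSpace ℝ (Fin D) → ℝ)
    (hcont : Continuous fun z : EuclideanSpace ℝ (Fin D) × EuclideanSpace ℝ (Fin D) => k z.1 z.2)
    (v : ℝ) (hbd : ∀ x y, |k x y| ≤ v)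
    (μ : Measure (EuclideanSpace ℝ (Fin D))) [IsFiniteMeasure μ] :
    Lp ℝ 2 μ →ₗ[ℝ] Lp ℝ 2 μ where
  toFun g := (kernelOperator_memLp k hcont v hbd μ g).toLp
  map_add' g h := by
    rw [← MemLp.toLp_add]
    refine MemLp.toLp_congr _ _ (Filter.Eventually.of_forall fun x => ?_)
    simp only [Pi.add_apply]
    rw [← integral_add (kernelOperator_integrable k hcont v hbd μ g x)
      (kernelOperator_integrable k hcont v hbd μ h x)]
    refine integral_congr_ae ?_
    filter_upwards [Lp.coeFn_add g h] with x' hx'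
    rw [hx', Pi.add_apply, mul_add]
  map_smul' r g := by
    rw [RingHom.id_apply, ← MemLp.toLp_const_smul]
    refine MemLp.toLp_congr _ _ (Filter.Eventually.of_forall fun x => ?_)
    simp only [Pi.smul_apply, smul_eq_mul]
    rw [← integral_const_mul]
    refine integral_congr_ae ?_
    filter_upwards [Lp.coeFn_smul r g] with x' hx'
    rw [hx', Pi.smul_apply, smul_eq_mul, mul_left_comm]

/-- `lam 0 ≥ lam 1 ≥ … ≥ 0` lists the positive eigenvalues of `T` in non-increasing order, each
repeated according to its multiplicity, and is padded with zeros if there are only finitely many. -/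
def IsEigenvalueSequence {V : Type*} [AddCommGroup V] [Module ℝ V] (T : V →ₗ[ℝ] V)
    (lam : ℕ → ℝ) : Prop :=
  Antitone lam ∧ (∀ m, 0 ≤ lam m) ∧
    ∀ r : ℝ, 0 < r →
      {m : ℕ | lam m = r}.encard = Cardinal.toENat (Module.rank ℝ (Module.End.eigenspace T r))

/-! ### Gaussian process regression and its sparse variational approximation -/

/-- The kernel matrix of the inputs `x₁, …, x_N`. -/
def kernelMatrix {D N : ℕ} (k : EuclideanSpace ℝ (Fin D) → EuclideanSpace ℝ (Fin D) → ℝ)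
    (x : Fin N → EuclideanSpace ℝ (Fin D)) : Matrix (Fin N) (Fin N) ℝ :=
  Matrix.of fun i j => k (x i) (x j)

/-- The Kullback–Leibler divergence between the Gaussian processes with mean functions `m₁, m₂` and
covariance functions `c₁, c₂`, as probability measures on functions with the product σ-algebra:
the supremum of the divergences between the finite-dimensional marginal distributions. -/
def gpKL {D : ℕ}
    (m₁ : EuclideanSpace ℝ (Fin D) → ℝ)
    (c₁ : EuclideanSpace ℝ (Fin D) → EuclideanSpace ℝ (Fin D) → ℝ)
    (m₂ : EuclideanSpace ℝ (Fin D) → ℝ)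
    (c₂ : EuclideanSpace ℝ (Fin D) → EuclideanSpace ℝ (Fin D) → ℝ) : ℝ≥0∞ :=
  ⨆ (n : ℕ) (t : Fin n → EuclideanSpace ℝ (Fin D)),
    InformationTheory.klDiv
      (multivariateGaussian (WithLp.toLp 2 fun i => m₁ (t i)) (Matrix.of fun i j => c₁ (t i) (t j)))
      (multivariateGaussian (WithLp.toLp 2 fun i => m₂ (t i)) (Matrix.of fun i j => c₂ (t i) (t j)))

/-- Mean function of the exact posterior, `k_{xf} (K + σ² I)⁻¹ y`. -/
def posteriorMean {D N : ℕ} (k : EuclideanSpace ℝ (Fin D) → EuclideanSpace ℝ (Fin D) → ℝ)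
    (σ2 : ℝ) (x : Fin N → EuclideanSpace ℝ (Fin D)) (y : EuclideanSpace ℝ (Fin N))
    (s : EuclideanSpace ℝ (Fin D)) : ℝ :=
  (fun i => k s (x i)) ⬝ᵥ ((kernelMatrix k x + σ2 • 1)⁻¹ *ᵥ (fun i => y i))

/-- Covariance function of the exact posterior, `k(s, s') - k_{sf} (K + σ² I)⁻¹ k_{fs'}`. -/
def posteriorCov {D N : ℕ} (k : EuclideanSpace ℝ (Fin D) → EuclideanSpace ℝ (Fin D) → ℝ)
    (σ2 : ℝ) (x : Fin N → EuclideanSpace ℝ (Fin D)) (s s' : EuclideanSpace ℝ (Fin D)) : ℝ :=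
  k s s' - (fun i => k s (x i)) ⬝ᵥ ((kernelMatrix k x + σ2 • 1)⁻¹ *ᵥ (fun i => k (x i) s'))

/-- Moore–Penrose inverse of a symmetric matrix (apply `r ↦ r⁻¹`, with `0 ↦ 0`, to the spectrum);
it is the inverse if the matrix is invertible. -/
def symPinv {ι : Type*} [Fintype ι] [DecidableEq ι] (A : Matrix ι ι ℝ) : Matrix ι ι ℝ :=
  cfc (fun r : ℝ => r⁻¹) A

/-- `K_{uu}` for the inducing inputs `x i`, `i ∈ Z`. -/
def inducingMatrix {D N : ℕ} (k : EuclideanSpace ℝ (Fin D) → EuclideanSpace ℝ (Fin D) → ℝ)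
    (x : Fin N → EuclideanSpace ℝ (Fin D)) (Z : Finset (Fin N)) : Matrix Z Z ℝ :=
  Matrix.of fun i j => k (x i) (x j)

/-- Mean function `k_{su} K_{uu}⁻¹ m` of the approximate posterior with `q(U) = N(m, C)`. -/
def variationalMean {D N : ℕ} (k : EuclideanSpace ℝ (Fin D) → EuclideanSpace ℝ (Fin D) → ℝ)
    (x : Fin N → EuclideanSpace ℝ (Fin D)) (Z : Finset (Fin N)) (m : Z → ℝ)
    (s : EuclideanSpace ℝ (Fin D)) : ℝ :=
  (fun i : Z => k s (x i)) ⬝ᵥ (symPinv (inducingMatrix k x Z) *ᵥ m)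

/-- Covariance function `k(s, s') + k_{su} K_{uu}⁻¹ (C - K_{uu}) K_{uu}⁻¹ k_{us'}` of the approximate
posterior with `q(U) = N(m, C)`. -/
def variationalCov {D N : ℕ} (k : EuclideanSpace ℝ (Fin D) → EuclideanSpace ℝ (Fin D) → ℝ)
    (x : Fin N → EuclideanSpace ℝ (Fin D)) (Z : Finset (Fin N)) (C : Matrix Z Z ℝ)
    (s s' : EuclideanSpace ℝ (Fin D)) : ℝ :=
  k s s' + (fun i : Z => k s (x i)) ⬝ᵥ
    ((symPinv (inducingMatrix k x Z) * (C - inducingMatrix k x Z) *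
      symPinv (inducingMatrix k x Z)) *ᵥ (fun i : Z => k (x i) s'))

/-- `KL(Q‖P)`, where `P` is the exact posterior and `Q` is the sparse variational approximation with
inducing inputs `x i`, `i ∈ Z`, and optimal Gaussian distribution `q(U)`: the minimum of the
divergence to `P` over the means and covariance matrices of `q(U)`. -/
def sparseKL {D N : ℕ} (k : EuclideanSpace ℝ (Fin D) → EuclideanSpace ℝ (Fin D) → ℝ)
    (σ2 : ℝ) (x : Fin N → EuclideanSpace ℝ (Fin D)) (y : EuclideanSpace ℝ (Fin N))
    (Z : Finset (Fin N)) : ℝ≥0∞ :=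
  ⨅ (m : Z → ℝ) (C : Matrix Z Z ℝ) (_ : C.PosSemidef),
    gpKL (variationalMean k x Z m) (variationalCov k x Z C)
      (posteriorMean k σ2 x y) (posteriorCov k σ2 x)

/-! ### Recursive ridge leverage score sampling with a rank parameter

A weighted sample of `{1, …, N}` is stored as a vector `w` of weights, zero off the sample. It
stands for the sampling matrix with columns `w i • e i`, `w i ≠ 0`; padding that matrix
with zero columns gives `diagonal w`. -/

/-- The random subset that contains each `i` independently with probability `p i`. -/
def independentSubset {N : ℕ} (p : Fin N → unitInterval) : PMF (Finset (Fin N)) :=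
  PMF.ofFintype
    (fun A => (∏ i ∈ A, ENNReal.ofReal (p i)) * ∏ i ∈ Aᶜ, ENNReal.ofReal (1 - p i)) (by
      rw [← Fintype.prod_add]
      refine Finset.prod_eq_one fun i _ => ?_
      rw [← ENNReal.ofReal_add (p i).2.1 (sub_nonneg.2 (p i).2.2)]
      simp)

/-- The sum of all but the `S` largest eigenvalues of a symmetric matrix. -/
def eigenvalueTail {N : ℕ} (S : ℕ) (A : Matrix (Fin N) (Fin N) ℝ) : ℝ :=
  open Classical in
  if h : A.IsHermitian then ∑ m with S ≤ m.val, h.eigenvalues₀ m else 0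

/-- The data-dependent ridge `S⁻¹ ∑_{m > S} λ_m(Wᵀ K W)`, with `W = diagonal w`. -/
def sampleRidge {N : ℕ} (K : Matrix (Fin N) (Fin N) ℝ) (S : ℕ) (w : Fin N → ℝ) : ℝ :=
  eigenvalueTail S (diagonal w * K * diagonal w) / S

/-- `ω⁻¹ (K - K W (Wᵀ K W + ω I)⁻¹ Wᵀ K)ᵢᵢ`, cut off at `1`. -/
def sampleLeverage {N : ℕ} (K : Matrix (Fin N) (Fin N) ℝ) (w : Fin N → ℝ) (ω : ℝ) (i : Fin N) : ℝ :=
  min 1 (ω⁻¹ *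
    (K - K * diagonal w * (diagonal w * K * diagonal w + ω • 1)⁻¹ * (diagonal w * K)) i i)

/-- The approximate ridge leverage scores at the data-dependent ridge. If that ridge is zero, they
are the limits as the ridge decreases to zero (the scores increase as the ridge decreases). -/
def approxLeverage {N : ℕ} (K : Matrix (Fin N) (Fin N) ℝ) (S : ℕ) (w : Fin N → ℝ) (i : Fin N) : ℝ :=
  if 0 < sampleRidge K S w then sampleLeverage K w (sampleRidge K S w) i
  else ⨆ ω : Set.Ioi (0 : ℝ), sampleLeverage K w ω i

/-- The inclusion probabilities `pᵢ = min {1, κ l̃ᵢ log (∑ⱼ l̃ⱼ / δ)}`, `i ∈ T`. -/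
def inclusionProb {N : ℕ} (K : Matrix (Fin N) (Fin N) ℝ) (S : ℕ) (κ δ : ℝ) (T : Finset (Fin N))
    (w : Fin N → ℝ) (i : Fin N) : unitInterval :=
  if i ∈ T then
    Set.projIcc (0 : ℝ) 1 zero_le_one
      (κ * approxLeverage K S w i * Real.log ((∑ j ∈ T, approxLeverage K S w j) / δ))
  else 0

/-- The recursive algorithm on the index set `T` with failure parameter `δ`. If
`|T| ≤ 192 log (1/δ)` keep all of `T`. Otherwise draw a uniformly random half of `T`, run the
algorithm on it with failure parameter `δ/3`, estimate the ridge and the ridge leverage scores of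
all points of `T` from the weighted sample it returns, and include each `i ∈ T` independently with
probability `pᵢ` and weight `pᵢ^(-1/2)`. The first argument bounds the depth of the
recursion; a bound of `N` is never reached (see `recursiveRLS_succ_eq`). -/
def recursiveRLS {N : ℕ} (K : Matrix (Fin N) (Fin N) ℝ) (S : ℕ) (κ : ℝ) :
    ℕ → ℝ → Finset (Fin N) → PMF (Fin N → ℝ)
  | 0, _, T => PMF.pure fun i => if i ∈ T then 1 else 0
  | n + 1, δ, T =>
    if (T.card : ℝ) ≤ 192 * Real.log (1 / δ) then PMF.pure fun i => if i ∈ T then 1 else 0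
    else
      (independentSubset fun i => if i ∈ T then ⟨1 / 2, by norm_num, by norm_num⟩ else 0).bind fun T' =>
        (recursiveRLS K S κ n (δ / 3) T').bind fun w =>
          (independentSubset (inclusionProb K S κ δ T w)).map fun A i =>
            if i ∈ A then 1 / Real.sqrt (inclusionProb K S κ δ T w i) else 0

/-- Allowing a greater depth of recursion than `n` has no effect as soon as
`N ≤ 192 log (1/δ) + n`, in particular for `n = N` and `δ ≤ 1`. -/
theorem recursiveRLS_succ_eq {N : ℕ} (K : Matrix (Fin N) (Fin N) ℝ) (S : ℕ) (κ : ℝ) (n : ℕ) :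
    ∀ (δ : ℝ) (T : Finset (Fin N)), 0 < δ → (N : ℝ) ≤ 192 * Real.log (1 / δ) + n →
      recursiveRLS K S κ (n + 1) δ T = recursiveRLS K S κ n δ T := by
  have hcard : ∀ T : Finset (Fin N), (T.card : ℝ) ≤ N := fun T => by
    exact_mod_cast (Finset.card_le_univ T).trans (by simp)
  induction n with
  | zero =>
    intro δ T hδ h
    have hT := hcard T
    simp only [Nat.cast_zero, add_zero] at h
    rw [recursiveRLS, recursiveRLS, if_pos (hT.trans h)]
  | succ n ih =>
    intro δ T hδ h
    rw [recursiveRLS.eq_2 K S κ δ T (n + 1), recursiveRLS.eq_2 K S κ δ T n]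
    split_ifs with hT
    · rfl
    · congr 1
      funext T'
      rw [ih (δ / 3) T' (by positivity)]
      have h3 : Real.log (1 / (δ / 3)) = Real.log (1 / δ) + Real.log 3 := by
        rw [← Real.log_mul (by positivity) (by norm_num)]
        congr 1
        field_simp
      have h4 : (1 : ℝ) / 192 ≤ Real.log 3 := by
        have := Real.one_sub_inv_le_log_of_pos (x := 3) (by norm_num)
        linarith [this, show (1 : ℝ) - 3⁻¹ = 2 / 3 by norm_num]
      rw [h3]
      push_cast at h
      linarith

/-- The set of inducing points selected by the algorithm for the kernel matrix `K`. -/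
def rlsInducingPoints {N : ℕ} (K : Matrix (Fin N) (Fin N) ℝ) (S : ℕ) (κ δ : ℝ) :
    PMF (Finset (Fin N)) :=
  (recursiveRLS K S κ N δ Finset.univ).map fun w => Finset.univ.filter fun i => w i ≠ 0

/-! ### The joint distribution of covariates, inducing points and observations -/

/-- Probability of an event when the covariates `x` have law `ν` and, given `x`, the index set `Z`
of the inducing points, with law `alg x`, and the observations `y`, with law `η x`, are
independent. -/
def jointProb {D N : ℕ} (ν : Measure (Fin N → EuclideanSpace ℝ (Fin D)))
    (alg : (Fin N → EuclideanSpace ℝ (Fin D)) → PMF (Finset (Fin N)))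
    (η : (Fin N → EuclideanSpace ℝ (Fin D)) → Measure (EuclideanSpace ℝ (Fin N)))
    (event : (Fin N → EuclideanSpace ℝ (Fin D)) → Finset (Fin N) →
      EuclideanSpace ℝ (Fin N) → Prop) : ℝ≥0∞ :=
  ∫⁻ x, ∑ Z : Finset (Fin N), alg x Z * η x {y | event x Z y} ∂ν

end

/-! The argument separates into a deterministic bound for the divergence, a spectral bound for
random covariates, and an analysis of the algorithm.

Deterministic part. Let R be the error of the Nyström approximation of K on Z. Take for q the
posterior law of f(Z) in the model where K is replaced by K − R. On any finite set of points both
processes are then images, under one linear map, of Gaussian laws on a weight space. Data processing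
bounds their divergence, uniformly over the points, by half of tr R/σ² + yᵀ(K − R + σ²)⁻¹y − yᵀ(K +
σ²)⁻¹y (`sparseKL_le`). If R ≤ l, then K + σ² ≤ (1 + l/σ²)(K − R + σ²), and the divergence is at
most l/(2σ²) · (N + yᵀ(K + σ²)⁻¹y) (`sparseKL_le_of_nystromResidual_le`). The quadratic form is at
most ‖y‖²/σ², and has mean N if y follows the model; Markov's inequality costs one factor 1/δ.

Covariates. The algorithm achieves l equal to the eigenvalue tail of K divided by S. By Ky Fan's
principle that tail is at most the trace of K minus S Mercer terms, whose mean is N times the tail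
of the operator spectrum (`IsEigenvalueSequence.exists_mercer`, `eigenvalueTail_le_trace_sub`). Only
the marginals of the covariates enter. Markov's inequality costs the second factor 1/δ.

Algorithm. Write K = BBᵀ and compare the weighted Gram matrix of the sampled rows of B with the full
one. A good sample (`IsGoodSample`) approximates the Gram matrix relative to Gram plus ridge and
also its eigenvalue tail, because the ridge is itself estimated from the sample. Matrix Bernstein
with intrinsic dimension, obtained from Golden–Thompson, shows that sampling by overestimates of the
ridge leverage scores yields a good sample (`bernoulliProb_not_isGoodSample`). Deleting rows lowers
both Gram matrix and ridge and so raises scores; hence a good sample of any subset T' of T gives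
valid overestimates for T up to a factor 2, and accuracy passes through the recursion whatever T'
is. The randomness of the half matters only for the number of points, and only at the outermost
level. Scaling down O(S log(S/δ)) rows makes all scores small (`exists_reweighting`), so a random
half is spectrally comparable with the reweighted rows; truncated scores relative to the half
therefore have a small sum (`bernoulliProb_half_leverage`). Since the estimated ridge may be zero,
estimates are made at ridge + s with s > 0 and passed to the limit. -/

set_option linter.unusedSectionVars false

/-! ### The Golden–Thompson inequality. -/

section GoldenThompson

open NormedSpace Filter Topology

variable {n : Type*} [Fintype n]

theorem Matrix.trace_mul_transpose_self_nonneg (M : Matrix n n ℝ) : 0 ≤ (M * Mᵀ).trace := by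
  simpa using (Matrix.posSemidef_self_mul_conjTranspose M).trace_nonneg

theorem Matrix.trace_mul_self_le (M : Matrix n n ℝ) : (M * M).trace ≤ (M * Mᵀ).trace := by
  have h := Matrix.trace_mul_transpose_self_nonneg (M - Mᵀ)
  have e : ((M - Mᵀ) * (M - Mᵀ)ᵀ).trace =
      (M * Mᵀ).trace - (M * M).trace - ((M * M)ᵀ).trace + (Mᵀ * M).trace := by
    simp only [transpose_sub, transpose_transpose, transpose_mul, sub_mul, mul_sub, trace_sub]
    ring
  rw [e, trace_transpose, trace_mul_comm Mᵀ M] at h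
  linarith

theorem Matrix.two_mul_trace_mul_le {P R : Matrix n n ℝ} (hP : Pᵀ = P) (hR : Rᵀ = R) :
    2 * (P * R).trace ≤ (P * P).trace + (R * R).trace := by
  have h := Matrix.trace_mul_transpose_self_nonneg (P - R)
  rw [transpose_sub, hP, hR] at h
  simp only [sub_mul, mul_sub, trace_sub] at h
  rw [trace_mul_comm R P] at h
  linarith

variable [DecidableEq n]

theorem Matrix.mul_pow_succ_eq (A B : Matrix n n ℝ) (k : ℕ) :
    (A * B) ^ (k + 1) = A * (B * A) ^ k * B := by
  induction k with
  | zero => simp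
  | succ k ih => rw [pow_succ (A * B), ih, pow_succ (B * A)]; simp only [mul_assoc]

theorem Matrix.trace_mul_pow_comm (A B : Matrix n n ℝ) (k : ℕ) :
    ((A * B) ^ k).trace = ((B * A) ^ k).trace := by
  cases k with
  | zero => simp
  | succ k => rw [mul_pow_succ_eq, trace_mul_comm, ← mul_assoc, ← pow_succ']

/-- One induction proves both families because each feeds the other. For general M, the previous
case is applied to M * M, the product is regrouped cyclically into the symmetric factors M Mᵀ and Mᵀ
M, and 2 tr(PR) ≤ tr P² + tr R² finishes. For symmetric X and Y the first family is applied to M = X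
* Y. -/
theorem Matrix.trace_pow_two_pow_le (j : ℕ) :
    (∀ M : Matrix n n ℝ, (M ^ 2 ^ (j + 1)).trace ≤ ((M * Mᵀ) ^ 2 ^ j).trace) ∧
      ∀ X Y : Matrix n n ℝ, Xᵀ = X → Yᵀ = Y →
        ((X * Y) ^ 2 ^ j).trace ≤ (X ^ 2 ^ j * Y ^ 2 ^ j).trace := by
  induction j with
  | zero => exact ⟨fun M => by simpa [pow_two] using M.trace_mul_self_le, by simp⟩
  | succ j ih =>
    obtain ⟨ha, hT⟩ := ih
    refine ⟨fun M => ?_, fun X Y hX hY => ?_⟩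
    · have h1 := ha (M * M)
      rw [← pow_two, ← pow_mul, ← pow_succ' 2] at h1
      rw [pow_two, transpose_mul, mul_assoc, trace_mul_pow_comm,
        show M * (Mᵀ * Mᵀ) * M = (M * Mᵀ) * (Mᵀ * M) by simp only [mul_assoc]] at h1
      have h2 := hT (M * Mᵀ) (Mᵀ * M) (by simp) (by simp)
      have h3 := Matrix.two_mul_trace_mul_le (P := (M * Mᵀ) ^ 2 ^ j) (R := (Mᵀ * M) ^ 2 ^ j)
        (by simp [transpose_pow]) (by simp [transpose_pow])
      rw [← pow_two, ← pow_two, ← pow_mul, ← pow_mul, ← pow_succ 2, trace_mul_pow_comm Mᵀ M] at h3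
      linarith
    · have h1 := ha (X * Y)
      rw [transpose_mul, hX, hY, mul_assoc, trace_mul_pow_comm X (Y * (Y * X)),
        show Y * (Y * X) * X = (Y * Y) * (X * X) by simp only [mul_assoc]] at h1
      have h2 := hT (Y * Y) (X * X) (by simp [hY]) (by simp [hX])
      rw [← pow_two, ← pow_two, ← pow_mul, ← pow_mul, ← pow_succ' 2, trace_mul_comm,
        pow_two, pow_two] at h2
      exact h1.trans h2

/-- Telescoping, one factor at a time. The assumption 1 ≤ K permits the exponent m in place of m −
1. -/
theorem norm_pow_sub_pow_le_mul {𝔸 : Type*} [NormedRing 𝔸] [NormOneClass 𝔸] {X Y : 𝔸} {K : ℝ}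
    (hX : ‖X‖ ≤ K) (hY : ‖Y‖ ≤ K) (hK : 1 ≤ K) (m : ℕ) :
    ‖X ^ m - Y ^ m‖ ≤ m * ‖X - Y‖ * K ^ m := by
  induction m with
  | zero => simp
  | succ m ih =>
    have e : X ^ (m + 1) - Y ^ (m + 1) = X ^ m * (X - Y) + (X ^ m - Y ^ m) * Y := by
      rw [pow_succ, pow_succ]; noncomm_ring
    rw [e]
    have h0 : (0 : ℝ) ≤ K ^ m := by positivity
    calc ‖X ^ m * (X - Y) + (X ^ m - Y ^ m) * Y‖
        ≤ ‖X ^ m‖ * ‖X - Y‖ + ‖X ^ m - Y ^ m‖ * ‖Y‖ :=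
          (norm_add_le _ _).trans (add_le_add (norm_mul_le _ _) (norm_mul_le _ _))
      _ ≤ K ^ m * ‖X - Y‖ + (m * ‖X - Y‖ * K ^ m) * K := by
          gcongr
          exact (norm_pow_le X m).trans (pow_le_pow_left₀ (norm_nonneg _) hX m)
      _ ≤ K ^ (m + 1) * ‖X - Y‖ + (m * ‖X - Y‖ * K ^ m) * K := by
          gcongr
          exact Nat.le_succ m
      _ = _ := by push_cast; ring

theorem NormedSpace.norm_exp_le_exp_norm {𝔸 : Type*} [NormedRing 𝔸] [NormOneClass 𝔸]
    [NormedAlgebra ℝ 𝔸] [CompleteSpace 𝔸] (x : 𝔸) : ‖exp x‖ ≤ Real.exp ‖x‖ := by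
  rw [congrFun (exp_eq_tsum ℝ) x, Real.exp_eq_exp_ℝ, congrFun (exp_eq_tsum ℝ) ‖x‖]
  refine tsum_of_norm_bounded (expSeries_summable' (𝕂 := ℝ) ‖x‖).hasSum fun m => ?_
  rw [norm_smul, norm_inv, Real.norm_natCast, smul_eq_mul]
  gcongr
  exact norm_pow_le x m

/-- The Lie product formula. The curves e^{uA} e^{uB} and e^{u(A+B)} have the same derivative at u =
0, so they differ by o(1/m) at u = 1/m; taking m-th powers multiplies the difference by at most m
e^{‖A‖+‖B‖}. -/
theorem NormedSpace.tendsto_exp_mul_exp_pow {𝔸 : Type*} [NormedRing 𝔸] [NormOneClass 𝔸]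
    [NormedAlgebra ℝ 𝔸] [CompleteSpace 𝔸] (A B : 𝔸) :
    Tendsto (fun m : ℕ => (exp ((m : ℝ)⁻¹ • A) * exp ((m : ℝ)⁻¹ • B)) ^ m) atTop
      (𝓝 (exp (A + B))) := by
  have hA := hasDerivAt_exp_smul_const (𝕂 := ℝ) A (0 : ℝ)
  have hB := hasDerivAt_exp_smul_const (𝕂 := ℝ) B (0 : ℝ)
  have hAB := hasDerivAt_exp_smul_const (𝕂 := ℝ) (A + B) (0 : ℝ)
  have hd := (hA.mul hB).sub hAB
  simp only [zero_smul, exp_zero, one_mul, mul_one, sub_self] at hd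
  have hs := hd.tendsto_slope_zero
  have h0 : ((((fun u : ℝ => exp (u • A)) * fun u : ℝ => exp (u • B)) -
      fun u : ℝ => exp (u • (A + B))) 0) = 0 := by simp
  simp only [zero_add, h0, sub_zero] at hs
  have hm : Tendsto (fun m : ℕ => (m : ℝ)⁻¹) atTop (𝓝[≠] 0) :=
    (tendsto_inv_atTop_nhdsGT_zero.comp tendsto_natCast_atTop_atTop).mono_right
      (nhdsWithin_mono _ fun x hx => ne_of_gt hx)
  have hs2 := (hs.comp hm).norm
  rw [norm_zero] at hs2
  rw [tendsto_iff_norm_sub_tendsto_zero]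
  have hb := hs2.mul_const (Real.exp (‖A‖ + ‖B‖))
  rw [zero_mul] at hb
  refine squeeze_zero' (Eventually.of_forall fun _ => norm_nonneg _) ?_ hb
  filter_upwards [eventually_gt_atTop 0] with m hm0
  have hm1 : (0 : ℝ) < m := by exact_mod_cast hm0
  have hexp : exp (A + B) = exp ((m : ℝ)⁻¹ • (A + B)) ^ m := by
    let := NormedAlgebra.restrictScalars ℚ ℝ 𝔸
    rw [← exp_nsmul, ← Nat.cast_smul_eq_nsmul ℝ, smul_smul, mul_inv_cancel₀ hm1.ne', one_smul]
  have hn : ∀ C : 𝔸, ‖exp C‖ ≤ Real.exp ‖C‖ := fun C => norm_exp_le_exp_norm C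
  set K := Real.exp ((m : ℝ)⁻¹ * (‖A‖ + ‖B‖)) with hKdef
  have hX : ‖exp ((m : ℝ)⁻¹ • A) * exp ((m : ℝ)⁻¹ • B)‖ ≤ K := by
    refine (norm_mul_le _ _).trans ((mul_le_mul (hn _) (hn _) (norm_nonneg _)
      (Real.exp_nonneg _)).trans ?_)
    rw [← Real.exp_add, norm_smul, norm_smul, norm_inv, Real.norm_natCast, hKdef, mul_add]
  have hY : ‖exp ((m : ℝ)⁻¹ • (A + B))‖ ≤ K := by
    refine (hn _).trans (Real.exp_le_exp.2 ?_)
    rw [norm_smul, norm_inv, Real.norm_natCast]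
    gcongr
    exact norm_add_le _ _
  have hK1 : 1 ≤ K := Real.one_le_exp (by positivity)
  have hKm : K ^ m = Real.exp (‖A‖ + ‖B‖) := by
    rw [hKdef, ← Real.exp_nat_mul, ← mul_assoc, mul_inv_cancel₀ hm1.ne', one_mul]
  rw [hexp]
  refine (norm_pow_sub_pow_le_mul hX hY hK1 m).trans (le_of_eq ?_)
  rw [hKm, Function.comp_apply, norm_smul, inv_inv, Real.norm_natCast]
  rfl

open scoped Matrix.Norms.Operator in
/-- The Golden–Thompson inequality. -/
theorem Matrix.trace_exp_add_le {A B : Matrix n n ℝ} (hA : Aᵀ = A) (hB : Bᵀ = B) :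
    (exp (A + B)).trace ≤ (exp A * exp B).trace := by
  cases isEmpty_or_nonempty n
  · simp [Matrix.trace]
  have h := NormedSpace.tendsto_exp_mul_exp_pow A B
  -- The trace inequality is available for exponents 2 ^ j only, so the product formula is used
  -- along that subsequence.
  have h2 := h.comp (tendsto_pow_atTop_atTop_of_one_lt (r := 2) (by norm_num))
  have h3 := (Continuous.matrix_trace continuous_id).tendsto (exp (A + B)) |>.comp h2
  refine le_of_tendsto h3 (Eventually.of_forall fun j => ?_)
  have hj : (0 : ℝ) < (2 ^ j : ℕ) := by positivity
  have hp : ∀ C : Matrix n n ℝ, exp (((2 ^ j : ℕ) : ℝ)⁻¹ • C) ^ 2 ^ j = exp C := fun C => by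
    rw [← Matrix.exp_nsmul, ← Nat.cast_smul_eq_nsmul ℝ, smul_smul, mul_inv_cancel₀ hj.ne', one_smul]
  have := (Matrix.trace_pow_two_pow_le j).2 (exp (((2 ^ j : ℕ) : ℝ)⁻¹ • A))
    (exp (((2 ^ j : ℕ) : ℝ)⁻¹ • B)) (by rw [← exp_transpose, transpose_smul, hA])
    (by rw [← exp_transpose, transpose_smul, hB])
  rw [hp, hp] at this
  exact this

end GoldenThompson

/-! ### The Loewner order on real symmetric matrices. -/

section LoewnerOrder

open scoped MatrixOrder

variable {m n : Type*} [Fintype m] [Fintype n]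

theorem Matrix.IsHermitian.transpose_eq {A : Matrix n n ℝ} (hA : A.IsHermitian) : Aᵀ = A := by
  simpa [Matrix.IsHermitian, conjTranspose_eq_transpose_of_trivial] using hA

theorem Matrix.isHermitian_of_transpose_eq {A : Matrix n n ℝ} (hA : Aᵀ = A) : A.IsHermitian := by
  simpa [Matrix.IsHermitian, conjTranspose_eq_transpose_of_trivial] using hA

theorem Matrix.posSemidef_iff_transpose {A : Matrix n n ℝ} :
    A.PosSemidef ↔ Aᵀ = A ∧ ∀ x, 0 ≤ x ⬝ᵥ A *ᵥ x := by
  rw [posSemidef_iff_dotProduct_mulVec]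
  simp [Matrix.IsHermitian, conjTranspose_eq_transpose_of_trivial]

theorem Matrix.le_iff_dotProduct {A B : Matrix n n ℝ} (hA : Aᵀ = A) (hB : Bᵀ = B) :
    A ≤ B ↔ ∀ x, x ⬝ᵥ A *ᵥ x ≤ x ⬝ᵥ B *ᵥ x := by
  rw [Matrix.le_iff, posSemidef_iff_transpose]
  simp [hA, hB, sub_mulVec, dotProduct_sub]

theorem Matrix.dotProduct_mulVec_mono {A B : Matrix n n ℝ} (h : A ≤ B) (x : n → ℝ) :
    x ⬝ᵥ A *ᵥ x ≤ x ⬝ᵥ B *ᵥ x := by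
  have := (posSemidef_iff_transpose.1 (Matrix.le_iff.1 h)).2 x
  simpa [sub_mulVec, dotProduct_sub] using this

theorem Matrix.trace_mono {A B : Matrix n n ℝ} (h : A ≤ B) : A.trace ≤ B.trace := by
  have := (Matrix.le_iff.1 h).trace_nonneg
  rw [trace_sub] at this
  linarith

theorem Matrix.conj_mono {A B : Matrix n n ℝ} (h : A ≤ B) (C : Matrix m n ℝ) :
    C * A * Cᵀ ≤ C * B * Cᵀ := by
  rw [Matrix.le_iff] at h ⊢
  simpa [Matrix.mul_sub, Matrix.sub_mul] using h.mul_mul_conjTranspose_same C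

theorem Matrix.conj_mono' {A B : Matrix n n ℝ} (h : A ≤ B) (C : Matrix n m ℝ) :
    Cᵀ * A * C ≤ Cᵀ * B * C := by
  simpa using Matrix.conj_mono h Cᵀ

theorem Matrix.smul_mono_right {A B : Matrix n n ℝ} (h : A ≤ B) {c : ℝ} (hc : 0 ≤ c) :
    c • A ≤ c • B := by
  rw [Matrix.le_iff] at h ⊢
  rw [← smul_sub]
  exact h.smul hc

theorem Matrix.smul_mono_left {A : Matrix n n ℝ} (hA : 0 ≤ A) {c d : ℝ} (h : c ≤ d) :
    c • A ≤ d • A := by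
  rw [Matrix.le_iff, ← sub_smul]
  exact (nonneg_iff_posSemidef.1 hA).smul (sub_nonneg.2 h)

theorem Matrix.vecMulVec_self_nonneg (c : n → ℝ) : 0 ≤ vecMulVec c c := by
  rw [nonneg_iff_posSemidef]
  simpa using posSemidef_vecMulVec_self_star c

theorem Matrix.transpose_vecMulVec_self (c : n → ℝ) : (vecMulVec c c)ᵀ = vecMulVec c c := by
  simp [transpose_vecMulVec]

theorem Matrix.dotProduct_vecMulVec_mulVec (c x : n → ℝ) :
    x ⬝ᵥ vecMulVec c c *ᵥ x = (c ⬝ᵥ x) ^ 2 := by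
  simp [vecMulVec_mulVec, dotProduct_comm x c, pow_two]

theorem Matrix.trace_mul_nonneg {A B : Matrix n n ℝ} (hA : 0 ≤ A) (hB : 0 ≤ B) :
    0 ≤ (A * B).trace := by
  classical
  rw [nonneg_iff_posSemidef] at hA hB
  obtain ⟨C, rfl⟩ := CStarAlgebra.nonneg_iff_eq_star_mul_self.1 (nonneg_iff_posSemidef.2 hA)
  rw [mul_assoc, trace_mul_comm]
  exact (hB.mul_mul_conjTranspose_same C).trace_nonneg

theorem Matrix.trace_mul_mono {A B C : Matrix n n ℝ} (hA : 0 ≤ A) (h : B ≤ C) :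
    (A * B).trace ≤ (A * C).trace := by
  have := Matrix.trace_mul_nonneg hA (sub_nonneg.2 h)
  rw [Matrix.mul_sub, trace_sub] at this
  linarith

variable [DecidableEq n]

/-- Real symmetric matrices are orthogonally diagonalizable. -/
theorem Matrix.IsHermitian.exists_orthogonal_diagonal {A : Matrix n n ℝ} (hA : A.IsHermitian) :
    ∃ U : Matrix n n ℝ, U * Uᵀ = 1 ∧ Uᵀ * U = 1 ∧ A = U * diagonal hA.eigenvalues * Uᵀ := by
  refine ⟨hA.eigenvectorUnitary, ?_, ?_, ?_⟩
  · simpa [star_eq_conjTranspose] using Unitary.coe_mul_star_self hA.eigenvectorUnitary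
  · simpa [star_eq_conjTranspose] using Unitary.coe_star_mul_self hA.eigenvectorUnitary
  · conv_lhs => rw [hA.spectral_theorem]
    simp [Unitary.conjStarAlgAut_apply, star_eq_conjTranspose]

theorem Matrix.IsHermitian.le_smul_one_iff {A : Matrix n n ℝ} (hA : A.IsHermitian) (t : ℝ) :
    A ≤ t • 1 ↔ ∀ i, hA.eigenvalues i ≤ t := by
  obtain ⟨U, h1, h2, h3⟩ := hA.exists_orthogonal_diagonal
  constructor
  · intro h i
    have h4 := Matrix.conj_mono' h U
    rw [h3] at h4
    have h5 : Uᵀ * (U * diagonal hA.eigenvalues * Uᵀ) * U = diagonal hA.eigenvalues := by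
      rw [show Uᵀ * (U * diagonal hA.eigenvalues * Uᵀ) * U =
        (Uᵀ * U) * diagonal hA.eigenvalues * (Uᵀ * U) by simp only [mul_assoc], h2]
      simp
    rw [h5] at h4
    have h6 := (Matrix.le_iff.1 h4).diag_nonneg (i := i)
    simp [h2] at h6
    exact h6
  · intro h
    have h4 : diagonal hA.eigenvalues ≤ t • (1 : Matrix n n ℝ) := by
      rw [Matrix.le_iff, smul_one_eq_diagonal, diagonal_sub]
      exact PosSemidef.diagonal fun i => sub_nonneg.2 (h i)
    have h5 := Matrix.conj_mono h4 U
    rw [← h3] at h5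
    simpa [h1] using h5

end LoewnerOrder

/-! ### Trace exponentials along rank-one directions. -/

section RankOneExp

open NormedSpace
open scoped MatrixOrder

/-- Every positive power of t P is t ^ k P, so the exponential series sums to e^t on P; the term k =
0 leaves 1 − P. -/
theorem NormedSpace.exp_smul_of_mul_self_eq {𝔸 : Type*} [NormedRing 𝔸] [NormedAlgebra ℝ 𝔸]
    [CompleteSpace 𝔸] {P : 𝔸} (hP : P * P = P) (t : ℝ) :
    exp (t • P) = 1 + (Real.exp t - 1) • P := by
  have h1 := exp_series_hasSum_exp' (𝕂 := ℝ) (t • P)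
  have h2 : HasSum (fun k : ℕ => (k.factorial : ℝ)⁻¹ • t ^ k) (Real.exp t) := by
    rw [Real.exp_eq_exp_ℝ]; exact exp_series_hasSum_exp' (𝕂 := ℝ) t
  have h3 := (h2.smul_const P).add (hasSum_ite_eq 0 (1 - P))
  have hpow : ∀ k : ℕ, P ^ (k + 1) = P := fun k => by
    induction k with
    | zero => simp
    | succ k ih => rw [pow_succ, ih, hP]
  have e : 1 + (Real.exp t - 1) • P = Real.exp t • P + (1 - P) := by
    rw [sub_smul, one_smul]; abel
  rw [e]
  refine h1.unique ?_
  convert h3 using 1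
  funext k
  cases k with
  | zero => simp
  | succ k => simp [smul_pow, hpow, smul_smul]

variable {n : Type*} [Fintype n] [DecidableEq n]

open scoped Matrix.Norms.Operator in
theorem Matrix.exp_smul_vecMulVec {c : n → ℝ} (hc : c ⬝ᵥ c ≠ 0) (z : ℝ) :
    exp (z • vecMulVec c c) =
      1 + ((Real.exp (z * (c ⬝ᵥ c)) - 1) / (c ⬝ᵥ c)) • vecMulVec c c := by
  have hP : ((c ⬝ᵥ c)⁻¹ • vecMulVec c c) * ((c ⬝ᵥ c)⁻¹ • vecMulVec c c) =
      (c ⬝ᵥ c)⁻¹ • vecMulVec c c := by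
    rw [smul_mul_smul_comm, vecMulVec_mul_vecMulVec, vecMulVec_smul, smul_smul,
      mul_assoc, inv_mul_cancel₀ hc, mul_one]
  have h := NormedSpace.exp_smul_of_mul_self_eq hP (z * (c ⬝ᵥ c))
  rw [smul_smul, mul_assoc, mul_inv_cancel₀ hc, mul_one, smul_smul, ← div_eq_mul_inv] at h
  exact h

open scoped Matrix.Norms.Operator in
theorem Matrix.exp_nonneg {H : Matrix n n ℝ} (hH : Hᵀ = H) : 0 ≤ exp H := by
  have e : exp H = exp ((2 : ℝ)⁻¹ • H) * (exp ((2 : ℝ)⁻¹ • H))ᵀ := by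
    rw [← exp_transpose, transpose_smul, hH, ← Matrix.exp_add_of_commute _ _ (Commute.refl _),
      ← add_smul]
    norm_num
  rw [e, nonneg_iff_posSemidef]
  simpa using posSemidef_self_mul_conjTranspose (exp ((2 : ℝ)⁻¹ • H))

theorem Matrix.trace_exp_eq_sum {H : Matrix n n ℝ} (hH : H.IsHermitian) :
    (exp H).trace = ∑ i, Real.exp (hH.eigenvalues i) := by
  obtain ⟨U, h1, h2, h3⟩ := hH.exists_orthogonal_diagonal
  have hU : IsUnit U := (isUnit_iff_exists_inv).2 ⟨Uᵀ, h1⟩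
  have hi : U⁻¹ = Uᵀ := inv_eq_right_inv h1
  conv_lhs => rw [h3, ← hi, exp_conj _ _ hU, hi, trace_mul_comm, ← mul_assoc, h2, one_mul,
    exp_diagonal, trace_diagonal]
  refine Finset.sum_congr rfl fun i _ => ?_
  rw [Pi.coe_exp, Real.exp_eq_exp_ℝ]

/-- Two-point averaging of the trace exponential along a rank-one direction. -/
theorem Matrix.two_point_trace_exp_le {H : Matrix n n ℝ} (hH : Hᵀ = H) (c : n → ℝ)
    {p z₁ z₀ v : ℝ} (hp0 : 0 ≤ p) (hp1 : p ≤ 1)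
    (h : p * Real.exp (z₁ * (c ⬝ᵥ c)) + (1 - p) * Real.exp (z₀ * (c ⬝ᵥ c)) ≤
      Real.exp (v * (c ⬝ᵥ c))) :
    p * (exp (H + z₁ • vecMulVec c c)).trace + (1 - p) * (exp (H + z₀ • vecMulVec c c)).trace ≤
      (exp (H + v • vecMulVec c c)).trace := by
  by_cases hc : c ⬝ᵥ c = 0
  · have : c = 0 := dotProduct_self_eq_zero.1 hc
    subst this
    simp
    linarith
  have hs : 0 < c ⬝ᵥ c := lt_of_le_of_ne (by simpa using dotProduct_self_star_nonneg c) (Ne.symm hc)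
  set C := vecMulVec c c with hC
  have hCt : Cᵀ = C := Matrix.transpose_vecMulVec_self c
  set H' := H + v • C with hH'
  have hH't : H'ᵀ = H' := by rw [hH', transpose_add, transpose_smul, hH, hCt]
  set q := (exp H' * C).trace with hq
  have hq0 : 0 ≤ q :=
    Matrix.trace_mul_nonneg (Matrix.exp_nonneg hH't) (Matrix.vecMulVec_self_nonneg c)
  have key : ∀ z : ℝ, (exp (H + z • C)).trace ≤
      (exp H').trace + (Real.exp ((z - v) * (c ⬝ᵥ c)) - 1) / (c ⬝ᵥ c) * q := fun z => by
    have e : H + z • C = H' + (z - v) • C := by rw [hH', sub_smul]; abel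
    rw [e]
    refine (Matrix.trace_exp_add_le hH't (by rw [transpose_smul, hCt])).trans (le_of_eq ?_)
    rw [Matrix.exp_smul_vecMulVec hc, mul_add, mul_one, trace_add, Matrix.mul_smul, trace_smul,
      smul_eq_mul]
  have h' : p * Real.exp ((z₁ - v) * (c ⬝ᵥ c)) + (1 - p) * Real.exp ((z₀ - v) * (c ⬝ᵥ c)) ≤ 1 := by
    rw [sub_mul z₁, sub_mul z₀, Real.exp_sub, Real.exp_sub, ← mul_div_assoc, ← mul_div_assoc, ← add_div,
      div_le_one (Real.exp_pos _)]
    exact h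
  have k1 := mul_le_mul_of_nonneg_left (key z₁) hp0
  have k0 := mul_le_mul_of_nonneg_left (key z₀) (sub_nonneg.2 hp1)
  have hfin : (p * Real.exp ((z₁ - v) * (c ⬝ᵥ c)) + (1 - p) * Real.exp ((z₀ - v) * (c ⬝ᵥ c)) - 1)
      / (c ⬝ᵥ c) * q ≤ 0 :=
    mul_nonpos_of_nonpos_of_nonneg (div_nonpos_of_nonpos_of_nonneg (by linarith) hs.le) hq0
  have e2 : p * ((exp H').trace + (Real.exp ((z₁ - v) * (c ⬝ᵥ c)) - 1) / (c ⬝ᵥ c) * q) +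
      (1 - p) * ((exp H').trace + (Real.exp ((z₀ - v) * (c ⬝ᵥ c)) - 1) / (c ⬝ᵥ c) * q) =
      (exp H').trace + (p * Real.exp ((z₁ - v) * (c ⬝ᵥ c)) +
        (1 - p) * Real.exp ((z₀ - v) * (c ⬝ᵥ c)) - 1) / (c ⬝ᵥ c) * q := by ring
  linarith

end RankOneExp

/-! ### Expectations over independent Bernoulli selections. -/

section Bernoulli

open NormedSpace
open scoped MatrixOrder

variable {ι : Type*} [DecidableEq ι]

/-- The expectation of `f A`, where `A` contains each element `i` of `s` independently with
probability `p i`. -/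
noncomputable def bernoulliExp (p : ι → ℝ) (s : Finset ι) (f : Finset ι → ℝ) : ℝ :=
  ∑ A ∈ s.powerset, ((∏ i ∈ A, p i) * ∏ i ∈ s \ A, (1 - p i)) * f A

theorem bernoulliExp_insert (p : ι → ℝ) {s : Finset ι} {i : ι} (hi : i ∉ s) (f : Finset ι → ℝ) :
    bernoulliExp p (insert i s) f =
      p i * bernoulliExp p s (fun A => f (insert i A)) + (1 - p i) * bernoulliExp p s f := by
  rw [bernoulliExp, Finset.sum_powerset_insert hi, add_comm, bernoulliExp, bernoulliExp,
    Finset.mul_sum, Finset.mul_sum]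
  congr 1
  · refine Finset.sum_congr rfl fun A hA => ?_
    have hiA : i ∉ A := fun h => hi (Finset.mem_powerset.1 hA h)
    rw [Finset.prod_insert hiA, Finset.insert_sdiff_insert, Finset.sdiff_insert,
      Finset.erase_eq_of_notMem (fun h => hi (Finset.sdiff_subset h))]
    ring
  · refine Finset.sum_congr rfl fun A hA => ?_
    have hiA : i ∉ A := fun h => hi (Finset.mem_powerset.1 hA h)
    rw [Finset.insert_sdiff_of_notMem _ hiA,
      Finset.prod_insert (fun h => hi (Finset.sdiff_subset h))]
    ring

theorem bernoulliExp_add (p : ι → ℝ) (s : Finset ι) (f g : Finset ι → ℝ) :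
    bernoulliExp p s (fun A => f A + g A) = bernoulliExp p s f + bernoulliExp p s g := by
  simp [bernoulliExp, mul_add, Finset.sum_add_distrib]

theorem bernoulliExp_mul_right (p : ι → ℝ) (s : Finset ι) (f : Finset ι → ℝ) (c : ℝ) :
    bernoulliExp p s (fun A => f A * c) = bernoulliExp p s f * c := by
  simp only [bernoulliExp, Finset.sum_mul, mul_assoc]

theorem bernoulliExp_const (p : ι → ℝ) (s : Finset ι) (c : ℝ) :
    bernoulliExp p s (fun _ => c) = c := by
  rw [bernoulliExp, ← Finset.sum_mul, ← Finset.prod_add]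
  simp

theorem bernoulliExp_mono {p : ι → ℝ} (hp0 : ∀ i, 0 ≤ p i) (hp1 : ∀ i, p i ≤ 1) (s : Finset ι)
    {f g : Finset ι → ℝ} (h : ∀ A, f A ≤ g A) : bernoulliExp p s f ≤ bernoulliExp p s g :=
  Finset.sum_le_sum fun A _ => mul_le_mul_of_nonneg_left (h A)
    (mul_nonneg (Finset.prod_nonneg fun i _ => hp0 i)
      (Finset.prod_nonneg fun i _ => sub_nonneg.2 (hp1 i)))

variable {n : Type*} [Fintype n] [DecidableEq n]

/-- A matrix Laplace transform computed one index at a time: conditioning on i shifts H by a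
multiple of the i-th rank-one matrix, the induction hypothesis treats the other indices, and the
two-point inequality replaces the random multiple by v i. The subtracted trace has mean zero by
`hmean`. It is carried along because tr exp Y − tr Y is never below the dimension, which later lets
the dimension cancel. The factor c i ⬝ᵥ c i in `hmean` admits indices with p i = 0 and c i = 0. -/
theorem bernoulliExp_trace_exp_le {p : ι → ℝ} (hp0 : ∀ i, 0 ≤ p i) (hp1 : ∀ i, p i ≤ 1)
    (c : ι → n → ℝ) (z₁ z₀ v : ι → ℝ)
    (hmean : ∀ i, (p i * z₁ i + (1 - p i) * z₀ i) * (c i ⬝ᵥ c i) = 0)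
    (hexp : ∀ i, p i * Real.exp (z₁ i * (c i ⬝ᵥ c i)) +
      (1 - p i) * Real.exp (z₀ i * (c i ⬝ᵥ c i)) ≤ Real.exp (v i * (c i ⬝ᵥ c i)))
    (s : Finset ι) :
    ∀ H : Matrix n n ℝ, Hᵀ = H →
      bernoulliExp p s (fun A =>
          (exp (H + ∑ i ∈ s, (if i ∈ A then z₁ i else z₀ i) • vecMulVec (c i) (c i))).trace -
            (∑ i ∈ s, (if i ∈ A then z₁ i else z₀ i) • vecMulVec (c i) (c i)).trace) ≤
        (exp (H + ∑ i ∈ s, v i • vecMulVec (c i) (c i))).trace := by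
  have hCt : ∀ i, (vecMulVec (c i) (c i))ᵀ = vecMulVec (c i) (c i) :=
    fun i => Matrix.transpose_vecMulVec_self (c i)
  induction s using Finset.induction_on with
  | empty => intro H _; simp [bernoulliExp]
  | insert i s hi ih =>
    intro H hH
    set C := vecMulVec (c i) (c i) with hC
    rw [bernoulliExp_insert p hi]
    have step : ∀ (A : Finset ι) (z : ℝ) (B : Finset ι),
        (∀ j ∈ s, (j ∈ B ↔ j ∈ A)) → (if i ∈ B then z₁ i else z₀ i) = z →
        (exp (H + ∑ j ∈ insert i s, (if j ∈ B then z₁ j else z₀ j) • vecMulVec (c j) (c j))).trace -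
          (∑ j ∈ insert i s, (if j ∈ B then z₁ j else z₀ j) • vecMulVec (c j) (c j)).trace =
        ((exp ((H + z • C) +
            ∑ j ∈ s, (if j ∈ A then z₁ j else z₀ j) • vecMulVec (c j) (c j))).trace -
          (∑ j ∈ s, (if j ∈ A then z₁ j else z₀ j) • vecMulVec (c j) (c j)).trace) +
          -(z * (c i ⬝ᵥ c i)) := by
      intro A z B hB hz
      rw [Finset.sum_insert hi, hz, ← add_assoc, trace_add, trace_smul, trace_vecMulVec]
      have : ∑ j ∈ s, (if j ∈ B then z₁ j else z₀ j) • vecMulVec (c j) (c j) =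
          ∑ j ∈ s, (if j ∈ A then z₁ j else z₀ j) • vecMulVec (c j) (c j) :=
        Finset.sum_congr rfl fun j hj => by simp only [hB j hj]
      rw [this, smul_eq_mul]
      ring
    have hcong : ∀ f g : Finset ι → ℝ, (∀ A ⊆ s, f A = g A) →
        bernoulliExp p s f = bernoulliExp p s g := fun f g h =>
      Finset.sum_congr rfl fun A hA => by rw [h A (Finset.mem_powerset.1 hA)]
    rw [hcong _ _ fun A hA => step A (z₁ i) (insert i A)
        (fun j hj => by
          have : j ≠ i := fun h => hi (h ▸ hj)
          simp [this]) (by simp),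
      hcong _ _ fun A hA => step A (z₀ i) A (fun j _ => Iff.rfl) (if_neg fun h => hi (hA h)),
      bernoulliExp_add, bernoulliExp_add, bernoulliExp_const, bernoulliExp_const]
    have h1 := ih (H + z₁ i • C) (by rw [transpose_add, transpose_smul, hH, hCt])
    have h0 := ih (H + z₀ i • C) (by rw [transpose_add, transpose_smul, hH, hCt])
    have hV : (∑ j ∈ s, v j • vecMulVec (c j) (c j))ᵀ = ∑ j ∈ s, v j • vecMulVec (c j) (c j) := by
      simp only [transpose_sum, transpose_smul, hCt]
    have h2 := Matrix.two_point_trace_exp_le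
      (H := H + ∑ j ∈ s, v j • vecMulVec (c j) (c j)) (by rw [transpose_add, hH, hV]) (c i)
      (hp0 i) (hp1 i) (hexp i)
    rw [Finset.sum_insert hi]
    have e : ∀ z : ℝ, H + z • C + ∑ j ∈ s, v j • vecMulVec (c j) (c j) =
        H + ∑ j ∈ s, v j • vecMulVec (c j) (c j) + z • C := fun z => by abel
    rw [e] at h1 h0
    have e' : H + (v i • C + ∑ j ∈ s, v j • vecMulVec (c j) (c j)) =
        H + ∑ j ∈ s, v j • vecMulVec (c j) (c j) + v i • C := by abel
    rw [e']
    have k1 := mul_le_mul_of_nonneg_left h1 (hp0 i)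
    have k0 := mul_le_mul_of_nonneg_left h0 (sub_nonneg.2 (hp1 i))
    have hm := hmean i
    nlinarith

end Bernoulli

/-! ### Matrix Bernstein inequality with intrinsic dimension. -/

section Concentration

open NormedSpace
open scoped MatrixOrder

variable {n : Type*} [Fintype n] [DecidableEq n]

/-- Each eigenvalue x contributes e^x − x ≥ 1. -/
theorem Matrix.card_add_le_trace_exp_sub_trace {H : Matrix n n ℝ} (hH : H.IsHermitian) :
    (Fintype.card n : ℝ) ≤ (exp H).trace - H.trace := by
  rw [Matrix.trace_exp_eq_sum hH, hH.trace_eq_sum_eigenvalues]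
  simp only [RCLike.ofReal_real_eq_id, id]
  rw [← Finset.sum_sub_distrib, Fintype.card_eq_sum_ones, Nat.cast_sum]
  refine Finset.sum_le_sum fun i _ => ?_
  have := Real.add_one_le_exp (hH.eigenvalues i)
  push_cast
  linarith

/-- Some eigenvalue exceeds t and contributes at least e^t − t, because e^x − x increases for x ≥ 0;
each of the others contributes at least 1. This is the gain on the bad event in Markov's inequality.
-/
theorem Matrix.card_add_le_trace_exp_sub_trace_of_not_le {H : Matrix n n ℝ} (hH : H.IsHermitian)
    {t : ℝ} (ht : 0 ≤ t) (h : ¬ H ≤ t • 1) :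
    (Fintype.card n : ℝ) + (Real.exp t - t - 1) ≤ (exp H).trace - H.trace := by
  rw [hH.le_smul_one_iff] at h
  push Not at h
  obtain ⟨j, hj⟩ := h
  rw [Matrix.trace_exp_eq_sum hH, hH.trace_eq_sum_eigenvalues]
  simp only [RCLike.ofReal_real_eq_id, id]
  rw [← Finset.sum_sub_distrib, ← Finset.add_sum_erase _ _ (Finset.mem_univ j)]
  have h1 : ((Finset.univ.erase j).card : ℝ) ≤
      ∑ i ∈ Finset.univ.erase j, (Real.exp (hH.eigenvalues i) - hH.eigenvalues i) := by
    rw [Finset.card_eq_sum_ones, Nat.cast_sum]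
    refine Finset.sum_le_sum fun i _ => ?_
    have := Real.add_one_le_exp (hH.eigenvalues i)
    push_cast
    linarith
  have h2 : ((Finset.univ.erase j).card : ℝ) = Fintype.card n - 1 := by
    rw [Finset.card_erase_of_mem (Finset.mem_univ j), Finset.card_univ,
      Nat.cast_sub (Fintype.card_pos_iff.2 ⟨j⟩)]
    simp
  have h3 : Real.exp t - t ≤ Real.exp (hH.eigenvalues j) - hH.eigenvalues j := by
    have e1 : Real.exp (hH.eigenvalues j) = Real.exp t * Real.exp (hH.eigenvalues j - t) := by
      rw [← Real.exp_add]; congr 1; ring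
    have e2 := Real.add_one_le_exp (hH.eigenvalues j - t)
    have e3 := Real.one_le_exp ht
    have e4 := mul_le_mul_of_nonneg_left e2 (Real.exp_nonneg t)
    nlinarith
  linarith

/-- Convexity gives e^{cx} ≤ 1 + x(e^c − 1) on [0, 1]. The excess over the dimension is thus
governed by the trace of A, which is the intrinsic dimension. -/
theorem Matrix.trace_exp_smul_le {A : Matrix n n ℝ} (hA0 : 0 ≤ A) (hA1 : A ≤ 1) {c : ℝ} :
    (exp (c • A)).trace ≤ Fintype.card n + A.trace * (Real.exp c - 1) := by
  have hA := (nonneg_iff_posSemidef.1 hA0)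
  have hH := hA.1
  obtain ⟨U, h1, h2, h3⟩ := hH.exists_orthogonal_diagonal
  have hU : IsUnit U := (isUnit_iff_exists_inv).2 ⟨Uᵀ, h1⟩
  have hi : U⁻¹ = Uᵀ := inv_eq_right_inv h1
  have he : (exp (c • A)).trace = ∑ i, Real.exp (c * hH.eigenvalues i) := by
    have e : c • A = U * diagonal (c • hH.eigenvalues) * U⁻¹ := by
      conv_lhs => rw [h3]
      rw [hi, diagonal_smul, Matrix.mul_smul, Matrix.smul_mul]
    rw [e, exp_conj _ _ hU, hi, trace_mul_comm, ← mul_assoc, h2, one_mul,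
      exp_diagonal, trace_diagonal]
    refine Finset.sum_congr rfl fun i _ => ?_
    rw [Pi.coe_exp, Real.exp_eq_exp_ℝ]
    rfl
  have hle := (hH.le_smul_one_iff 1).1 (by simpa using hA1)
  rw [he, hH.trace_eq_sum_eigenvalues]
  simp only [RCLike.ofReal_real_eq_id, id]
  rw [Fintype.card_eq_sum_ones, Nat.cast_sum, Finset.sum_mul, ← Finset.sum_add_distrib]
  refine Finset.sum_le_sum fun i _ => ?_
  have hcx := convexOn_exp.2 (Set.mem_univ 0) (Set.mem_univ c)
    (sub_nonneg.2 (hle i)) (hA.eigenvalues_nonneg i) (by ring)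
  simp only [smul_eq_mul, mul_zero, zero_add, Real.exp_zero, mul_one] at hcx
  rw [mul_comm c]
  push_cast
  linarith

end Concentration

section Concentration

open NormedSpace
open scoped MatrixOrder

/-- The probability of the event `E` for the set `A` that contains each element `i`
independently with probability `p i`. -/
noncomputable def bernoulliProb {ι : Type*} [Fintype ι] [DecidableEq ι] (p : ι → ℝ)
    (E : Set (Finset ι)) : ℝ :=
  bernoulliExp p Finset.univ (E.indicator 1)

theorem bernoulliProb_mono {ι : Type*} [Fintype ι] [DecidableEq ι] {p : ι → ℝ}
    (hp0 : ∀ i, 0 ≤ p i) (hp1 : ∀ i, p i ≤ 1) {E F : Set (Finset ι)} (h : E ⊆ F) :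
    bernoulliProb p E ≤ bernoulliProb p F :=
  bernoulliExp_mono hp0 hp1 _ fun A => Set.indicator_le_indicator_of_subset h (by simp) A

theorem bernoulliProb_union_le {ι : Type*} [Fintype ι] [DecidableEq ι] {p : ι → ℝ}
    (hp0 : ∀ i, 0 ≤ p i) (hp1 : ∀ i, p i ≤ 1) (E F : Set (Finset ι)) :
    bernoulliProb p (E ∪ F) ≤ bernoulliProb p E + bernoulliProb p F := by
  rw [bernoulliProb, bernoulliProb, bernoulliProb, ← bernoulliExp_add]
  refine bernoulliExp_mono hp0 hp1 _ fun A => ?_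
  by_cases h1 : A ∈ E <;> by_cases h2 : A ∈ F <;> simp [h1, h2]

/-- Markov's inequality produces the ratio (e^u − 1)/(e^{2u} − 2u − 1); for u ≥ 1 it is at most
2e^{−u}, by e^{2u} ≥ 4u + 2. -/
theorem exp_sub_one_div_le {u : ℝ} (hu : 1 ≤ u) :
    Real.exp u - 1 ≤ 2 * Real.exp (-u) * (Real.exp (2 * u) - 2 * u - 1) ∧
      0 < Real.exp (2 * u) - 2 * u - 1 := by
  have h1 := Real.quadratic_le_exp_of_nonneg (show (0 : ℝ) ≤ u by linarith)
  have h2 : Real.exp (2 * u) = Real.exp u * Real.exp u := by rw [← Real.exp_add]; ring_nf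
  have h3 : 4 * u + 2 ≤ Real.exp (2 * u) := by
    rw [h2]
    nlinarith [mul_le_mul h1 h1 (by positivity) (by positivity),
      mul_nonneg (sub_nonneg.2 hu) (sub_nonneg.2 hu)]
  have h4 : Real.exp (-u) * Real.exp (2 * u) = Real.exp u := by rw [← Real.exp_add]; ring_nf
  have h5 := Real.exp_pos (-u)
  refine ⟨?_, by linarith⟩
  nlinarith [mul_le_mul_of_nonneg_left h3 h5.le]

variable {ι : Type*} [Fintype ι] [DecidableEq ι] {n : Type*} [Fintype n] [DecidableEq n]

/-- The deviation from its mean of the random matrix `∑ i ∈ A, (p i)⁻¹ bᵢ bᵢᵀ`. -/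
noncomputable def sampleDeviation (p : ι → ℝ) (b : ι → n → ℝ) (A : Finset ι) : Matrix n n ℝ :=
  ∑ i, ((if i ∈ A then (p i)⁻¹ else 0) - 1) • vecMulVec (b i) (b i)

theorem sampleDeviation_transpose (p : ι → ℝ) (b : ι → n → ℝ) (A : Finset ι) :
    (sampleDeviation p b A)ᵀ = sampleDeviation p b A := by
  simp [sampleDeviation, transpose_sum]

/-- By e^x ≤ 1 + x + x² for |x| ≤ 1: the linear terms average to zero and the quadratic ones to
θ²s²(1 − p)/p, which is at most θ²βs because s ≤ pβ. For p = 1 nothing is random, and p = 0 forces s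
= 0. -/
theorem bernoulli_two_point_exp_le {p β θ σ s : ℝ} (hp0 : 0 ≤ p) (hp1 : p ≤ 1) (hs : 0 ≤ s)
    (hβ : 0 ≤ β) (hθ : 0 ≤ θ) (hθβ : θ * β ≤ 1) (hσ : σ ^ 2 = 1) (hb : p < 1 → s ≤ p * β) :
    p * Real.exp (σ * θ * (p⁻¹ - 1) * s) + (1 - p) * Real.exp (σ * θ * (0 - 1) * s) ≤
      Real.exp (θ ^ 2 * β * s) := by
  rcases hp1.lt_or_eq with hlt | rfl
  swap
  · simp; positivity
  have hsb := hb hlt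
  rcases hp0.lt_or_eq with hpos | rfl
  swap
  · have : s = 0 := le_antisymm (by simpa using hsb) hs
    simp [this]
  have hq : ∀ u : ℝ, |u| ≤ 1 → Real.exp u ≤ 1 + u + u ^ 2 := fun u hu => by
    have := Real.abs_exp_sub_one_sub_id_le hu
    have := (abs_le.1 this).2
    linarith
  have hσa : |σ| = 1 := by
    have : |σ| ^ 2 = 1 := by rw [sq_abs, hσ]
    nlinarith [abs_nonneg σ]
  have hps : p⁻¹ * s ≤ β := by rw [inv_mul_le_iff₀ hpos]; exact hsb
  have hpi : 1 ≤ p⁻¹ := (one_le_inv₀ hpos).2 hp1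
  have h1 : |σ * θ * (p⁻¹ - 1) * s| ≤ 1 := by
    rw [abs_mul, abs_mul, abs_mul, hσa, abs_of_nonneg hθ, abs_of_nonneg (sub_nonneg.2 hpi),
      abs_of_nonneg hs, one_mul, mul_assoc]
    refine (mul_le_mul_of_nonneg_left ?_ hθ).trans hθβ
    nlinarith
  have h0 : |σ * θ * (0 - 1) * s| ≤ 1 := by
    rw [abs_mul, abs_mul, abs_mul, hσa, abs_of_nonneg hθ, abs_of_nonneg hs, one_mul, mul_assoc]
    refine (mul_le_mul_of_nonneg_left ?_ hθ).trans hθβ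
    norm_num
    nlinarith
  have k1 := mul_le_mul_of_nonneg_left (hq _ h1) hp0
  have k0 := mul_le_mul_of_nonneg_left (hq _ h0) (sub_nonneg.2 hp1)
  have hexp := Real.add_one_le_exp (θ ^ 2 * β * s)
  have e : p * (1 + σ * θ * (p⁻¹ - 1) * s + (σ * θ * (p⁻¹ - 1) * s) ^ 2) +
      (1 - p) * (1 + σ * θ * (0 - 1) * s + (σ * θ * (0 - 1) * s) ^ 2) =
      1 + σ ^ 2 * θ ^ 2 * s * ((1 - p) * (p⁻¹ * s)) := by
    field_simp
    ring
  rw [hσ, one_mul] at e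
  have : θ ^ 2 * s * ((1 - p) * (p⁻¹ * s)) ≤ θ ^ 2 * s * β := by
    refine mul_le_mul_of_nonneg_left ?_ (by positivity)
    nlinarith [mul_nonneg (inv_nonneg.2 hp0) hs]
  have hk := add_le_add k1 k0
  rw [e] at hk
  linarith

/-- Matrix Bernstein inequality with intrinsic dimension for a rank-one Bernoulli sample. -/
theorem bernoulliProb_not_sampleDeviation_le {p : ι → ℝ} (hp0 : ∀ i, 0 ≤ p i) (hp1 : ∀ i, p i ≤ 1)
    {c : ι → n → ℝ} {β ε d σ : ℝ} (hβ : 0 < β) (hε0 : 0 < ε) (hε1 : ε ≤ 1)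
    (hu : 4 * β ≤ ε ^ 2) (hσ : σ ^ 2 = 1)
    (hc : ∀ i, p i < 1 → c i ⬝ᵥ c i ≤ p i * β)
    (hA : ∑ i, vecMulVec (c i) (c i) ≤ 1) (hd : (∑ i, vecMulVec (c i) (c i)).trace ≤ d) :
    bernoulliProb p {A | ¬ σ • sampleDeviation p c A ≤ ε • 1} ≤
      2 * d * Real.exp (-(ε ^ 2 / (4 * β))) := by
  have hs : ∀ i, 0 ≤ c i ⬝ᵥ c i := fun i => by simpa using dotProduct_self_star_nonneg (c i)
  have hA0 : (0 : Matrix n n ℝ) ≤ ∑ i, vecMulVec (c i) (c i) :=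
    Finset.sum_nonneg fun i _ => Matrix.vecMulVec_self_nonneg _
  -- The choice θ = ε/(2β) minimises θ²β − θε; then θ²β = u and θε = 2u.
  set u := ε ^ 2 / (4 * β) with hudef
  set θ := ε / (2 * β) with hθdef
  have hu1 : 1 ≤ u := by rw [hudef, le_div_iff₀ (by positivity)]; linarith
  have hθ0 : 0 < θ := by positivity
  have hθβ : θ * β = ε / 2 := by rw [hθdef]; field_simp
  have hθ2 : θ ^ 2 * β = u := by rw [hθdef, hudef]; field_simp; ring
  have hθε : θ * ε = 2 * u := by rw [hθdef, hudef]; field_simp; ring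
  have main := bernoulliExp_trace_exp_le hp0 hp1 c (fun i => σ * θ * ((p i)⁻¹ - 1))
    (fun i => σ * θ * (0 - 1)) (fun _ => θ ^ 2 * β)
    (fun i => by
      rcases (hp0 i).lt_or_eq with hpos | h0
      · have : p i * (σ * θ * ((p i)⁻¹ - 1)) + (1 - p i) * (σ * θ * (0 - 1)) = 0 := by
          field_simp
          ring
        rw [this, zero_mul]
      · have : c i ⬝ᵥ c i = 0 :=
          le_antisymm (by simpa [← h0] using hc i (by rw [← h0]; norm_num)) (hs i)
        rw [this, mul_zero])
    (fun i => bernoulli_two_point_exp_le (hp0 i) (hp1 i) (hs i) hβ.le hθ0.le (by linarith) hσ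
      (hc i))
    Finset.univ (0 : Matrix n n ℝ) (by simp)
  simp only [zero_add, ← Finset.smul_sum] at main
  have hY : ∀ A : Finset ι, ∑ i, (if i ∈ A then σ * θ * ((p i)⁻¹ - 1) else σ * θ * (0 - 1)) •
      vecMulVec (c i) (c i) = θ • (σ • sampleDeviation p c A) := fun A => by
    rw [sampleDeviation, smul_smul, Finset.smul_sum]
    refine Finset.sum_congr rfl fun i _ => ?_
    rw [smul_smul]
    congr 1
    split_ifs <;> ring
  simp only [hY] at main
  have hH : ∀ A : Finset ι, (θ • (σ • sampleDeviation p c A)).IsHermitian := fun A =>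
    Matrix.isHermitian_of_transpose_eq (by
      rw [transpose_smul, transpose_smul, sampleDeviation_transpose])
  set φ := Real.exp (2 * u) - 2 * u - 1 with hφ
  obtain ⟨hφ1, hφ0⟩ := exp_sub_one_div_le hu1
  -- Markov's inequality for tr exp Y − tr Y, where Y is θσ times the deviation: this quantity is
  -- always at least the dimension, exceeds it by φ on the bad event, and has mean at most the
  -- dimension plus d(e^u − 1). The dimension cancels and d remains.
  have low : bernoulliProb p {A | ¬ σ • sampleDeviation p c A ≤ ε • 1} * φ + Fintype.card n ≤
      Fintype.card n + d * (Real.exp u - 1) := by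
    rw [bernoulliProb, ← bernoulliExp_mul_right, ← bernoulliExp_const p Finset.univ
      (Fintype.card n : ℝ), ← bernoulliExp_add]
    refine (bernoulliExp_mono hp0 hp1 _ fun A => ?_).trans (main.trans ?_)
    · by_cases h : σ • sampleDeviation p c A ≤ ε • 1
      · rw [Set.indicator_of_notMem (by simpa using h), zero_mul, zero_add]
        exact Matrix.card_add_le_trace_exp_sub_trace (hH A)
      · rw [Set.indicator_of_mem (by simpa using h), Pi.one_apply, one_mul, add_comm]
        refine Matrix.card_add_le_trace_exp_sub_trace_of_not_le (hH A) (by linarith) fun h' => h ?_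
        have := Matrix.smul_mono_right h' (inv_nonneg.2 hθ0.le)
        rw [inv_smul_smul₀ hθ0.ne', ← hθε, smul_smul, ← mul_assoc, inv_mul_cancel₀ hθ0.ne',
          one_mul] at this
        exact this
    · rw [bernoulliExp_const, hθ2]
      refine (Matrix.trace_exp_smul_le hA0 hA).trans ?_
      have := Real.add_one_le_exp u
      gcongr
      linarith
  have hd0 : 0 ≤ d := (nonneg_iff_posSemidef.1 hA0).trace_nonneg.trans hd
  have h1 : bernoulliProb p {A | ¬ σ • sampleDeviation p c A ≤ ε • 1} * φ ≤
      (2 * d * Real.exp (-u)) * φ := by nlinarith [mul_le_mul_of_nonneg_left hφ1 hd0]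
  exact le_of_mul_le_mul_right h1 hφ0

/-- Two-sided relative version: `c` is measured in the norm of a positive definite matrix `G`. -/
theorem bernoulliProb_sampleDeviation {p : ι → ℝ} (hp0 : ∀ i, 0 ≤ p i) (hp1 : ∀ i, p i ≤ 1)
    {b : ι → n → ℝ} {G : Matrix n n ℝ} (hG : G.PosDef)
    {β ε d : ℝ} (hβ : 0 < β) (hε0 : 0 < ε) (hε1 : ε ≤ 1) (hu : 4 * β ≤ ε ^ 2)
    (hb : ∀ i, p i < 1 → vecMulVec (b i) (b i) ≤ (p i * β) • G)
    (hA : ∑ i, vecMulVec (b i) (b i) ≤ G) (hd : (G⁻¹ * ∑ i, vecMulVec (b i) (b i)).trace ≤ d) :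
    bernoulliProb p {A | ¬ (-(ε • G) ≤ sampleDeviation p b A ∧ sampleDeviation p b A ≤ ε • G)} ≤
      4 * d * Real.exp (-(ε ^ 2 / (4 * β))) := by
  -- Whitening: with G = R Rᵀ and c i = R⁻¹ b i, bounds relative to G become bounds relative to the
  -- identity.
  obtain ⟨R, hRu, hR⟩ : ∃ R : Matrix n n ℝ, IsUnit R ∧ G = R * Rᵀ := by
    refine ⟨CFC.sqrt G, ?_, ?_⟩
    · have := (Matrix.isStrictlyPositive_iff_posDef.2 hG)
      exact (CFC.isUnit_sqrt_iff G hG.posSemidef.nonneg).2 hG.isUnit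
    · have h1 := (CFC.sqrt_nonneg G).isSelfAdjoint
      have h2 : (CFC.sqrt G)ᵀ = CFC.sqrt G := by
        simpa [IsSelfAdjoint, star_eq_conjTranspose] using h1
      rw [h2, CFC.sqrt_mul_sqrt_self _ hG.posSemidef.nonneg]
  have hRd : IsUnit R.det := (Matrix.isUnit_iff_isUnit_det R).1 hRu
  set Q := R⁻¹ with hQ
  have hQR : Q * R = 1 := Matrix.nonsing_inv_mul R hRd
  have hRQ : R * Q = 1 := Matrix.mul_nonsing_inv R hRd
  have hRQt : Rᵀ * Qᵀ = 1 := by rw [← transpose_mul, hQR, transpose_one]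
  have hQRt : Qᵀ * Rᵀ = 1 := by rw [← transpose_mul, hRQ, transpose_one]
  have hQG : Q * G * Qᵀ = 1 := by
    rw [hR, show Q * (R * Rᵀ) * Qᵀ = (Q * R) * (Rᵀ * Qᵀ) by simp only [mul_assoc], hQR, hRQt,
      one_mul]
  have hGinv : G⁻¹ = Qᵀ * Q := by
    refine inv_eq_left_inv ?_
    rw [hR, show Qᵀ * Q * (R * Rᵀ) = Qᵀ * (Q * R) * Rᵀ by simp only [mul_assoc], hQR, mul_one, hQRt]
  set c : ι → n → ℝ := fun i => Q *ᵥ b i with hc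
  have hcb : ∀ i, vecMulVec (c i) (c i) = Q * vecMulVec (b i) (b i) * Qᵀ := fun i => by
    rw [hc, mul_vecMulVec, vecMulVec_mul, vecMul_transpose]
  have hsum : ∑ i, vecMulVec (c i) (c i) = Q * (∑ i, vecMulVec (b i) (b i)) * Qᵀ := by
    simp only [hcb, Matrix.mul_sum, Matrix.sum_mul]
  have hdev : ∀ A, sampleDeviation p c A = Q * sampleDeviation p b A * Qᵀ := fun A => by
    simp only [sampleDeviation, hcb, Matrix.mul_sum, Matrix.sum_mul, Matrix.mul_smul,
      Matrix.smul_mul]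
  have hback : ∀ X : Matrix n n ℝ, Q * X * Qᵀ ≤ ε • 1 → X ≤ ε • G := fun X hX => by
    have := Matrix.conj_mono hX R
    rw [show R * (Q * X * Qᵀ) * Rᵀ = (R * Q) * X * (Qᵀ * Rᵀ) by simp only [mul_assoc], hRQ, hQRt,
      one_mul, mul_one, Matrix.mul_smul, Matrix.smul_mul, mul_one, ← hR] at this
    exact this
  have hc' : ∀ i, p i < 1 → c i ⬝ᵥ c i ≤ p i * β := fun i hi => by
    have h1 := Matrix.conj_mono (hb i hi) Q
    rw [← hcb, Matrix.mul_smul, Matrix.smul_mul, hQG] at h1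
    have h2 := Matrix.dotProduct_mulVec_mono h1 (c i)
    rw [Matrix.dotProduct_vecMulVec_mulVec, smul_mulVec, one_mulVec, dotProduct_smul,
      smul_eq_mul] at h2
    have h3 : 0 ≤ c i ⬝ᵥ c i := by simpa using dotProduct_self_star_nonneg (c i)
    rcases h3.lt_or_eq with h4 | h4
    · rw [pow_two] at h2
      exact le_of_mul_le_mul_right h2 h4
    · rw [← h4]; exact mul_nonneg (hp0 i) hβ.le
  have hA' : ∑ i, vecMulVec (c i) (c i) ≤ 1 := by
    rw [hsum, ← hQG]; exact Matrix.conj_mono hA Q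
  have hd' : (∑ i, vecMulVec (c i) (c i)).trace ≤ d := by
    rw [hsum, trace_mul_comm, ← mul_assoc, ← hGinv]; exact hd
  have h1 := bernoulliProb_not_sampleDeviation_le hp0 hp1 hβ hε0 hε1 hu (σ := 1) (by norm_num)
    hc' hA' hd'
  have h2 := bernoulliProb_not_sampleDeviation_le hp0 hp1 hβ hε0 hε1 hu (σ := -1) (by norm_num)
    hc' hA' hd'
  have h3 := (bernoulliProb_mono hp0 hp1 (E := {A | ¬ (-(ε • G) ≤ sampleDeviation p b A ∧
      sampleDeviation p b A ≤ ε • G)}) ?_).trans (bernoulliProb_union_le hp0 hp1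
        {A | ¬ (1 : ℝ) • sampleDeviation p c A ≤ ε • 1}
        {A | ¬ (-1 : ℝ) • sampleDeviation p c A ≤ ε • 1})
  · linarith
  · intro A hA
    by_contra hcon
    simp only [Set.mem_union, Set.mem_ofPred_eq, not_or, not_not] at hcon hA
    refine hA ⟨?_, ?_⟩
    · rw [neg_le]
      refine hback _ ?_
      have := hcon.2
      rw [hdev] at this
      simpa using this
    · refine hback _ ?_
      have := hcon.1
      rw [hdev] at this
      simpa using this

end Concentration

/-! ### Eigenvalue tails and Ky Fan's principle. -/

section EigenvalueTail

open scoped MatrixOrder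

variable {N : ℕ}

/-- `eigenvalueTail` refers to the ordered list `eigenvalues₀`. Re-indexing the eigenbasis makes the
diagonal antitone, and the tail becomes a sum over the indices from S on. -/
theorem Matrix.IsHermitian.exists_antitone_diagonal {A : Matrix (Fin N) (Fin N) ℝ}
    (hA : A.IsHermitian) :
    ∃ (U : Matrix (Fin N) (Fin N) ℝ) (σ : Fin N → ℝ), U * Uᵀ = 1 ∧ Uᵀ * U = 1 ∧ Antitone σ ∧
      A = U * diagonal σ * Uᵀ ∧ ∀ S : ℕ, eigenvalueTail S A = ∑ m with S ≤ m.val, σ m := by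
  obtain ⟨U, h1, h2, h3⟩ := hA.exists_orthogonal_diagonal
  have hcard : N = Fintype.card (Fin N) := (Fintype.card_fin N).symm
  let e : Fin (Fintype.card (Fin N)) ≃ Fin N := Fintype.equivOfCardEq (Fintype.card_fin _)
  let π : Fin N ≃ Fin N := (Fin.castOrderIso hcard).toEquiv.trans e
  have hσ : ∀ m, hA.eigenvalues (π m) = hA.eigenvalues₀ (Fin.cast hcard m) := fun m => by
    simp [IsHermitian.eigenvalues, π, e]
  refine ⟨U.submatrix id π, fun m => hA.eigenvalues (π m), ?_, ?_, ?_, ?_, ?_⟩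
  · rw [transpose_submatrix, submatrix_mul_equiv, h1, submatrix_one _ Function.injective_id]
  · have : (U.submatrix id π)ᵀ * U.submatrix id π = (Uᵀ * U).submatrix π π := by
      rw [transpose_submatrix]
      exact (submatrix_mul _ _ _ _ _ Function.bijective_id).symm
    rw [this, h2, submatrix_one_equiv]
  · intro a b hab
    simp only [hσ]
    exact hA.eigenvalues₀_antitone hab
  · have : diagonal (fun m => hA.eigenvalues (π m)) = (diagonal hA.eigenvalues).submatrix π π :=
      (submatrix_diagonal_equiv hA.eigenvalues π).symm
    rw [this, transpose_submatrix, submatrix_mul_equiv, submatrix_mul_equiv, ← h3]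
    simp
  · intro S
    rw [eigenvalueTail, dif_pos hA]
    simp only [hσ]
    refine (Finset.sum_bij (fun m _ => Fin.cast hcard m) ?_ ?_ ?_ ?_).symm
    · intro m hm; simpa using hm
    · intro a _ b _ h; simpa using h
    · intro b hb
      exact ⟨Fin.cast hcard.symm b, by simpa using hb, by simp⟩
    · intro m _; rfl

theorem eigenvalueTail_eq_of_charpoly_eq {A B : Matrix (Fin N) (Fin N) ℝ} (hA : A.IsHermitian)
    (hB : B.IsHermitian) (h : A.charpoly = B.charpoly) (S : ℕ) :
    eigenvalueTail S A = eigenvalueTail S B := by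
  have h0 : hA.eigenvalues₀ = hB.eigenvalues₀ := by
    simp_rw [← List.ofFn_inj, ← IsHermitian.sort_roots_charpoly_eq_eigenvalues₀, h]
  rw [eigenvalueTail, eigenvalueTail, dif_pos hA, dif_pos hB, h0]

theorem eigenvalueTail_mul_transpose_comm (X : Matrix (Fin N) (Fin N) ℝ) (S : ℕ) :
    eigenvalueTail S (X * Xᵀ) = eigenvalueTail S (Xᵀ * X) :=
  eigenvalueTail_eq_of_charpoly_eq (isHermitian_of_transpose_eq (by simp))
    (isHermitian_of_transpose_eq (by simp)) (charpoly_mul_comm _ _) S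

theorem Matrix.trace_mul_diagonal (X : Matrix (Fin N) (Fin N) ℝ) (σ : Fin N → ℝ) :
    (X * diagonal σ).trace = ∑ m, X m m * σ m := by
  simp [Matrix.trace, mul_diagonal]

/-- Ky Fan's principle. -/
theorem eigenvalueTail_le_trace {A P : Matrix (Fin N) (Fin N) ℝ} (hA : 0 ≤ A) (hP0 : 0 ≤ P)
    (hP1 : P ≤ 1) {S : ℕ} (hPS : P.trace ≤ S) : eigenvalueTail S A ≤ ((1 - P) * A).trace := by
  have hApsd := nonneg_iff_posSemidef.1 hA
  obtain ⟨U, σ, h1, h2, hσ, h3, h4⟩ := hApsd.1.exists_antitone_diagonal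
  set q : Fin N → ℝ := fun m => (Uᵀ * P * U) m m with hq
  have hq0 : ∀ m, 0 ≤ q m := fun m => by
    have := Matrix.conj_mono' hP0 U
    simp only [Matrix.mul_zero, Matrix.zero_mul] at this
    exact (nonneg_iff_posSemidef.1 this).diag_nonneg
  have hq1 : ∀ m, q m ≤ 1 := fun m => by
    have := Matrix.conj_mono' hP1 U
    rw [mul_one, h2] at this
    have := (Matrix.le_iff.1 this).diag_nonneg (i := m)
    simpa using this
  have hqS : ∑ m, q m ≤ S := by
    have : ∑ m, q m = P.trace := by
      change (Uᵀ * P * U).trace = _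
      rw [trace_mul_comm, ← mul_assoc, h1, one_mul]
    rw [this]; exact hPS
  have hσ0 : ∀ m, 0 ≤ σ m := fun m => by
    have := Matrix.conj_mono' hA U
    rw [h3, show Uᵀ * (U * diagonal σ * Uᵀ) * U = (Uᵀ * U) * diagonal σ * (Uᵀ * U) by
      simp only [mul_assoc], h2, one_mul, mul_one, Matrix.mul_zero, Matrix.zero_mul] at this
    simpa using (nonneg_iff_posSemidef.1 this).diag_nonneg (i := m)
  have htr : ((1 - P) * A).trace = ∑ m, (1 - q m) * σ m := by
    conv_lhs => rw [h3, ← mul_assoc, trace_mul_comm, ← mul_assoc, ← mul_assoc,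
      Matrix.mul_sub, Matrix.sub_mul, mul_one, h2, trace_mul_diagonal]
    simp [hq]
  rw [h4, htr, Finset.sum_filter]
  by_cases hSN : S < N
  -- τ is a threshold: with q m the diagonal of P in the eigenbasis, 1 − q m − 1[m ≥ S] and σ m − τ
  -- never have opposite signs, and the former sum to S − tr P ≥ 0.
  · set τ := σ ⟨S, hSN⟩ with hτ
    have key : ∀ m : Fin N, τ * (1 - q m - if S ≤ m.val then 1 else 0) ≤
        (1 - q m) * σ m - if S ≤ m.val then σ m else 0 := fun m => by
      split_ifs with h
      · have : σ m ≤ τ := hσ (show (⟨S, hSN⟩ : Fin N) ≤ m from h)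
        nlinarith [hq0 m]
      · have : τ ≤ σ m := hσ (show m ≤ (⟨S, hSN⟩ : Fin N) from le_of_not_ge h)
        nlinarith [hq1 m]
    have hsum := Finset.sum_le_sum fun m (_ : m ∈ Finset.univ) => key m
    rw [← Finset.mul_sum, Finset.sum_sub_distrib, Finset.sum_sub_distrib,
      Finset.sum_sub_distrib] at hsum
    have hc : ∑ m : Fin N, (if S ≤ m.val then (1 : ℝ) else 0) = N - S := by
      rw [Finset.sum_boole]
      have : (Finset.univ.filter fun m : Fin N => S ≤ m.val) = Finset.Ici ⟨S, hSN⟩ := by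
        ext m; simp [Fin.le_def]
      rw [this, Fin.card_Ici, Nat.cast_sub hSN.le]
    rw [hc] at hsum
    simp only [Finset.sum_const, Finset.card_univ, Fintype.card_fin, nsmul_eq_mul, mul_one] at hsum
    have : 0 ≤ τ * (N - ∑ m, q m - (N - S)) := mul_nonneg (hσ0 _) (by linarith)
    linarith
  · rw [Finset.sum_eq_zero fun m _ => if_neg (by have := m.2; omega)]
    exact Finset.sum_nonneg fun m _ => mul_nonneg (sub_nonneg.2 (hq1 m)) (hσ0 m)

/-- The spectral projection onto all but the first `r` eigenvectors. -/
theorem exists_tail_projection {A : Matrix (Fin N) (Fin N) ℝ} (hA : 0 ≤ A) (r : ℕ) :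
    ∃ F : Matrix (Fin N) (Fin N) ℝ, Fᵀ = F ∧ F * F = F ∧ A * F = F * A ∧ (1 - F).trace ≤ r ∧
      (F * A).trace = eigenvalueTail r A ∧
      ∀ S : ℕ, S ≤ r → ((r : ℝ) + 1 - S) • (F * A) ≤ eigenvalueTail S A • F := by
  have hApsd := nonneg_iff_posSemidef.1 hA
  obtain ⟨U, σ, h1, h2, hσ, h3, h4⟩ := hApsd.1.exists_antitone_diagonal
  set f : Fin N → ℝ := fun m => if r ≤ m.val then 1 else 0 with hf
  have hσ0 : ∀ m, 0 ≤ σ m := fun m => by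
    have := Matrix.conj_mono' hA U
    rw [h3, show Uᵀ * (U * diagonal σ * Uᵀ) * U = (Uᵀ * U) * diagonal σ * (Uᵀ * U) by
      simp only [mul_assoc], h2, one_mul, mul_one, Matrix.mul_zero, Matrix.zero_mul] at this
    simpa using (nonneg_iff_posSemidef.1 this).diag_nonneg (i := m)
  have hmul : ∀ a b : Fin N → ℝ, (U * diagonal a * Uᵀ) * (U * diagonal b * Uᵀ) =
      U * diagonal (fun m => a m * b m) * Uᵀ := fun a b => by
    rw [show (U * diagonal a * Uᵀ) * (U * diagonal b * Uᵀ) =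
      U * diagonal a * (Uᵀ * U) * diagonal b * Uᵀ by simp only [mul_assoc], h2, mul_one,
      mul_assoc U, diagonal_mul_diagonal]
  have htr : ∀ a : Fin N → ℝ, (U * diagonal a * Uᵀ).trace = ∑ m, a m := fun a => by
    rw [trace_mul_comm, ← mul_assoc, h2, one_mul, trace_diagonal]
  refine ⟨U * diagonal f * Uᵀ, ?_, ?_, ?_, ?_, ?_, ?_⟩
  · simp [mul_assoc]
  · rw [hmul]
    congr 3
    funext m
    simp [hf]
  · conv_lhs => rw [h3]
    conv_rhs => rw [h3]
    rw [hmul, hmul]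
    simp only [mul_comm]
  · have e : (1 : Matrix (Fin N) (Fin N) ℝ) = U * diagonal 1 * Uᵀ := by
      rw [show diagonal (1 : Fin N → ℝ) = 1 from diagonal_one, mul_one, h1]
    rw [e, trace_sub, htr, htr, ← Finset.sum_sub_distrib]
    have : ∀ m : Fin N, (1 : Fin N → ℝ) m - f m = if m.val < r then 1 else 0 := fun m => by
      simp only [hf, Pi.one_apply]
      split_ifs <;> first | omega | norm_num
    simp only [this]
    rw [Finset.sum_boole]
    have hc : (Finset.univ.filter fun m : Fin N => m.val < r).card ≤ (Finset.range r).card :=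
      Finset.card_le_card_of_injOn Fin.val (fun m hm => by simpa using hm)
        Fin.val_injective.injOn
    rw [Finset.card_range] at hc
    exact_mod_cast hc
  · conv_lhs => rw [h3]
    rw [hmul, htr, h4, Finset.sum_filter]
    simp [hf]
  · intro S hS
    have hfA : U * diagonal f * Uᵀ * A = U * diagonal (fun m => f m * σ m) * Uᵀ := by
      conv_lhs => rw [h3]
      rw [hmul]
    have hsm : ∀ (c : ℝ) (a : Fin N → ℝ),
        c • (U * diagonal a * Uᵀ) = U * diagonal (c • a) * Uᵀ := fun c a => by
      rw [diagonal_smul, Matrix.mul_smul, Matrix.smul_mul]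
    rw [hfA, hsm, hsm]
    refine Matrix.conj_mono ?_ U
    rw [Matrix.le_iff, diagonal_sub]
    refine PosSemidef.diagonal fun m => ?_
    simp only [Pi.zero_apply, Pi.smul_apply, smul_eq_mul, sub_nonneg, hf]
    split_ifs with hm
    swap
    · simp
    rw [one_mul, mul_one, h4]
    have hrN : r < N := lt_of_le_of_lt hm m.2
    -- There are r + 1 − S eigenvalues with indices S, …, r. Each dominates every eigenvalue of
    -- index at least r, so the tail from S on bounds r + 1 − S copies of any of the latter.
    have hsub : Finset.Icc (⟨S, lt_of_le_of_lt hS hrN⟩ : Fin N) ⟨r, hrN⟩ ⊆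
        Finset.univ.filter fun m : Fin N => S ≤ m.val := fun j hj => by
      simp only [Finset.mem_Icc, Fin.le_def] at hj
      simpa using hj.1
    refine le_trans ?_ (Finset.sum_le_sum_of_subset_of_nonneg hsub fun j _ _ => hσ0 j)
    have hcard : ((r : ℝ) + 1 - S) =
        (Finset.Icc (⟨S, lt_of_le_of_lt hS hrN⟩ : Fin N) ⟨r, hrN⟩).card := by
      rw [Fin.card_Icc, Nat.cast_sub (by simp; omega)]
      push_cast
      ring
    rw [hcard, ← nsmul_eq_mul]
    refine Finset.card_nsmul_le_sum _ _ _ fun j hj => hσ ?_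
    simp only [Finset.mem_Icc] at hj
    exact hj.2.trans hm

theorem Matrix.nonneg_of_idempotent {n : Type*} [Fintype n] {F : Matrix n n ℝ} (h1 : Fᵀ = F)
    (h2 : F * F = F) : 0 ≤ F := by
  rw [nonneg_iff_posSemidef, ← h2]
  nth_rw 1 [← h1]
  simpa using posSemidef_conjTranspose_mul_self F

theorem Matrix.le_one_of_idempotent {n : Type*} [Fintype n] [DecidableEq n] {F : Matrix n n ℝ}
    (h1 : Fᵀ = F) (h2 : F * F = F) : F ≤ 1 := by
  rw [← sub_nonneg]
  refine Matrix.nonneg_of_idempotent (by rw [transpose_sub, h1, transpose_one]) ?_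
  rw [sub_mul, mul_sub, mul_sub, h2]
  simp

theorem eigenvalueTail_nonneg {A : Matrix (Fin N) (Fin N) ℝ} (hA : 0 ≤ A) (S : ℕ) :
    0 ≤ eigenvalueTail S A := by
  obtain ⟨F, h1, h2, -, -, h5, -⟩ := exists_tail_projection hA S
  rw [← h5]
  exact Matrix.trace_mul_nonneg (Matrix.nonneg_of_idempotent h1 h2) hA

/-- Ky Fan's principle in terms of the complementary projection. -/
theorem eigenvalueTail_le_trace_projection {A F : Matrix (Fin N) (Fin N) ℝ} (hA : 0 ≤ A)
    (h1 : Fᵀ = F) (h2 : F * F = F) {S : ℕ} (hS : (1 - F).trace ≤ S) :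
    eigenvalueTail S A ≤ (F * A).trace := by
  have := eigenvalueTail_le_trace hA (sub_nonneg.2 (Matrix.le_one_of_idempotent h1 h2))
    (sub_le_self _ (Matrix.nonneg_of_idempotent h1 h2)) hS
  simpa using this

theorem eigenvalueTail_mono {A B : Matrix (Fin N) (Fin N) ℝ} (hA : 0 ≤ A) (h : A ≤ B) (S : ℕ) :
    eigenvalueTail S A ≤ eigenvalueTail S B := by
  obtain ⟨F, h1, h2, -, h4, h5, -⟩ := exists_tail_projection (hA.trans h) S
  rw [← h5]
  exact (eigenvalueTail_le_trace_projection hA h1 h2 h4).trans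
    (Matrix.trace_mul_mono (Matrix.nonneg_of_idempotent h1 h2) h)

theorem eigenvalueTail_smul_le {A : Matrix (Fin N) (Fin N) ℝ} (hA : 0 ≤ A) {c : ℝ} (hc : 0 ≤ c)
    (S : ℕ) : eigenvalueTail S (c • A) ≤ c * eigenvalueTail S A := by
  obtain ⟨F, h1, h2, -, h4, h5, -⟩ := exists_tail_projection hA S
  have h0 : 0 ≤ c • A := by simpa using Matrix.smul_mono_right hA hc
  refine (eigenvalueTail_le_trace_projection h0 h1 h2 h4).trans ?_
  rw [Matrix.mul_smul, trace_smul, h5, smul_eq_mul]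

/-- Compression by an orthogonal projection does not increase the eigenvalue tail. -/
theorem eigenvalueTail_conj_le {A E : Matrix (Fin N) (Fin N) ℝ} (hA : 0 ≤ A) (h1 : Eᵀ = E)
    (h2 : E * E = E) (S : ℕ) : eigenvalueTail S (E * A * E) ≤ eigenvalueTail S A := by
  obtain ⟨C, rfl⟩ := CStarAlgebra.nonneg_iff_eq_star_mul_self.1 hA
  have hs : star C = Cᵀ := by simp [star_eq_conjTranspose]
  rw [hs]
  -- With A = CᵀC, the matrix EAE has the spectrum of C E Cᵀ, which is at most C Cᵀ, and C Cᵀ has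
  -- the spectrum of A.
  have e1 : E * (Cᵀ * C) * E = (C * E)ᵀ * (C * E) := by
    rw [transpose_mul, h1]; simp only [mul_assoc]
  have e2 : (C * E) * (C * E)ᵀ = C * E * Cᵀ := by
    rw [transpose_mul, h1, show C * E * (E * Cᵀ) = C * (E * E) * Cᵀ by simp only [mul_assoc], h2]
  rw [e1, ← eigenvalueTail_mul_transpose_comm, ← eigenvalueTail_mul_transpose_comm, e2]
  have h0 := Matrix.conj_mono (Matrix.nonneg_of_idempotent h1 h2) C
  have h3 := Matrix.conj_mono (Matrix.le_one_of_idempotent h1 h2) C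
  rw [Matrix.mul_zero, Matrix.zero_mul] at h0
  rw [mul_one] at h3
  exact eigenvalueTail_mono h0 h3 S

end EigenvalueTail

/-! ### Good samples: spectral approximation together with the eigenvalue tail. -/

section GoodSample

open scoped MatrixOrder

/-- Bernstein's inequality for a weighted Bernoulli sample of nonnegative numbers. -/
theorem bernoulliProb_sum_deviation {ι : Type*} [Fintype ι] [DecidableEq ι] {p : ι → ℝ}
    (hp0 : ∀ i, 0 ≤ p i) (hp1 : ∀ i, p i ≤ 1) {a : ι → ℝ} (ha : ∀ i, 0 ≤ a i) {g β ε : ℝ}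
    (hg : 0 < g) (hβ : 0 < β) (hε0 : 0 < ε) (hε1 : ε ≤ 1) (hu : 4 * β ≤ ε ^ 2)
    (hb : ∀ i, p i < 1 → a i ≤ p i * β * g) (hA : ∑ i, a i ≤ g) :
    bernoulliProb p {A | ¬ |∑ i, ((if i ∈ A then (p i)⁻¹ else 0) - 1) * a i| ≤ ε * g} ≤
      4 * Real.exp (-(ε ^ 2 / (4 * β))) := by
  have hone : ∀ c d : ℝ, c ≤ d → c • (1 : Matrix Unit Unit ℝ) ≤ d • 1 := fun c d h =>
    Matrix.smul_mono_left (nonneg_iff_posSemidef.2 PosSemidef.one) h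
  have hone' : ∀ c d : ℝ, c • (1 : Matrix Unit Unit ℝ) ≤ d • 1 → c ≤ d := fun c d h => by
    have := Matrix.trace_mono h
    simpa using this
  -- The case of 1 × 1 matrices, where the effective dimension is at most 1.
  set b : ι → Unit → ℝ := fun i _ => Real.sqrt (a i) with hbdef
  have hbb : ∀ i, vecMulVec (b i) (b i) = a i • (1 : Matrix Unit Unit ℝ) := fun i => by
    ext j k
    simp [vecMulVec_apply, hbdef, Real.mul_self_sqrt (ha i)]
  have hsum : ∑ i, vecMulVec (b i) (b i) = (∑ i, a i) • (1 : Matrix Unit Unit ℝ) := by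
    simp only [hbb, Finset.sum_smul]
  have hdev : ∀ A, sampleDeviation p b A =
      (∑ i, ((if i ∈ A then (p i)⁻¹ else 0) - 1) * a i) • (1 : Matrix Unit Unit ℝ) := fun A => by
    simp only [sampleDeviation, hbb, smul_smul, Finset.sum_smul]
  have h := bernoulliProb_sampleDeviation (d := 1) hp0 hp1 (b := b) (PosDef.one.smul hg) hβ hε0 hε1
    hu (fun i hi => by
      rw [hbb, smul_smul]
      exact hone _ _ (hb i hi)) (by rw [hsum]; exact hone _ _ hA)
    (by
      rw [hsum]
      have : (g • (1 : Matrix Unit Unit ℝ))⁻¹ = g⁻¹ • 1 := by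
        refine inv_eq_left_inv ?_
        rw [smul_mul_smul_comm, inv_mul_cancel₀ hg.ne', one_smul, one_mul]
      rw [this, smul_mul_smul_comm, one_mul, trace_smul]
      simp only [trace_one, Fintype.card_unit, Nat.cast_one, smul_eq_mul, mul_one]
      rw [inv_mul_le_iff₀ hg, mul_one]
      exact hA)
  rw [mul_one] at h
  refine (bernoulliProb_mono hp0 hp1 fun A hA' => ?_).trans h
  intro hcon
  refine hA' ?_
  rw [hdev, smul_smul, ← neg_smul] at hcon
  exact abs_le.2 ⟨hone' _ _ hcon.1, hone' _ _ hcon.2⟩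

variable {N : ℕ}

/-- `M` is close to `A` relative to `A + ρ`, and so is the sum of all but its largest `S`
eigenvalues. -/
structure IsGoodSample (S : ℕ) (A M : Matrix (Fin N) (Fin N) ℝ) (ρ : ℝ) : Prop where
  lower : -((1 / 1000 : ℝ) • (A + ρ • 1)) ≤ M - A
  upper : M - A ≤ (1 / 1000 : ℝ) • (A + ρ • 1)
  tail_upper : eigenvalueTail S M ≤ eigenvalueTail S A + 1 / 1000 * (S * ρ)
  tail_lower : 49 / 100 * eigenvalueTail S A - 5 / 100 * (S * ρ) ≤ eigenvalueTail S M

theorem Matrix.smul_one_nonneg {n : Type*} [Fintype n] [DecidableEq n] {c : ℝ} (hc : 0 ≤ c) :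
    (0 : Matrix n n ℝ) ≤ c • 1 :=
  nonneg_iff_posSemidef.2 (PosSemidef.one.smul hc)

/-- The Loewner bounds alone would cost ρ/1000 for each of up to N small eigenvalues, so the deep
tail is controlled by traces. The upper bound on the tail of M is Ky Fan's principle with the
projection F for A. For the lower bound M is compressed in two ways. Beyond index 41 S the
eigenvalues of A are at most ρ/40, so E M E has norm about ρ/40 and dropping its S largest
eigenvalues costs little of tr(E M). On the head, of rank at most 41 S, the Loewner bound loses only
41 S · ρ/1000. -/
theorem isGoodSample_of_trace_le {S : ℕ} {A M F E : Matrix (Fin N) (Fin N) ℝ}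
    {ρ : ℝ} (hA : 0 ≤ A) (hM : 0 ≤ M) (hρ : 0 ≤ ρ) (hAρ : eigenvalueTail S A ≤ S * ρ)
    (hlow : -((1 / 1000 : ℝ) • (A + ρ • 1)) ≤ M - A)
    (hupp : M - A ≤ (1 / 1000 : ℝ) • (A + ρ • 1))
    (hF1 : Fᵀ = F) (hF2 : F * F = F) (hF4 : (1 - F).trace ≤ S)
    (hF5 : (F * A).trace = eigenvalueTail S A)
    (hE1 : Eᵀ = E) (hE2 : E * E = E) (hE3 : A * E = E * A) (hE4 : (1 - E).trace ≤ (41 * S : ℕ))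
    (hE5 : (E * A).trace = eigenvalueTail (41 * S) A)
    (hE6 : (((41 * S : ℕ) : ℝ) + 1 - S) • (E * A) ≤ eigenvalueTail S A • E)
    (htF : |(F * (M - A)).trace| ≤ 1 / 1000 * (S * ρ))
    (htE : |(E * (M - A)).trace| ≤ 1 / 1000 * (S * ρ)) : IsGoodSample S A M ρ := by
  have hS0 : (0 : ℝ) ≤ S := Nat.cast_nonneg S
  have hE0 := Matrix.nonneg_of_idempotent hE1 hE2
  have hEle := Matrix.le_one_of_idempotent hE1 hE2
  refine ⟨hlow, hupp, ?_, ?_⟩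
  · refine (eigenvalueTail_le_trace_projection hM hF1 hF2 hF4).trans ?_
    have := (abs_le.1 htF).2
    rw [Matrix.mul_sub, trace_sub, hF5] at this
    linarith
  have hEAE : E * A * E = E * A := by rw [mul_assoc, hE3, ← mul_assoc, hE2]
  have hEA0 : 0 ≤ E * A := by
    rw [← hEAE]
    have := Matrix.conj_mono hA E
    rwa [Matrix.mul_zero, Matrix.zero_mul, hE1] at this
  -- compression to the tail
  have ha : (E * M).trace - S * ((1001 / 1000) * (ρ / 40) + ρ / 1000) ≤ eigenvalueTail S M := by
    refine le_trans ?_ (eigenvalueTail_conj_le hM hE1 hE2 S)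
    have hX0 : 0 ≤ E * M * E := by
      have := Matrix.conj_mono hM E
      rwa [Matrix.mul_zero, Matrix.zero_mul, hE1] at this
    obtain ⟨P, hP1, hP2, -, hP4, hP5, -⟩ := exists_tail_projection hX0 S
    rw [← hP5]
    set s := (1001 / 1000) * (ρ / 40) + ρ / 1000 with hs
    have hs0 : 0 ≤ s := by positivity
    have hXs : E * M * E ≤ s • 1 := by
      have h1 : M ≤ (1001 / 1000 : ℝ) • A + (ρ / 1000) • 1 := by
        have := sub_le_iff_le_add.1 hupp
        refine this.trans (le_of_eq ?_)
        rw [smul_add, smul_smul, add_right_comm]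
        congr 1
        · nth_rw 2 [← one_smul ℝ A]
          rw [← add_smul]; norm_num
        · congr 1; ring
      have h2 := Matrix.conj_mono h1 E
      rw [hE1, Matrix.mul_add, Matrix.add_mul, Matrix.mul_smul, Matrix.smul_mul, hEAE,
        Matrix.mul_smul, Matrix.smul_mul, mul_one, hE2] at h2
      have h3 : E * A ≤ (ρ / 40) • E := by
        rcases Nat.eq_zero_or_pos S with rfl | hSpos
        · have : eigenvalueTail 0 A = 0 :=
            le_antisymm (by simpa using hAρ) (eigenvalueTail_nonneg hA 0)
          rw [this] at hE6
          norm_num at hE6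
          refine hE6.trans ?_
          have := Matrix.smul_mono_right hE0 (show (0 : ℝ) ≤ ρ / 40 by positivity)
          simpa using this
        · have hSp : (0 : ℝ) < S := by exact_mod_cast hSpos
          have hk : (0 : ℝ) < ((41 * S : ℕ) : ℝ) + 1 - S := by push_cast; linarith
          have h4 := Matrix.smul_mono_right hE6 (inv_nonneg.2 hk.le)
          rw [inv_smul_smul₀ hk.ne', smul_smul] at h4
          refine h4.trans (Matrix.smul_mono_left hE0 ?_)
          rw [inv_mul_le_iff₀ hk]
          push_cast
          nlinarith
      calc E * M * E ≤ (1001 / 1000 : ℝ) • (E * A) + (ρ / 1000) • E := h2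
        _ ≤ (1001 / 1000 : ℝ) • ((ρ / 40) • E) + (ρ / 1000) • E :=
            add_le_add_left (Matrix.smul_mono_right h3 (by norm_num)) _
        _ = s • E := by rw [smul_smul, ← add_smul]
        _ ≤ s • 1 := Matrix.smul_mono_right hEle hs0
    have h5 : ((1 - P) * (E * M * E)).trace ≤ S * s := by
      refine (Matrix.trace_mul_mono (sub_nonneg.2 (Matrix.le_one_of_idempotent hP1 hP2))
        hXs).trans ?_
      rw [Matrix.mul_smul, mul_one, trace_smul, smul_eq_mul, mul_comm]
      exact mul_le_mul_of_nonneg_right hP4 hs0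
    have h6 : (E * M * E).trace = (E * M).trace := by
      rw [trace_mul_comm, ← mul_assoc, hE2]
    rw [Matrix.sub_mul, one_mul, trace_sub, h6] at h5
    linarith
  -- compression to the head
  have hb : 999 / 1000 * (eigenvalueTail S A - eigenvalueTail (41 * S) A) - 41 * S * (ρ / 1000) ≤
      eigenvalueTail S M := by
    set H := 1 - E with hH
    have hH1 : Hᵀ = H := by rw [hH, transpose_sub, transpose_one, hE1]
    have hH2 : H * H = H := by rw [hH, sub_mul, mul_sub, mul_sub, hE2]; simp
    have hHAH : H * A * H = A - E * A := by
      rw [hH, Matrix.sub_mul, one_mul, Matrix.mul_sub, mul_one, Matrix.sub_mul, hE3, hEAE]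
      abel
    clear_value H
    refine le_trans ?_ (eigenvalueTail_conj_le hM hH1 hH2 S)
    have hX0 : 0 ≤ H * M * H := by
      have := Matrix.conj_mono hM H
      rwa [Matrix.mul_zero, Matrix.zero_mul, hH1] at this
    obtain ⟨P, hP1, hP2, -, hP4, hP5, -⟩ := exists_tail_projection hX0 S
    rw [← hP5]
    have hP0 := Matrix.nonneg_of_idempotent hP1 hP2
    have hPle := Matrix.le_one_of_idempotent hP1 hP2
    have h1 : (999 / 1000 : ℝ) • A - (ρ / 1000) • 1 ≤ M := by
      refine le_trans (le_of_eq ?_) (sub_le_iff_le_add.2 (neg_le_sub_iff_le_add.1 hlow))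
      rw [smul_add, smul_smul, ← sub_sub]
      congr 1
      · nth_rw 2 [← one_smul ℝ A]
        rw [← sub_smul]; norm_num
      · congr 1; ring
    have h2 := Matrix.conj_mono h1 H
    rw [hH1, Matrix.mul_sub, Matrix.sub_mul, Matrix.mul_smul, Matrix.smul_mul, hHAH,
      Matrix.mul_smul, Matrix.smul_mul, mul_one, hH2] at h2
    have h3 := Matrix.trace_mul_mono hP0 h2
    rw [Matrix.mul_sub, Matrix.mul_smul, Matrix.mul_smul, trace_sub, trace_smul, trace_smul,
      smul_eq_mul, smul_eq_mul] at h3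
    have h4 : (P * H).trace ≤ 41 * S := by
      have := Matrix.trace_mul_mono (Matrix.nonneg_of_idempotent hH1 hH2) hPle
      rw [mul_one, trace_mul_comm] at this
      push_cast at hE4
      linarith
    have h5 := eigenvalueTail_le_trace_projection hA hP1 hP2 hP4
    have h6 : (P * (E * A)).trace ≤ eigenvalueTail (41 * S) A := by
      have := Matrix.trace_mul_mono hEA0 hPle
      rw [mul_one, hE5, trace_mul_comm] at this
      exact this
    rw [Matrix.mul_sub, trace_sub] at h3
    nlinarith [mul_le_mul_of_nonneg_left h4 (show (0 : ℝ) ≤ ρ / 1000 by positivity)]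
  have hc := (abs_le.1 htE).1
  rw [Matrix.mul_sub, trace_sub, hE5] at hc
  have hr := eigenvalueTail_nonneg hA (41 * S)
  have hSρ : 0 ≤ S * ρ := by positivity
  -- The two lower bounds are averaged. The tail of order 41 S drops out up to a nonnegative
  -- remainder, and the errors 0.001, 0.025025, 0.001 and 0.041, in units of S ρ, have half their
  -- sum below 0.05.
  nlinarith

theorem IsGoodSample.mono {S : ℕ} {A M : Matrix (Fin N) (Fin N) ℝ} {ρ ρ' : ℝ}
    (h : IsGoodSample S A M ρ) (hρ : ρ ≤ ρ') : IsGoodSample S A M ρ' := by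
  have h1 : (1 / 1000 : ℝ) • (A + ρ • (1 : Matrix (Fin N) (Fin N) ℝ)) ≤
      (1 / 1000 : ℝ) • (A + ρ' • 1) :=
    Matrix.smul_mono_right (add_le_add_right (Matrix.smul_mono_left
      (nonneg_iff_posSemidef.2 PosSemidef.one) hρ) A) (by norm_num)
  have h2 : (S : ℝ) * ρ ≤ S * ρ' := mul_le_mul_of_nonneg_left hρ (Nat.cast_nonneg S)
  exact ⟨(neg_le_neg h1).trans h.lower, h.upper.trans h1, h.tail_upper.trans (by linarith),
    le_trans (by linarith) h.tail_lower⟩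

theorem Matrix.le_of_forall_pos_le_add_smul {n : Type*} [Fintype n] [DecidableEq n]
    {X Y Z : Matrix n n ℝ} (hX : Xᵀ = X) (hY : Yᵀ = Y)
    (h : ∀ η : ℝ, 0 < η → X ≤ Y + η • Z) : X ≤ Y := by
  rw [Matrix.le_iff_dotProduct hX hY]
  intro x
  have h1 : ∀ η : ℝ, 0 < η → x ⬝ᵥ X *ᵥ x ≤ x ⬝ᵥ Y *ᵥ x + η * (x ⬝ᵥ Z *ᵥ x) := fun η hη => by
    have := Matrix.dotProduct_mulVec_mono (h η hη) x
    simpa [add_mulVec, dotProduct_add, smul_mulVec, dotProduct_smul] using this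
  have h2 : Filter.Tendsto (fun η : ℝ => x ⬝ᵥ Y *ᵥ x + η * (x ⬝ᵥ Z *ᵥ x))
      (nhdsWithin 0 (Set.Ioi 0)) (nhds (x ⬝ᵥ Y *ᵥ x + 0 * (x ⬝ᵥ Z *ᵥ x))) :=
    (Continuous.tendsto (by fun_prop) 0).mono_left nhdsWithin_le_nhds
  rw [zero_mul, add_zero] at h2
  exact ge_of_tendsto h2 (Filter.eventually_of_mem self_mem_nhdsWithin fun η hη => h1 η hη)

/-- The ridge may vanish, and A + ρ need not be positive definite then. Concentration is proved at ρ
+ η, and the four conditions, being closed, pass to the limit. -/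
theorem IsGoodSample.of_forall_pos {S : ℕ} {A M : Matrix (Fin N) (Fin N) ℝ} {ρ : ℝ}
    (hA : Aᵀ = A) (hM : Mᵀ = M) (h : ∀ η : ℝ, 0 < η → IsGoodSample S A M (ρ + η)) :
    IsGoodSample S A M ρ := by
  have e : ∀ η : ℝ, (1 / 1000 : ℝ) • (A + (ρ + η) • (1 : Matrix (Fin N) (Fin N) ℝ)) =
      (1 / 1000 : ℝ) • (A + ρ • 1) + η • ((1 / 1000 : ℝ) • 1) := fun η => by
    rw [add_smul, ← add_assoc, smul_add _ _ (η • (1 : Matrix (Fin N) (Fin N) ℝ)),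
      smul_comm η]
  have ht1 : ((1 / 1000 : ℝ) • (A + ρ • (1 : Matrix (Fin N) (Fin N) ℝ)))ᵀ =
      (1 / 1000 : ℝ) • (A + ρ • 1) := by simp [hA]
  have hS0 : (0 : ℝ) ≤ S := Nat.cast_nonneg S
  have hlim : ∀ a b c : ℝ, (∀ η : ℝ, 0 < η → a ≤ b + η * c) → 0 ≤ c → a ≤ b := fun a b c hab hc => by
    refine le_of_forall_pos_le_add fun ξ hξ => (hab (ξ / (c + 1)) (by positivity)).trans ?_
    gcongr
    rw [div_mul_eq_mul_div, div_le_iff₀ (by linarith)]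
    nlinarith
  refine ⟨?_, ?_, ?_, ?_⟩
  · rw [neg_le]
    refine Matrix.le_of_forall_pos_le_add_smul (Z := (1 / 1000 : ℝ) • 1) (by simp [hA, hM]) ht1
      fun η hη => ?_
    rw [← e, neg_le]
    exact (h η hη).lower
  · refine Matrix.le_of_forall_pos_le_add_smul (Z := (1 / 1000 : ℝ) • 1) (by simp [hA, hM]) ht1
      fun η hη => ?_
    rw [← e]
    exact (h η hη).upper
  · refine hlim _ _ (1 / 1000 * S) (fun η hη => (h η hη).tail_upper.trans (le_of_eq (by ring)))
      (by positivity)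
  · refine sub_le_iff_le_add.2 (hlim _ _ (5 / 100 * S) (fun η hη => ?_) (by positivity))
    have := (h η hη).tail_lower
    linarith

/-- Independent sampling with probabilities that dominate the ridge leverage scores. -/
theorem bernoulliProb_not_isGoodSample {p : Fin N → ℝ} (hp0 : ∀ i, 0 ≤ p i) (hp1 : ∀ i, p i ≤ 1)
    {u : Fin N → Fin N → ℝ} {A : Matrix (Fin N) (Fin N) ℝ}
    (hAu : A = ∑ i, vecMulVec (u i) (u i)) {S : ℕ} (hS : 1 ≤ S) {ρ β d : ℝ} (hρ : 0 < ρ)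
    (hAρ : eigenvalueTail S A ≤ S * ρ) (hβ : 0 < β) (hβ1 : 8 * β ≤ (1 / 1000) ^ 2)
    (hb : ∀ i, p i < 1 → vecMulVec (u i) (u i) ≤ (p i * β) • (A + ρ • 1))
    (hd : ((A + ρ • (1 : Matrix (Fin N) (Fin N) ℝ))⁻¹ * A).trace ≤ d) :
    bernoulliProb p {B | ¬ IsGoodSample S A
        (∑ i, (if i ∈ B then (p i)⁻¹ else 0) • vecMulVec (u i) (u i)) ρ} ≤
      (4 * d + 8) * Real.exp (-((1 / 1000) ^ 2 / (8 * β))) := by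
  have hA : 0 ≤ A := by
    rw [hAu]; exact Finset.sum_nonneg fun i _ => Matrix.vecMulVec_self_nonneg _
  have hSp : (1 : ℝ) ≤ S := by exact_mod_cast hS
  have hSρ : 0 < S * ρ := by positivity
  have hG : (A + ρ • (1 : Matrix (Fin N) (Fin N) ℝ)).PosDef :=
    PosDef.posSemidef_add (nonneg_iff_posSemidef.1 hA) (PosDef.one.smul hρ)
  obtain ⟨F, hF1, hF2, hF3, hF4, hF5, hF6⟩ := exists_tail_projection hA S
  obtain ⟨E, hE1, hE2, hE3, hE4, hE5, hE6⟩ := exists_tail_projection hA (41 * S)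
  -- concentration of the trace against a tail projection
  have scalar : ∀ P : Matrix (Fin N) (Fin N) ℝ, Pᵀ = P → P * P = P → A * P = P * A →
      P * A ≤ (S * ρ) • P → (P * A).trace ≤ S * ρ →
      bernoulliProb p {B | ¬ |(P * sampleDeviation p u B).trace| ≤ 1 / 1000 * (S * ρ)} ≤
        4 * Real.exp (-((1 / 1000) ^ 2 / (8 * β))) := by
    intro P hP1 hP2 hP3 hP6 hPt
    have hP0 := Matrix.nonneg_of_idempotent hP1 hP2
    set a : Fin N → ℝ := fun i => u i ⬝ᵥ P *ᵥ u i with ha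
    have hav : ∀ i, (P * vecMulVec (u i) (u i)).trace = a i := fun i => by
      rw [mul_vecMulVec, trace_vecMulVec, dotProduct_comm]
    have ha0 : ∀ i, 0 ≤ a i := fun i => by
      have := Matrix.dotProduct_mulVec_mono hP0 (u i)
      simpa using this
    have hsumA : ∑ i, a i = (P * A).trace := by
      rw [hAu, Matrix.mul_sum, trace_sum]
      simp only [hav]
    have hdev : ∀ B, (P * sampleDeviation p u B).trace =
        ∑ i, ((if i ∈ B then (p i)⁻¹ else 0) - 1) * a i := fun B => by
      rw [sampleDeviation, Matrix.mul_sum, trace_sum]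
      refine Finset.sum_congr rfl fun i _ => ?_
      rw [Matrix.mul_smul, trace_smul, hav, smul_eq_mul]
    have h := bernoulliProb_sum_deviation hp0 hp1 ha0 hSρ (β := 2 * β) (ε := 1 / 1000)
      (by positivity) (by norm_num) (by norm_num) (by linarith) (fun i hi => by
        -- Testing `hb` at P u_i gives a_i² ≤ p_i β u_iᵀ P(A + ρ)P u_i ≤ 2 p_i β S ρ a_i, because PA
        -- ≤ S ρ P and ρ ≤ S ρ. Hence the scalar parameter 2 β.
        have h1 := Matrix.dotProduct_mulVec_mono (hb i hi) (P *ᵥ u i)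
        rw [Matrix.dotProduct_vecMulVec_mulVec] at h1
        have h2 : (P *ᵥ u i) ⬝ᵥ ((p i * β) • (A + ρ • 1)) *ᵥ (P *ᵥ u i) =
            (p i * β) * (u i ⬝ᵥ (P * (A + ρ • 1) * P) *ᵥ u i) := by
          rw [smul_mulVec, dotProduct_smul, smul_eq_mul, ← mulVec_mulVec, ← mulVec_mulVec,
            dotProduct_mulVec (u i) P, ← mulVec_transpose, hP1]
        have h3 : P * (A + ρ • 1) * P ≤ (2 * (S * ρ)) • P := by
          have : P * (A + ρ • 1) * P = P * A + ρ • P := by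
            rw [Matrix.mul_add, Matrix.add_mul, mul_assoc P A P, hP3, ← mul_assoc, hP2,
              Matrix.mul_smul, Matrix.smul_mul, mul_one, hP2]
          rw [this, two_mul, add_smul]
          exact add_le_add hP6 (Matrix.smul_mono_left hP0 (by nlinarith))
        have h4 := Matrix.dotProduct_mulVec_mono h3 (u i)
        rw [smul_mulVec, dotProduct_smul, smul_eq_mul] at h4
        rw [h2] at h1
        change a i ^ 2 ≤ _ at h1
        change _ ≤ 2 * (S * ρ) * a i at h4
        have hpb : 0 ≤ p i * β := mul_nonneg (hp0 i) hβ.le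
        have h5 : a i * a i ≤ (p i * (2 * β) * (S * ρ)) * a i := by
          nlinarith [mul_le_mul_of_nonneg_left h4 hpb]
        rcases (ha0 i).lt_or_eq with h6 | h6
        · exact le_of_mul_le_mul_right h5 h6
        · rw [← h6]
          have := mul_nonneg hpb hSρ.le
          linarith) (by rw [hsumA]; exact hPt)
    simp only [hdev]
    have e : 4 * (2 * β) = 8 * β := by ring
    rwa [e] at h
  have hmat := bernoulliProb_sampleDeviation (d := d) hp0 hp1 hG hβ (ε := 1 / 1000) (by norm_num)
    (by norm_num) (by linarith) hb (by
      rw [← hAu]; exact le_add_of_nonneg_right (Matrix.smul_one_nonneg hρ.le))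
    (by rw [← hAu]; exact hd)
  have hexp : Real.exp (-((1 / 1000) ^ 2 / (4 * β))) ≤ Real.exp (-((1 / 1000) ^ 2 / (8 * β))) := by
    gcongr
    norm_num
  have hd0 : 0 ≤ d := by
    refine le_trans ?_ hd
    exact Matrix.trace_mul_nonneg (nonneg_iff_posSemidef.2 hG.inv.posSemidef) hA
  have hFA : F * A ≤ (S * ρ) • F := by
    have := hF6 S le_rfl
    simp only [add_sub_cancel_left, one_smul] at this
    exact this.trans (Matrix.smul_mono_left (Matrix.nonneg_of_idempotent hF1 hF2) hAρ)
  have hE0 := Matrix.nonneg_of_idempotent hE1 hE2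
  have hEA : E * A ≤ (S * ρ) • E := by
    have h1 := hE6 S (by omega)
    have hEA0 : 0 ≤ E * A := by
      have h2 := Matrix.conj_mono hA E
      rw [Matrix.mul_zero, Matrix.zero_mul, hE1, mul_assoc, hE3, ← mul_assoc, hE2] at h2
      exact h2
    have h2 : (1 : ℝ) • (E * A) ≤ (((41 * S : ℕ) : ℝ) + 1 - S) • (E * A) :=
      Matrix.smul_mono_left hEA0 (by push_cast; linarith)
    rw [one_smul] at h2
    exact (h2.trans h1).trans (Matrix.smul_mono_left hE0 hAρ)
  have hEt : (E * A).trace ≤ S * ρ := by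
    refine le_trans ?_ hAρ
    have hF0 := Matrix.nonneg_of_idempotent hF1 hF2
    rw [hE5, ← hF5]
    refine eigenvalueTail_le_trace_projection hA hF1 hF2 (hF4.trans ?_)
    exact_mod_cast (by omega : S ≤ 41 * S)
  have h1 := scalar F hF1 hF2 hF3 hFA (hF5 ▸ hAρ)
  have h2 := scalar E hE1 hE2 hE3 hEA hEt
  have hM : ∀ B : Finset (Fin N), ∑ i, (if i ∈ B then (p i)⁻¹ else 0) • vecMulVec (u i) (u i) - A =
      sampleDeviation p u B := fun B => by
    rw [hAu, sampleDeviation, ← Finset.sum_sub_distrib]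
    simp only [sub_smul, one_smul]
  have hcover : {B | ¬ IsGoodSample S A
        (∑ i, (if i ∈ B then (p i)⁻¹ else 0) • vecMulVec (u i) (u i)) ρ} ⊆
      {B | ¬ (-((1 / 1000 : ℝ) • (A + ρ • 1)) ≤ sampleDeviation p u B ∧
        sampleDeviation p u B ≤ (1 / 1000 : ℝ) • (A + ρ • 1))} ∪
      ({B | ¬ |(F * sampleDeviation p u B).trace| ≤ 1 / 1000 * (S * ρ)} ∪
        {B | ¬ |(E * sampleDeviation p u B).trace| ≤ 1 / 1000 * (S * ρ)}) := by
    intro B hB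
    by_contra hcon
    simp only [Set.mem_union, Set.mem_ofPred_eq, not_or, not_not] at hcon hB
    rw [← hM] at hcon
    refine hB (isGoodSample_of_trace_le hA ?_ hρ.le hAρ hcon.1.1 hcon.1.2 hF1 hF2 hF4 hF5 hE1 hE2
      hE3 hE4 hE5 (hE6 S (by omega)) hcon.2.1 hcon.2.2)
    refine Finset.sum_nonneg fun i _ => ?_
    have : (0 : ℝ) ≤ if i ∈ B then (p i)⁻¹ else 0 := by
      split_ifs
      · exact inv_nonneg.2 (hp0 i)
      · exact le_rfl
    have := Matrix.smul_mono_right (Matrix.vecMulVec_self_nonneg (u i)) this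
    simpa using this
  -- The matrix deviation contributes 4 d and each of the two traces contributes 4; the weaker
  -- exponent of the traces serves for all three.
  have h3 := (bernoulliProb_mono hp0 hp1 hcover).trans ((bernoulliProb_union_le hp0 hp1 _ _).trans
    (add_le_add_right (bernoulliProb_union_le hp0 hp1 _ _) _))
  have h4 := mul_le_mul_of_nonneg_left hexp (show (0 : ℝ) ≤ 4 * d by positivity)
  linarith

end GoodSample

/-! ### Ridge leverage scores, effective dimension and reweighting. -/

section Leverage

open scoped MatrixOrder

theorem Matrix.posDef_add_smul_one {n : Type*} [Fintype n] [DecidableEq n] {A : Matrix n n ℝ}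
    (hA : 0 ≤ A) {ρ : ℝ} (hρ : 0 < ρ) : (A + ρ • (1 : Matrix n n ℝ)).PosDef :=
  PosDef.posSemidef_add (nonneg_iff_posSemidef.1 hA) (PosDef.one.smul hρ)

theorem Matrix.PosDef.dotProduct_inv_mulVec_nonneg {n : Type*} [Fintype n] [DecidableEq n]
    {G : Matrix n n ℝ} (hG : G.PosDef) (c : n → ℝ) : 0 ≤ c ⬝ᵥ G⁻¹ *ᵥ c := by
  have := Matrix.dotProduct_mulVec_mono (nonneg_iff_posSemidef.2 hG.inv.posSemidef) c
  simpa using this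

theorem Matrix.PosDef.mulVec_inv_mulVec {n : Type*} [Fintype n] [DecidableEq n]
    {G : Matrix n n ℝ} (hG : G.PosDef) (c : n → ℝ) : G *ᵥ (G⁻¹ *ᵥ c) = c := by
  rw [mulVec_mulVec, mul_nonsing_inv _ ((Matrix.isUnit_iff_isUnit_det _).1 hG.isUnit), one_mulVec]

/-- This is the Cauchy–Schwarz inequality (c ⬝ᵥ x)² ≤ (cᵀG⁻¹c)(xᵀGx), tested at x = G⁻¹c in one
direction and obtained from a discriminant in the other. It translates leverage scores into Loewner
bounds for rank-one terms. -/
theorem Matrix.PosDef.vecMulVec_le_smul_iff {n : Type*} [Fintype n] [DecidableEq n]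
    {G : Matrix n n ℝ} (hG : G.PosDef) (c : n → ℝ) {t : ℝ} (ht : 0 ≤ t) :
    vecMulVec c c ≤ t • G ↔ c ⬝ᵥ G⁻¹ *ᵥ c ≤ t := by
  have hGt := hG.1.transpose_eq
  have hGz := hG.mulVec_inv_mulVec c
  set z := G⁻¹ *ᵥ c with hz
  constructor
  · intro h
    have h1 := Matrix.dotProduct_mulVec_mono h z
    rw [Matrix.dotProduct_vecMulVec_mulVec, smul_mulVec, hGz, dotProduct_smul, smul_eq_mul,
      dotProduct_comm z c] at h1
    by_contra hcon
    push Not at hcon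
    nlinarith
  · intro h
    rw [Matrix.le_iff_dotProduct (Matrix.transpose_vecMulVec_self c) (by simp [hGt])]
    intro x
    rw [Matrix.dotProduct_vecMulVec_mulVec, smul_mulVec, dotProduct_smul, smul_eq_mul]
    have hq : ∀ s : ℝ, 0 ≤ (c ⬝ᵥ z) * (s * s) + (-2 * (c ⬝ᵥ x)) * s + x ⬝ᵥ G *ᵥ x := fun s => by
      have h1 := Matrix.dotProduct_mulVec_mono (nonneg_iff_posSemidef.2 hG.posSemidef) (x - s • z)
      have h2 : z ⬝ᵥ G *ᵥ x = c ⬝ᵥ x := by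
        rw [dotProduct_mulVec, ← mulVec_transpose, hGt, hGz]
      simp only [mulVec_sub, mulVec_smul, hGz, dotProduct_sub, sub_dotProduct, smul_dotProduct,
        dotProduct_smul, smul_eq_mul, zero_mulVec, dotProduct_zero, h2] at h1
      rw [dotProduct_comm z c, dotProduct_comm x c] at h1
      linarith
    have hd := discrim_le_zero hq
    rw [discrim] at hd
    have hx : 0 ≤ x ⬝ᵥ G *ᵥ x := by
      have := hq 0
      simpa using this
    nlinarith [mul_le_mul_of_nonneg_right h hx]

theorem Matrix.PosDef.vecMulVec_le {n : Type*} [Fintype n] [DecidableEq n]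
    {G : Matrix n n ℝ} (hG : G.PosDef) (c : n → ℝ) : vecMulVec c c ≤ (c ⬝ᵥ G⁻¹ *ᵥ c) • G :=
  (hG.vecMulVec_le_smul_iff c (hG.dotProduct_inv_mulVec_nonneg c)).2 le_rfl

/-- Inversion reverses the order: c cᵀ ≤ (cᵀH⁻¹c) H ≤ r (cᵀH⁻¹c) G, and the rank-one criterion reads
off the bound. -/
theorem Matrix.PosDef.dotProduct_inv_mulVec_le {n : Type*} [Fintype n] [DecidableEq n]
    {G H : Matrix n n ℝ} (hG : G.PosDef) (hH : H.PosDef) {r : ℝ} (hr : 0 ≤ r) (h : H ≤ r • G)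
    (c : n → ℝ) : c ⬝ᵥ G⁻¹ *ᵥ c ≤ r * (c ⬝ᵥ H⁻¹ *ᵥ c) := by
  have h0 := hH.dotProduct_inv_mulVec_nonneg c
  rw [← hG.vecMulVec_le_smul_iff c (by positivity), mul_comm, ← smul_smul]
  exact (hH.vecMulVec_le c).trans (Matrix.smul_mono_right h h0)

theorem Matrix.trace_mul_sum_smul_vecMulVec {ι n : Type*} [Fintype ι] [Fintype n]
    (X : Matrix n n ℝ) (D : ι → ℝ) (b : ι → n → ℝ) :
    (X * ∑ i, D i • vecMulVec (b i) (b i)).trace = ∑ i, D i * (b i ⬝ᵥ X *ᵥ b i) := by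
  rw [Matrix.mul_sum, trace_sum]
  refine Finset.sum_congr rfl fun i _ => ?_
  rw [Matrix.mul_smul, trace_smul, mul_vecMulVec, trace_vecMulVec, dotProduct_comm, smul_eq_mul]

variable {N : ℕ}

/-- The effective dimension is at most `2 S` if the ridge dominates the eigenvalue tail. -/
theorem trace_inv_add_smul_one_mul_le {A : Matrix (Fin N) (Fin N) ℝ} (hA : 0 ≤ A) {S : ℕ} {ρ : ℝ}
    (hρ : 0 < ρ) (hAρ : eigenvalueTail S A ≤ S * ρ) :
    ((A + ρ • (1 : Matrix (Fin N) (Fin N) ℝ))⁻¹ * A).trace ≤ 2 * S := by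
  have hG := Matrix.posDef_add_smul_one hA hρ
  set G := A + ρ • (1 : Matrix (Fin N) (Fin N) ℝ) with hGdef
  have hu := (Matrix.isUnit_iff_isUnit_det _).1 hG.isUnit
  have hGi : 0 ≤ G⁻¹ := nonneg_iff_posSemidef.2 hG.inv.posSemidef
  have hAG : A = G - ρ • 1 := by rw [hGdef, add_sub_cancel_right]
  have e1 : G⁻¹ * A = 1 - ρ • G⁻¹ := by
    rw [hAG, Matrix.mul_sub, nonsing_inv_mul _ hu, Matrix.mul_smul, mul_one]
  have h1 : G⁻¹ * A ≤ 1 := by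
    rw [e1]
    exact sub_le_self _ (by simpa using Matrix.smul_mono_right hGi hρ.le)
  have h2 : G⁻¹ * A ≤ ρ⁻¹ • A := by
    have e2 : ρ⁻¹ • A - G⁻¹ * A = ρ⁻¹ • (A * G⁻¹ * A) := by
      have : A * G⁻¹ * A = A - ρ • (G⁻¹ * A) := by
        nth_rw 1 [hAG]
        rw [Matrix.sub_mul, mul_nonsing_inv _ hu, Matrix.smul_mul, one_mul, Matrix.sub_mul, one_mul,
          Matrix.smul_mul]
      rw [this, smul_sub, smul_smul, inv_mul_cancel₀ hρ.ne', one_smul]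
    rw [← sub_nonneg, e2]
    have h3 := Matrix.conj_mono hGi A
    rw [Matrix.mul_zero, Matrix.zero_mul, (nonneg_iff_posSemidef.1 hA).1.transpose_eq] at h3
    simpa using Matrix.smul_mono_right h3 (inv_nonneg.2 hρ.le)
  -- On the head of the spectrum G⁻¹A ≤ 1 contributes at most S; on the tail G⁻¹A ≤ ρ⁻¹A contributes
  -- at most the eigenvalue tail over ρ, again at most S.
  obtain ⟨F, hF1, hF2, -, hF4, hF5, -⟩ := exists_tail_projection hA S
  have h3 := Matrix.trace_mul_mono (Matrix.nonneg_of_idempotent hF1 hF2) h2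
  have h4 := Matrix.trace_mul_mono (sub_nonneg.2 (Matrix.le_one_of_idempotent hF1 hF2)) h1
  rw [Matrix.mul_smul, trace_smul, hF5, smul_eq_mul] at h3
  rw [Matrix.sub_mul, one_mul, trace_sub, mul_one] at h4
  have h5 : ρ⁻¹ * eigenvalueTail S A ≤ S := by
    rw [inv_mul_le_iff₀ hρ, mul_comm]; exact hAρ
  linarith

/-- Rows can be scaled down so that their ridge leverage scores are at most `α`, changing only
`2 S / α` of them. -/
theorem exists_reweighting (b : Fin N → Fin N → ℝ) {S : ℕ} (hS : 1 ≤ S) {α η : ℝ} (hα : 0 < α)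
    (hη : 0 < η) : ∃ D : Fin N → ℝ, (∀ i, 0 ≤ D i) ∧ (∀ i, D i ≤ 1) ∧
      (∀ i, D i • vecMulVec (b i) (b i) ≤ α • ((∑ i, D i • vecMulVec (b i) (b i)) +
        (eigenvalueTail S (∑ i, D i • vecMulVec (b i) (b i)) / S + η) • 1)) ∧
      α * (Finset.univ.filter fun i => D i < 1).card ≤ 2 * S := by
  have hSp : (0 : ℝ) < S := by exact_mod_cast hS
  set A : (Fin N → ℝ) → Matrix (Fin N) (Fin N) ℝ := fun D => ∑ i, D i • vecMulVec (b i) (b i)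
    with hAdef
  set G : (Fin N → ℝ) → Matrix (Fin N) (Fin N) ℝ := fun D =>
    A D + (eigenvalueTail S (A D) / S + η) • 1 with hGdef
  have hA0 : ∀ D, (∀ i, 0 ≤ D i) → 0 ≤ A D := fun D hD => Finset.sum_nonneg fun i _ => by
    simpa using Matrix.smul_mono_right (Matrix.vecMulVec_self_nonneg (b i)) (hD i)
  have hAt : ∀ D, (A D)ᵀ = A D := fun D => by
    simp [hAdef, transpose_sum]
  have hGt : ∀ D, (G D)ᵀ = G D := fun D => by simp [hGdef, hAt]
  have hρ : ∀ D, (∀ i, 0 ≤ D i) → 0 < eigenvalueTail S (A D) / S + η := fun D hD => by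
    have := eigenvalueTail_nonneg (hA0 D hD) S
    positivity
  have hG : ∀ D, (∀ i, 0 ≤ D i) → (G D).PosDef := fun D hD =>
    Matrix.posDef_add_smul_one (hA0 D hD) (hρ D hD)
  -- the feasible set
  set box : Set (Fin N → ℝ) := Set.Icc 0 1 with hbox
  set feas : Set (Fin N → ℝ) := {D | ∀ (i : Fin N) (x : Fin N → ℝ) (F : Matrix (Fin N) (Fin N) ℝ),
    Fᵀ = F → F * F = F → (1 - F).trace ≤ S → D i * (b i ⬝ᵥ x) ^ 2 ≤
      α * (x ⬝ᵥ A D *ᵥ x + ((F * A D).trace / S + η) * (x ⬝ᵥ x))} with hfeas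
  have hAc : Continuous A := by fun_prop
  -- By Ky Fan's principle a bound by the eigenvalue tail is a family of bounds by tr(F A), one for
  -- each projection F of corank at most S. Each is continuous in D, so the feasible set is closed.
  have hclosed : IsClosed feas := by
    simp only [hfeas, Set.ofPred_forall]
    refine isClosed_iInter fun i => isClosed_iInter fun x => isClosed_iInter fun F =>
      isClosed_iInter fun _ => isClosed_iInter fun _ => isClosed_iInter fun _ => ?_
    refine isClosed_le (by fun_prop) ?_
    have h1 : Continuous fun D => x ⬝ᵥ A D *ᵥ x := by fun_prop
    have h2 : Continuous fun D => (F * A D).trace :=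
      (continuous_const.matrix_mul hAc).matrix_trace
    fun_prop
  have hiff : ∀ D, (∀ i, 0 ≤ D i) →
      (D ∈ feas ↔ ∀ i, D i • vecMulVec (b i) (b i) ≤ α • G D) := by
    intro D hD
    have hval : ∀ (i : Fin N) (x : Fin N → ℝ),
        x ⬝ᵥ (D i • vecMulVec (b i) (b i)) *ᵥ x = D i * (b i ⬝ᵥ x) ^ 2 := fun i x => by
      rw [smul_mulVec, dotProduct_smul, Matrix.dotProduct_vecMulVec_mulVec, smul_eq_mul]
    have hval2 : ∀ x : Fin N → ℝ, x ⬝ᵥ (α • G D) *ᵥ x =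
        α * (x ⬝ᵥ A D *ᵥ x + (eigenvalueTail S (A D) / S + η) * (x ⬝ᵥ x)) := fun x => by
      rw [hGdef, smul_mulVec, dotProduct_smul, add_mulVec, dotProduct_add, smul_mulVec,
        dotProduct_smul, one_mulVec, smul_eq_mul, smul_eq_mul]
    have hxx : ∀ x : Fin N → ℝ, 0 ≤ x ⬝ᵥ x := fun x => by
      simp only [dotProduct]
      exact Finset.sum_nonneg fun i _ => mul_self_nonneg _
    constructor
    · intro h i
      rw [Matrix.le_iff_dotProduct (by simp) (by simp [hGt])]
      intro x
      obtain ⟨F, hF1, hF2, -, hF4, hF5, -⟩ := exists_tail_projection (hA0 D hD) S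
      rw [hval, hval2, ← hF5]
      exact h i x F hF1 hF2 hF4
    · intro h i x F hF1 hF2 hF4
      have h1 := Matrix.dotProduct_mulVec_mono (h i) x
      rw [hval, hval2] at h1
      refine h1.trans ?_
      have := eigenvalueTail_le_trace_projection (hA0 D hD) hF1 hF2 hF4
      have := hxx x
      gcongr
  have hcomp : IsCompact (box ∩ feas) := isCompact_Icc.inter_right hclosed
  have hne : (box ∩ feas).Nonempty := by
    refine ⟨0, ⟨le_rfl, zero_le_one⟩, (hiff 0 fun i => le_rfl).2 fun i => ?_⟩
    rw [Pi.zero_apply, zero_smul]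
    simpa using Matrix.smul_mono_right
      (nonneg_iff_posSemidef.2 (hG 0 fun i => le_rfl).posSemidef) hα.le
  -- D has maximal total weight. Raising one D i < 1 only enlarges G, so the other constraints
  -- survive and the i-th must be the obstruction: its score is at least α. The scores sum to at
  -- most 2 S, which limits the number of such rows.
  obtain ⟨D, ⟨hDbox, hDfeas⟩, hmax⟩ := hcomp.exists_isMaxOn hne
    (f := fun D => ∑ i, D i) (by fun_prop)
  have hD0 : ∀ i, 0 ≤ D i := fun i => hDbox.1 i
  have hD1 : ∀ i, D i ≤ 1 := fun i => hDbox.2 i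
  have hDG := (hiff D hD0).1 hDfeas
  refine ⟨D, hD0, hD1, hDG, ?_⟩
  have hlev : ∀ i, D i < 1 → α ≤ D i * (b i ⬝ᵥ (G D)⁻¹ *ᵥ b i) := by
    intro i hi
    by_contra hcon
    push Not at hcon
    set l := b i ⬝ᵥ (G D)⁻¹ *ᵥ b i with hl
    have hl0 : 0 ≤ l := (hG D hD0).dotProduct_inv_mulVec_nonneg _
    obtain ⟨e, he0, he1, he2⟩ : ∃ e : ℝ, 0 < e ∧ D i + e ≤ 1 ∧ (D i + e) * l ≤ α := by
      refine ⟨min (1 - D i) ((α - D i * l) / (l + 1)), lt_min (by linarith)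
        (div_pos (by linarith) (by linarith)), ?_, ?_⟩
      · linarith [min_le_left (1 - D i) ((α - D i * l) / (l + 1))]
      · have h1 := min_le_right (1 - D i) ((α - D i * l) / (l + 1))
        have h2 : (α - D i * l) / (l + 1) * (l + 1) = α - D i * l :=
          div_mul_cancel₀ _ (by linarith)
        have h3 : 0 < (α - D i * l) / (l + 1) := div_pos (by linarith) (by linarith)
        nlinarith
    set D' : Fin N → ℝ := Function.update D i (D i + e) with hD'
    have hle : D ≤ D' := by
      intro j
      rw [hD', Function.update_apply]
      split_ifs with h
      · rw [h]; linarith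
      · exact le_rfl
    have hD'0 : ∀ j, 0 ≤ D' j := fun j => (hD0 j).trans (hle j)
    have hAle : A D ≤ A D' := Finset.sum_le_sum fun j _ =>
      Matrix.smul_mono_left (Matrix.vecMulVec_self_nonneg _) (hle j)
    have hGle : G D ≤ G D' := by
      have h1 := eigenvalueTail_mono (hA0 D hD0) hAle S
      refine add_le_add hAle (Matrix.smul_mono_left (nonneg_iff_posSemidef.2 PosSemidef.one) ?_)
      gcongr
    have hmem : D' ∈ box ∩ feas := by
      refine ⟨⟨fun j => hD'0 j, fun j => ?_⟩, (hiff D' hD'0).2 fun j => ?_⟩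
      · rw [hD', Function.update_apply]
        split_ifs with h
        · exact he1
        · exact hD1 j
      · refine le_trans ?_ (Matrix.smul_mono_right hGle hα.le)
        rw [hD', Function.update_apply]
        split_ifs with h
        · subst h
          have h1 := Matrix.smul_mono_right ((hG D hD0).vecMulVec_le (b j))
            (show 0 ≤ D j + e by linarith [hD0 j])
          rw [smul_smul] at h1
          exact h1.trans (Matrix.smul_mono_left
            (nonneg_iff_posSemidef.2 (hG D hD0).posSemidef) he2)
        · exact hDG j
    have h1 : ∑ j, D' j ≤ ∑ j, D j := hmax hmem
    have h2 : ∑ j, D j < ∑ j, D' j :=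
      Finset.sum_lt_sum (fun j _ => hle j) ⟨i, Finset.mem_univ i, by
        rw [hD', Function.update_self]; linarith⟩
    linarith
  have htr : ∑ i, D i * (b i ⬝ᵥ (G D)⁻¹ *ᵥ b i) ≤ 2 * S := by
    rw [← Matrix.trace_mul_sum_smul_vecMulVec]
    refine trace_inv_add_smul_one_mul_le (hA0 D hD0) (hρ D hD0) ?_
    rw [mul_add, mul_div_cancel₀ _ hSp.ne']
    have := mul_pos hSp hη
    linarith
  refine le_trans ?_ htr
  rw [mul_comm, ← nsmul_eq_mul]
  refine (Finset.card_nsmul_le_sum _ (fun i => D i * (b i ⬝ᵥ (G D)⁻¹ *ᵥ b i)) α fun i hi => ?_).trans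
    (Finset.sum_le_sum_of_subset_of_nonneg (Finset.subset_univ _) fun i _ _ => ?_)
  · exact hlev i (Finset.mem_filter.1 hi).2
  · exact mul_nonneg (hD0 i) ((hG D hD0).dotProduct_inv_mulVec_nonneg _)

end Leverage

/-! ### Leverage scores relative to a random half of the rows. -/

section HalfSample

open scoped MatrixOrder

/-- A family of increasing events that are all likely occurs simultaneously with the same
probability. -/
theorem bernoulliProb_not_forall_pos {ι : Type*} [Fintype ι] [DecidableEq ι] {p : ι → ℝ}
    (hp0 : ∀ i, 0 ≤ p i) (hp1 : ∀ i, p i ≤ 1) {E : ℝ → Finset ι → Prop} {c : ℝ}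
    (hE : ∀ η η', 0 < η → η ≤ η' → ∀ A, E η A → E η' A)
    (h : ∀ η, 0 < η → bernoulliProb p {A | ¬ E η A} ≤ c) :
    bernoulliProb p {A | ¬ ∀ η, 0 < η → E η A} ≤ c := by
  have h1 : ∀ A : Finset ι, ∃ η, 0 < η ∧ (E η A → ∀ η', 0 < η' → E η' A) := fun A => by
    by_cases hA : ∀ η', 0 < η' → E η' A
    · exact ⟨1, one_pos, fun _ => hA⟩
    · push Not at hA
      obtain ⟨η, hη, hn⟩ := hA
      exact ⟨η, hη, fun h => absurd h hn⟩
  choose f hf0 hf using h1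
  -- There are finitely many sets A, so one threshold below all their witnesses serves for every A
  -- at once.
  set η₀ := Finset.univ.inf' Finset.univ_nonempty f with hη₀
  have hpos : 0 < η₀ := (Finset.lt_inf'_iff _).2 fun A _ => hf0 A
  refine (bernoulliProb_mono hp0 hp1 fun A hA => ?_).trans (h η₀ hpos)
  exact fun hcon => hA (hf A (hE _ _ hpos (Finset.inf'_le _ (Finset.mem_univ A)) A hcon))

variable {N : ℕ}

theorem three_lt_log_div {S : ℕ} (hS : 1 ≤ S) {δ : ℝ} (hδ : 0 < δ) (hδ1 : δ < 1 / 32) :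
    3 < Real.log (S / δ) := by
  have hSp : (1 : ℝ) ≤ S := by exact_mod_cast hS
  rw [Real.lt_log_iff_exp_lt (by positivity), lt_div_iff₀ hδ]
  have h1 := Real.exp_one_lt_d9
  have h2 : Real.exp 3 = Real.exp 1 ^ 3 := by rw [← Real.exp_nat_mul]; norm_num
  have h3 : Real.exp 1 ^ 3 < 2.7182818286 ^ 3 := pow_lt_pow_left₀ h1 (Real.exp_pos 1).le (by norm_num)
  have h4 : Real.exp 3 < 32 := by rw [h2]; exact h3.trans (by norm_num)
  nlinarith

theorem eigenvalueTail_le_two_mul {A : Matrix (Fin N) (Fin N) ℝ} (hA : 0 ≤ A)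
    {M : Matrix (Fin N) (Fin N) ℝ} (hM : 0 ≤ M) (h : M ≤ (2 : ℝ) • A) (S : ℕ) :
    eigenvalueTail S M ≤ 2 * eigenvalueTail S A :=
  (eigenvalueTail_mono hM h S).trans (eigenvalueTail_smul_le hA (by norm_num) S)

/-- `tail_lower` prevents the ridge of A' from being much smaller than that of A: 0.44 ρ ≤ 2 τ +
0.49 η. `lower` gives 0.999 A − 0.001 ρ ≤ 2 A'; multiplied by 5/2 it absorbs the rest. Consequently
scores relative to the unweighted half A' are at most five times those relative to the reweighted A.
-/
theorem IsGoodSample.le_smul_half {S : ℕ} (hS : 1 ≤ S) {A M A' : Matrix (Fin N) (Fin N) ℝ}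
    {η : ℝ} (hη : 0 < η) (hA : 0 ≤ A) (hM : 0 ≤ M) (hA' : 0 ≤ A')
    (h : IsGoodSample S A M (eigenvalueTail S A / S + η)) (hMA : M ≤ (2 : ℝ) • A') :
    A + (eigenvalueTail S A / S + η) • (1 : Matrix (Fin N) (Fin N) ℝ) ≤
      (5 : ℝ) • (A' + (eigenvalueTail S A' / S + η) • 1) := by
  have hSp : (0 : ℝ) < S := by exact_mod_cast hS
  set ρ := eigenvalueTail S A / S + η with hρ
  have ht := eigenvalueTail_nonneg hA S
  have hρ0 : 0 ≤ ρ := by positivity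
  have hρS : S * ρ = eigenvalueTail S A + S * η := by rw [hρ]; field_simp
  have h1 := h.tail_lower
  have h2 := eigenvalueTail_le_two_mul hA' hM hMA S
  set τ := eigenvalueTail S A' / S with hτ
  have hτS : eigenvalueTail S A' = S * τ := by rw [hτ]; field_simp
  have h3 : 44 / 100 * ρ ≤ 2 * τ + 49 / 100 * η := by
    have : S * (44 / 100 * ρ) ≤ S * (2 * τ + 49 / 100 * η) := by linarith
    exact le_of_mul_le_mul_left this hSp
  have h4 : (999 / 1000 : ℝ) • A - (ρ / 1000) • 1 ≤ (2 : ℝ) • A' := by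
    refine le_trans (le_of_eq ?_) ((sub_le_iff_le_add.2 (neg_le_sub_iff_le_add.1 h.lower)).trans hMA)
    rw [smul_add, smul_smul, ← sub_sub]
    congr 1
    · nth_rw 2 [← one_smul ℝ A]
      rw [← sub_smul]; norm_num
    · congr 1; ring
  have h5 : A + ρ • 1 ≤ (5 / 2 : ℝ) • ((999 / 1000 : ℝ) • A - (ρ / 1000) • 1) +
      (5 * (τ + η)) • (1 : Matrix (Fin N) (Fin N) ℝ) := by
    rw [← sub_nonneg]
    have e : (5 / 2 : ℝ) • ((999 / 1000 : ℝ) • A - (ρ / 1000) • 1) +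
        (5 * (τ + η)) • (1 : Matrix (Fin N) (Fin N) ℝ) - (A + ρ • 1) =
        (5 / 2 * (999 / 1000) - 1 : ℝ) • A +
          (5 * (τ + η) - 5 / 2 * (ρ / 1000) - ρ) • (1 : Matrix (Fin N) (Fin N) ℝ) := by
      module
    rw [e]
    refine add_nonneg ?_ (Matrix.smul_one_nonneg (by linarith))
    simpa using Matrix.smul_mono_right hA (show (0 : ℝ) ≤ 5 / 2 * (999 / 1000) - 1 by norm_num)
  refine h5.trans ?_
  have h6 := Matrix.smul_mono_right h4 (show (0 : ℝ) ≤ 5 / 2 by norm_num)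
  refine (add_le_add_left h6 _).trans (le_of_eq ?_)
  module

/-- The truncated multiples of the ridge leverage scores with respect to the rows in `T` have a
small sum. -/
def HasSmallLeverage (b : Fin N → Fin N → ℝ) (S : ℕ) (H : ℝ) (T : Finset (Fin N)) : Prop :=
  ∀ η : ℝ, 0 < η → ∀ X : ℝ, 0 ≤ X →
    ∑ i, min 1 (X * (b i ⬝ᵥ ((∑ i ∈ T, vecMulVec (b i) (b i)) +
      (eigenvalueTail S (∑ i ∈ T, vecMulVec (b i) (b i)) / S + η) •
        (1 : Matrix (Fin N) (Fin N) ℝ))⁻¹ *ᵥ b i)) ≤ 96000000 * (S * H) + 10 * S * X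

/-- The ridge leverage scores with respect to a uniformly random half of the rows have a small
sum. -/
theorem bernoulliProb_half_leverage (b : Fin N → Fin N → ℝ) {S : ℕ} (hS : 1 ≤ S) {δ : ℝ}
    (hδ : 0 < δ) (hδ1 : δ < 1 / 32) :
    bernoulliProb (fun _ : Fin N => (1 / 2 : ℝ))
      {T | ¬ HasSmallLeverage b S (Real.log (S / δ)) T} ≤ δ / 2 := by
  have hSp : (1 : ℝ) ≤ S := by exact_mod_cast hS
  have hL := three_lt_log_div hS hδ hδ1
  set L := Real.log (S / δ) with hLdef
  have hA'0 : ∀ T : Finset (Fin N), 0 ≤ ∑ i ∈ T, vecMulVec (b i) (b i) := fun T =>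
    Finset.sum_nonneg fun i _ => Matrix.vecMulVec_self_nonneg _
  have hG' : ∀ (T : Finset (Fin N)) (η : ℝ), 0 < η → ((∑ i ∈ T, vecMulVec (b i) (b i)) +
        (eigenvalueTail S (∑ i ∈ T, vecMulVec (b i) (b i)) / S + η) •
          (1 : Matrix (Fin N) (Fin N) ℝ)).PosDef := fun T η hη =>
    Matrix.posDef_add_smul_one (hA'0 T) (by
      have := eigenvalueTail_nonneg (hA'0 T) S
      positivity)
  refine bernoulliProb_not_forall_pos (fun _ => by norm_num) (fun _ => by norm_num) ?_ ?_
  · intro η η' hη hηη' T h X hX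
    refine le_trans (Finset.sum_le_sum fun i _ => ?_) (h X hX)
    refine min_le_min_left _ (mul_le_mul_of_nonneg_left ?_ hX)
    have := (hG' T η' (hη.trans_le hηη')).dotProduct_inv_mulVec_le (hG' T η hη) zero_le_one
      (by
        rw [one_smul]
        exact add_le_add_right (Matrix.smul_mono_left (nonneg_iff_posSemidef.2 PosSemidef.one)
          (by linarith)) _) (b i)
    rwa [one_mul] at this
  intro η hη
  -- With inclusion probability 1/2 and β = 2 α the failure exponent 10⁻⁶/(16 α) equals 3 L, so the
  -- probability carries (δ/S)³. The number of scaled rows, at most 2 S/α, is then at most 96 · 10⁶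
  -- S L.
  set α : ℝ := (1 / 1000) ^ 2 / (48 * L) with hα
  have hα0 : 0 < α := by positivity
  obtain ⟨D, hD0, hD1, hDG, hcard⟩ := exists_reweighting b hS hα0 hη
  set A := ∑ i, D i • vecMulVec (b i) (b i) with hA
  set ρ := eigenvalueTail S A / S + η with hρdef
  have hA0 : 0 ≤ A := Finset.sum_nonneg fun i _ => by
    simpa using Matrix.smul_mono_right (Matrix.vecMulVec_self_nonneg (b i)) (hD0 i)
  have ht := eigenvalueTail_nonneg hA0 S
  have hρ : 0 < ρ := by positivity
  have hρS : eigenvalueTail S A ≤ S * ρ := by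
    rw [hρdef, mul_add, mul_div_cancel₀ _ (by positivity)]
    have : 0 ≤ S * η := by positivity
    linarith
  have hG := Matrix.posDef_add_smul_one hA0 hρ
  have htr := trace_inv_add_smul_one_mul_le hA0 hρ hρS
  have huu : ∀ i, vecMulVec (Real.sqrt (D i) • b i) (Real.sqrt (D i) • b i) =
      D i • vecMulVec (b i) (b i) := fun i => by
    rw [vecMulVec_smul, smul_vecMulVec, smul_smul, Real.mul_self_sqrt (hD0 i)]
  have hprob := bernoulliProb_not_isGoodSample (p := fun _ : Fin N => (1 / 2 : ℝ))
    (fun _ => by norm_num) (fun _ => by norm_num) (u := fun i => Real.sqrt (D i) • b i) (A := A)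
    (by simp only [huu]; exact hA) hS hρ hρS (β := 2 * α) (d := 2 * S) (by positivity)
    (by
      rw [hα]
      have : (1 / 1000 : ℝ) ^ 2 / (48 * L) ≤ (1 / 1000) ^ 2 / (48 * 3) := by gcongr
      linarith) (fun i _ => by
      rw [huu, show (1 / 2 : ℝ) * (2 * α) = α by ring]
      exact hDG i) htr
  have hexp : Real.exp (-((1 / 1000) ^ 2 / (8 * (2 * α)))) = (δ / S) ^ 3 := by
    have e : -((1 / 1000 : ℝ) ^ 2 / (8 * (2 * α))) = (3 : ℕ) * Real.log (δ / S) := by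
      rw [show δ / S = (S / δ)⁻¹ by rw [inv_div], Real.log_inv, ← hLdef, hα]
      field_simp
      norm_num
    rw [e, Real.exp_nat_mul, Real.exp_log (by positivity)]
  rw [hexp] at hprob
  refine (bernoulliProb_mono (fun _ => by norm_num) (fun _ => by norm_num) fun T hT => ?_).trans
    (hprob.trans ?_)
  · intro hgood
    refine hT fun X hX => ?_
    simp only [huu] at hgood
    set M := ∑ i, (if i ∈ T then ((1 / 2 : ℝ))⁻¹ else 0) • D i • vecMulVec (b i) (b i) with hM
    have hM0 : 0 ≤ M := Finset.sum_nonneg fun i _ => by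
      rw [smul_smul]
      have : 0 ≤ (if i ∈ T then ((1 / 2 : ℝ))⁻¹ else 0) * D i :=
        mul_nonneg (by split_ifs <;> norm_num) (hD0 i)
      simpa using Matrix.smul_mono_right (Matrix.vecMulVec_self_nonneg (b i)) this
    have hMA : M ≤ (2 : ℝ) • ∑ i ∈ T, vecMulVec (b i) (b i) := by
      rw [hM, Finset.smul_sum, ← Finset.sum_filter_add_sum_filter_not Finset.univ (· ∈ T)]
      rw [Finset.filter_mem_eq_inter, Finset.univ_inter]
      have h0 : ∑ i with i ∉ T, (if i ∈ T then ((1 / 2 : ℝ))⁻¹ else 0) •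
          D i • vecMulVec (b i) (b i) = 0 := Finset.sum_eq_zero fun i hi => by
        rw [if_neg (Finset.mem_filter.1 hi).2, zero_smul]
      rw [h0, add_zero]
      refine Finset.sum_le_sum fun i hi => ?_
      rw [if_pos hi, smul_smul]
      exact Matrix.smul_mono_left (Matrix.vecMulVec_self_nonneg _) (by
        have := hD1 i
        norm_num; exact this)
    have hle := hgood.le_smul_half hS hη hA0 hM0 (hA'0 T) hMA
    have hlev : ∀ i, b i ⬝ᵥ ((∑ i ∈ T, vecMulVec (b i) (b i)) +
        (eigenvalueTail S (∑ i ∈ T, vecMulVec (b i) (b i)) / S + η) •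
          (1 : Matrix (Fin N) (Fin N) ℝ))⁻¹ *ᵥ b i ≤
        5 * (b i ⬝ᵥ (A + ρ • (1 : Matrix (Fin N) (Fin N) ℝ))⁻¹ *ᵥ b i) := fun i =>
      (hG' T η hη).dotProduct_inv_mulVec_le hG (by norm_num) hle (b i)
    set l : Fin N → ℝ := fun i => b i ⬝ᵥ (A + ρ • (1 : Matrix (Fin N) (Fin N) ℝ))⁻¹ *ᵥ b i with hl
    have hl0 : ∀ i, 0 ≤ l i := fun i => hG.dotProduct_inv_mulVec_nonneg _
    have hDl : ∑ i, D i * l i ≤ 2 * S := by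
      rw [← Matrix.trace_mul_sum_smul_vecMulVec]
      exact htr
    -- A row that was scaled down is charged the truncation value 1. A row with D i = 1 is charged
    -- through its score relative to A, and D-weighted scores sum to at most 2 S.
    have hterm : ∀ i, min 1 (X * (b i ⬝ᵥ ((∑ i ∈ T, vecMulVec (b i) (b i)) +
        (eigenvalueTail S (∑ i ∈ T, vecMulVec (b i) (b i)) / S + η) •
          (1 : Matrix (Fin N) (Fin N) ℝ))⁻¹ *ᵥ b i)) ≤
        (if D i < 1 then 1 else 0) + 5 * X * (D i * l i) := fun i => by
      have h0 : 0 ≤ 5 * X * (D i * l i) :=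
        mul_nonneg (by positivity) (mul_nonneg (hD0 i) (hl0 i))
      split_ifs with h
      · exact (min_le_left _ _).trans (by linarith)
      · have h1 : D i = 1 := le_antisymm (hD1 i) (not_lt.1 h)
        refine (min_le_right _ _).trans ?_
        rw [h1]
        have := mul_le_mul_of_nonneg_left (hlev i) hX
        linarith
    refine (Finset.sum_le_sum fun i _ => hterm i).trans ?_
    rw [Finset.sum_add_distrib, Finset.sum_boole, ← Finset.mul_sum]
    have h1 : ((Finset.univ.filter fun i => D i < 1).card : ℝ) ≤ 96000000 * (S * L) := by
      have h2 : α * (96000000 * (S * L)) = 2 * S := by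
        rw [hα]; field_simp; norm_num
      rw [← h2] at hcard
      exact le_of_mul_le_mul_left hcard hα0
    have h2 := mul_le_mul_of_nonneg_left hDl (show 0 ≤ 5 * X by positivity)
    linarith
  · have h1 : (δ / S) ^ 3 ≤ δ ^ 3 / S := by
      rw [div_pow]
      gcongr
      exact le_self_pow₀ hSp (by norm_num)
    have h2 : (4 * (2 * (S : ℝ)) + 8) * (δ / S) ^ 3 ≤ (16 * S) * (δ ^ 3 / S) := by
      refine mul_le_mul (by linarith) h1 (by positivity) (by positivity)
    have h3 : (16 * (S : ℝ)) * (δ ^ 3 / S) = 16 * δ ^ 3 := by field_simp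
    rw [h3] at h2
    nlinarith [mul_pos hδ hδ, mul_le_mul_of_nonneg_left hδ1.le hδ.le,
      mul_le_mul_of_nonneg_left hδ1.le (mul_pos hδ hδ).le]

end HalfSample

/-! ### The algorithm's scores as leverage scores of the rows of a factor of K. -/

section ApproximateLeverage

open scoped MatrixOrder

variable {N : ℕ}

/-- The weighted sum `∑ (w i)² bᵢ bᵢᵀ` over the rows `bᵢ` of `B`. -/
def weightedGram (B : Matrix (Fin N) (Fin N) ℝ) (w : Fin N → ℝ) : Matrix (Fin N) (Fin N) ℝ :=
  ∑ i, w i ^ 2 • vecMulVec (B i) (B i)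

theorem weightedGram_nonneg (B : Matrix (Fin N) (Fin N) ℝ) (w : Fin N → ℝ) :
    0 ≤ weightedGram B w :=
  Finset.sum_nonneg fun i _ => by
    simpa using Matrix.smul_mono_right (Matrix.vecMulVec_self_nonneg (B i)) (sq_nonneg (w i))

theorem weightedGram_eq (B : Matrix (Fin N) (Fin N) ℝ) (w : Fin N → ℝ) :
    weightedGram B w = (diagonal w * B)ᵀ * (diagonal w * B) := by
  ext j k
  simp only [weightedGram, Matrix.sum_apply, Matrix.smul_apply, vecMulVec_apply, smul_eq_mul,
    Matrix.mul_apply (M := (diagonal w * B)ᵀ), transpose_apply, diagonal_mul]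
  exact Finset.sum_congr rfl fun i _ => by ring

/-- The limit of the leverage scores from above the data-dependent ridge. -/
noncomputable def ridgeLeverage (B : Matrix (Fin N) (Fin N) ℝ) (w : Fin N → ℝ) (s : ℝ)
    (i : Fin N) : ℝ :=
  B i ⬝ᵥ (weightedGram B w + s • (1 : Matrix (Fin N) (Fin N) ℝ))⁻¹ *ᵥ B i

theorem ridgeLeverage_nonneg (B : Matrix (Fin N) (Fin N) ℝ) (w : Fin N → ℝ) {s : ℝ} (hs : 0 < s)
    (i : Fin N) : 0 ≤ ridgeLeverage B w s i :=
  (Matrix.posDef_add_smul_one (weightedGram_nonneg B w) hs).dotProduct_inv_mulVec_nonneg _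

theorem ridgeLeverage_antitone (B : Matrix (Fin N) (Fin N) ℝ) (w : Fin N → ℝ) {s t : ℝ}
    (hs : 0 < s) (hst : s ≤ t) (i : Fin N) : ridgeLeverage B w t i ≤ ridgeLeverage B w s i := by
  have hM := weightedGram_nonneg B w
  have := (Matrix.posDef_add_smul_one hM (hs.trans_le hst)).dotProduct_inv_mulVec_le
    (Matrix.posDef_add_smul_one hM hs) zero_le_one (by
      rw [one_smul]
      exact add_le_add_right (Matrix.smul_mono_left (nonneg_iff_posSemidef.2 PosSemidef.one)
        hst) _) (B i)
  rwa [one_mul] at this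

/-- Together with `ridgeLeverage_antitone` this squeezes the scores as the ridge decreases to a
positive limit. -/
theorem ridgeLeverage_le_mul (B : Matrix (Fin N) (Fin N) ℝ) (w : Fin N → ℝ) {s t : ℝ}
    (hs : 0 < s) (hst : s ≤ t) (i : Fin N) :
    ridgeLeverage B w s i ≤ t / s * ridgeLeverage B w t i := by
  have hM := weightedGram_nonneg B w
  have hts : 1 ≤ t / s := (one_le_div hs).2 hst
  refine (Matrix.posDef_add_smul_one hM hs).dotProduct_inv_mulVec_le
    (Matrix.posDef_add_smul_one hM (hs.trans_le hst)) (by linarith) ?_ (B i)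
  rw [smul_add, smul_smul, div_mul_cancel₀ _ hs.ne']
  refine add_le_add_left ?_ _
  have := Matrix.smul_mono_left hM hts
  rwa [one_smul] at this

variable {B K : Matrix (Fin N) (Fin N) ℝ} {w : Fin N → ℝ}

theorem diagonal_mul_mul_diagonal_eq (hK : K = B * Bᵀ) :
    diagonal w * K * diagonal w = (diagonal w * B) * (diagonal w * B)ᵀ := by
  rw [hK, transpose_mul, diagonal_transpose]
  simp only [mul_assoc]

theorem sampleRidge_eq (hK : K = B * Bᵀ) (S : ℕ) :
    sampleRidge K S w = eigenvalueTail S (weightedGram B w) / S := by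
  rw [sampleRidge, diagonal_mul_mul_diagonal_eq hK, eigenvalueTail_mul_transpose_comm,
    weightedGram_eq]

/-- Woodbury's identity 1 − Xᵀ(XXᵀ + s)⁻¹X = s(XᵀX + s)⁻¹, with X = diagonal w * B, turns the
formula in K into a leverage score of row i of B. -/
theorem sampleLeverage_eq (hK : K = B * Bᵀ) {s : ℝ} (hs : 0 < s) (i : Fin N) :
    sampleLeverage K w s i = min 1 (ridgeLeverage B w s i) := by
  set X := diagonal w * B with hX
  have hWG : weightedGram B w = Xᵀ * X := weightedGram_eq B w
  clear_value X
  have hG := Matrix.posDef_add_smul_one (weightedGram_nonneg B w) hs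
  have hH : (X * Xᵀ + s • (1 : Matrix (Fin N) (Fin N) ℝ)).PosDef :=
    Matrix.posDef_add_smul_one (nonneg_iff_posSemidef.2
      (by simpa using posSemidef_self_mul_conjTranspose X)) hs
  have huG := (Matrix.isUnit_iff_isUnit_det _).1 hG.isUnit
  have huH := (Matrix.isUnit_iff_isUnit_det _).1 hH.isUnit
  have hwood : 1 - Xᵀ * (X * Xᵀ + s • (1 : Matrix (Fin N) (Fin N) ℝ))⁻¹ * X =
      s • (weightedGram B w + s • (1 : Matrix (Fin N) (Fin N) ℝ))⁻¹ := by
    have e : (weightedGram B w + s • (1 : Matrix (Fin N) (Fin N) ℝ)) *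
        (1 - Xᵀ * (X * Xᵀ + s • (1 : Matrix (Fin N) (Fin N) ℝ))⁻¹ * X) = s • 1 := by
      rw [hWG]
      have e2 : (Xᵀ * X + s • (1 : Matrix (Fin N) (Fin N) ℝ)) * Xᵀ =
          Xᵀ * (X * Xᵀ + s • (1 : Matrix (Fin N) (Fin N) ℝ)) := by
        rw [Matrix.add_mul, Matrix.mul_add, Matrix.smul_mul, Matrix.mul_smul, one_mul, mul_one,
          mul_assoc]
      rw [Matrix.mul_sub, mul_one, ← mul_assoc _ (Xᵀ * _) X, ← mul_assoc _ Xᵀ, e2, mul_assoc Xᵀ,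
        mul_nonsing_inv _ huH, mul_one, add_sub_cancel_left]
    have := congrArg ((weightedGram B w + s • (1 : Matrix (Fin N) (Fin N) ℝ))⁻¹ * ·) e
    simp only [← mul_assoc] at this
    rwa [nonsing_inv_mul _ huG, one_mul, Matrix.mul_smul, mul_one] at this
  have hmain : K - K * diagonal w * (diagonal w * K * diagonal w + s • 1)⁻¹ * (diagonal w * K) =
      s • (B * (weightedGram B w + s • (1 : Matrix (Fin N) (Fin N) ℝ))⁻¹ * Bᵀ) := by
    rw [diagonal_mul_mul_diagonal_eq hK, ← hX]
    have e1 : K * diagonal w = B * Xᵀ := by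
      rw [hK, hX, transpose_mul, diagonal_transpose, mul_assoc]
    have e2 : diagonal w * K = X * Bᵀ := by rw [hK, hX, mul_assoc]
    rw [e1, e2, ← Matrix.smul_mul, ← Matrix.mul_smul, ← hwood, Matrix.mul_sub, Matrix.sub_mul,
      mul_one, ← hK]
    simp only [mul_assoc]
  rw [sampleLeverage, hmain, Matrix.smul_apply, smul_eq_mul, ← mul_assoc, inv_mul_cancel₀ hs.ne',
    one_mul]
  congr 1
  rw [Matrix.mul_assoc, Matrix.mul_apply', ridgeLeverage]
  rfl

theorem sampleRidge_nonneg (hK : K = B * Bᵀ) (S : ℕ) : 0 ≤ sampleRidge K S w := by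
  rw [sampleRidge_eq hK]
  have := eigenvalueTail_nonneg (weightedGram_nonneg B w) S
  positivity

/-- The approximate leverage scores are limits from above of the data-dependent ridge. -/
theorem tendsto_min_ridgeLeverage (hK : K = B * Bᵀ) (S : ℕ) (i : Fin N) :
    Filter.Tendsto (fun s => min 1 (ridgeLeverage B w (sampleRidge K S w + s) i))
      (nhdsWithin 0 (Set.Ioi 0)) (nhds (approxLeverage K S w i)) := by
  have hω := sampleRidge_nonneg (w := w) hK S
  rw [approxLeverage]
  split_ifs with h
  · rw [sampleLeverage_eq hK h]
    refine Filter.Tendsto.min tendsto_const_nhds ?_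
    set ω := sampleRidge K S w
    have h1 : Filter.Tendsto (fun s => ω / (ω + s) * ridgeLeverage B w ω i)
        (nhdsWithin 0 (Set.Ioi 0)) (nhds (ω / (ω + 0) * ridgeLeverage B w ω i)) := by
      refine Filter.Tendsto.mono_left ?_ nhdsWithin_le_nhds
      refine Filter.Tendsto.mul_const _ (Filter.Tendsto.div tendsto_const_nhds ?_ (by simpa using h.ne'))
      exact Continuous.tendsto (by fun_prop) 0
    rw [add_zero, div_self h.ne', one_mul] at h1
    refine tendsto_of_tendsto_of_tendsto_of_le_of_le' h1 tendsto_const_nhds ?_ ?_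
    · refine Filter.eventually_of_mem self_mem_nhdsWithin fun s hs => ?_
      have hs' : 0 < s := hs
      have := ridgeLeverage_le_mul B w h (show ω ≤ ω + s by linarith) i
      rw [div_mul_eq_mul_div, div_le_iff₀ (by linarith)]
      rw [div_mul_eq_mul_div, le_div_iff₀ h] at this
      linarith
    · refine Filter.eventually_of_mem self_mem_nhdsWithin fun s hs => ?_
      have hs' : 0 < s := hs
      exact ridgeLeverage_antitone B w h (by linarith) i
  · have h0 : sampleRidge K S w = 0 := le_antisymm (not_lt.1 h) hω
    rw [h0]
    simp only [zero_add]
    have e : (⨆ s : Set.Ioi (0 : ℝ), sampleLeverage K w s i) =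
        sSup ((fun s => min 1 (ridgeLeverage B w s i)) '' Set.Ioi 0) := by
      rw [sSup_image']
      exact iSup_congr fun s => sampleLeverage_eq hK s.2 i
    rw [e]
    -- A bounded antitone function tends from the right to its supremum, which is how the score at
    -- ridge zero is defined.
    refine AntitoneOn.tendsto_nhdsGT (fun s hs t _ hst =>
      min_le_min_left _ (ridgeLeverage_antitone B w hs hst i)) ⟨1, ?_⟩
    rintro _ ⟨s, -, rfl⟩
    exact min_le_left _ _

/-- Scores decrease in the ridge. The positive shift s keeps the matrix invertible when the
data-dependent ridge is zero. -/
theorem min_ridgeLeverage_le_approxLeverage (hK : K = B * Bᵀ) (S : ℕ) (i : Fin N) {s : ℝ}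
    (hs : 0 < s) :
    min 1 (ridgeLeverage B w (sampleRidge K S w + s) i) ≤ approxLeverage K S w i := by
  have hω := sampleRidge_nonneg (w := w) hK S
  refine ge_of_tendsto (tendsto_min_ridgeLeverage hK S i) ?_
  filter_upwards [Ioo_mem_nhdsGT hs] with t ht
  exact min_le_min_left _ (ridgeLeverage_antitone B w (by linarith [ht.1]) (by linarith [ht.2]) i)

theorem approxLeverage_nonneg (hK : K = B * Bᵀ) (S : ℕ) (i : Fin N) :
    0 ≤ approxLeverage K S w i := by
  have hω := sampleRidge_nonneg (w := w) hK S
  refine le_trans ?_ (min_ridgeLeverage_le_approxLeverage hK S i one_pos)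
  exact le_min zero_le_one (ridgeLeverage_nonneg B w (by linarith) i)

theorem approxLeverage_le_one (hK : K = B * Bᵀ) (S : ℕ) (i : Fin N) :
    approxLeverage K S w i ≤ 1 :=
  le_of_tendsto (tendsto_min_ridgeLeverage hK S i) (Filter.Eventually.of_forall fun _ =>
    min_le_left _ _)

end ApproximateLeverage

/-! ### Accuracy of the estimated scores. -/

section RecursiveSampling

open scoped MatrixOrder

/-- A union bound for two-stage randomness: bad first-stage outcomes are charged in full, and
impossible ones impose nothing on the second stage. -/
theorem PMF.toOuterMeasure_bind_le {α β : Type*} (p : PMF α) (f : α → PMF β) (s : Set β)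
    (bad : Set α) {c : ℝ≥0∞} (h : ∀ a, a ∉ bad → p a ≠ 0 → (f a).toOuterMeasure s ≤ c) :
    (p.bind f).toOuterMeasure s ≤ p.toOuterMeasure bad + c := by
  rw [PMF.toOuterMeasure_bind_apply, PMF.toOuterMeasure_apply]
  have h1 : ∀ a, p a * (f a).toOuterMeasure s ≤ bad.indicator p a + p a * c := fun a => by
    by_cases ha : a ∈ bad
    · rw [Set.indicator_of_mem ha]
      have h2 : (f a).toOuterMeasure s ≤ 1 := by
        rw [PMF.toOuterMeasure_apply, ← (f a).tsum_coe]
        exact ENNReal.tsum_le_tsum fun x => Set.indicator_le_self _ _ x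
      exact (mul_le_mul_right h2 (p a)).trans (by rw [mul_one]; exact le_self_add)
    · rw [Set.indicator_of_notMem ha, zero_add]
      by_cases hp : p a = 0
      · simp [hp]
      · exact mul_le_mul_right (h a ha hp) _
  refine (ENNReal.tsum_le_tsum h1).trans ?_
  rw [ENNReal.tsum_add, ENNReal.tsum_mul_right, p.tsum_coe, one_mul]

variable {N : ℕ}

theorem independentSubset_apply (p : Fin N → unitInterval) (A : Finset (Fin N)) :
    independentSubset p A =
      (∏ i ∈ A, ENNReal.ofReal (p i)) * ∏ i ∈ Aᶜ, ENNReal.ofReal (1 - p i) := rfl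

theorem independentSubset_toOuterMeasure (p : Fin N → unitInterval) (E : Set (Finset (Fin N))) :
    (independentSubset p).toOuterMeasure E =
      ENNReal.ofReal (bernoulliProb (fun i => (p i : ℝ)) E) := by
  have h0 : ∀ A : Finset (Fin N),
      0 ≤ (∏ i ∈ A, (p i : ℝ)) * ∏ i ∈ Finset.univ \ A, (1 - (p i : ℝ)) := fun A =>
    mul_nonneg (Finset.prod_nonneg fun i _ => (p i).2.1)
      (Finset.prod_nonneg fun i _ => sub_nonneg.2 (p i).2.2)
  rw [PMF.toOuterMeasure_apply_fintype, bernoulliProb, bernoulliExp, Finset.powerset_univ,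
    ENNReal.ofReal_sum_of_nonneg fun A _ =>
      mul_nonneg (h0 A) (Set.indicator_nonneg (fun _ _ => by simp) A)]
  refine Finset.sum_congr rfl fun A _ => ?_
  by_cases hA : A ∈ E
  · rw [Set.indicator_of_mem hA, Set.indicator_of_mem hA, Pi.one_apply, mul_one,
      independentSubset_apply,
      ENNReal.ofReal_mul (Finset.prod_nonneg fun i _ => (p i).2.1),
      ENNReal.ofReal_prod_of_nonneg fun i _ => (p i).2.1,
      ENNReal.ofReal_prod_of_nonneg fun i _ => sub_nonneg.2 (p i).2.2, Finset.compl_eq_univ_sdiff]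
  · rw [Set.indicator_of_notMem hA, Set.indicator_of_notMem hA, mul_zero, ENNReal.ofReal_zero]

theorem mem_of_independentSubset_ne_zero {p : Fin N → unitInterval} {A : Finset (Fin N)}
    (h : independentSubset p A ≠ 0) {i : Fin N} (hi : i ∈ A) : p i ≠ 0 := by
  intro h0
  refine h ?_
  rw [independentSubset_apply, Finset.prod_eq_zero hi (by simp [h0]), zero_mul]

/-- The sum of `bᵢ bᵢᵀ` over the rows `bᵢ`, `i ∈ T`, of `B`. -/
def rowGram (B : Matrix (Fin N) (Fin N) ℝ) (T : Finset (Fin N)) : Matrix (Fin N) (Fin N) ℝ :=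
  ∑ i ∈ T, vecMulVec (B i) (B i)

theorem rowGram_nonneg (B : Matrix (Fin N) (Fin N) ℝ) (T : Finset (Fin N)) : 0 ≤ rowGram B T :=
  Finset.sum_nonneg fun _ _ => Matrix.vecMulVec_self_nonneg _

theorem rowGram_mono (B : Matrix (Fin N) (Fin N) ℝ) {T T' : Finset (Fin N)} (h : T' ⊆ T) :
    rowGram B T' ≤ rowGram B T :=
  Finset.sum_le_sum_of_subset_of_nonneg h fun _ _ _ => Matrix.vecMulVec_self_nonneg _

theorem weightedGram_ite (B : Matrix (Fin N) (Fin N) ℝ) (T : Finset (Fin N)) :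
    weightedGram B (fun i => if i ∈ T then 1 else 0) = rowGram B T := by
  simp [weightedGram, rowGram, ite_pow, ite_smul]

theorem isGoodSample_self (S : ℕ) {A : Matrix (Fin N) (Fin N) ℝ} (hA : 0 ≤ A) {ρ : ℝ}
    (hρ : 0 ≤ ρ) : IsGoodSample S A A ρ := by
  have h1 : 0 ≤ (1 / 1000 : ℝ) • (A + ρ • (1 : Matrix (Fin N) (Fin N) ℝ)) := by
    simpa using Matrix.smul_mono_right (add_nonneg hA (Matrix.smul_one_nonneg hρ))
      (show (0 : ℝ) ≤ 1 / 1000 by norm_num)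
  have h2 : (0 : ℝ) ≤ S * ρ := by positivity
  have h3 := eigenvalueTail_nonneg hA S
  exact ⟨by rw [sub_self, neg_nonpos]; exact h1, by rw [sub_self]; exact h1, by linarith,
    by linarith⟩

theorem eigenvalueTail_le_trace_self {A : Matrix (Fin N) (Fin N) ℝ} (hA : 0 ≤ A) (S : ℕ) :
    eigenvalueTail S A ≤ A.trace := by
  have := eigenvalueTail_le_trace_projection (F := 1) hA (by simp) (by simp) (S := S) (by simp)
  rwa [one_mul] at this

theorem Matrix.le_trace_smul_one {n : Type*} [Fintype n] [DecidableEq n] {A : Matrix n n ℝ}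
    (hA : 0 ≤ A) : A ≤ A.trace • 1 := by
  have h := nonneg_iff_posSemidef.1 hA
  rw [h.1.le_smul_one_iff]
  intro i
  rw [h.1.trace_eq_sum_eigenvalues]
  exact Finset.single_le_sum (f := h.1.eigenvalues) (fun j _ => h.eigenvalues_nonneg j)
    (Finset.mem_univ i)

variable {B K : Matrix (Fin N) (Fin N) ℝ} {w : Fin N → ℝ}

/-- `upper` and `tail_upper` bound sample and ridge from above. Scores computed from a good sample
are hence at least half of the true ones, the direction that accuracy needs. -/
theorem IsGoodSample.add_le {S : ℕ} (hS : 1 ≤ S) {A M : Matrix (Fin N) (Fin N) ℝ} (hA : 0 ≤ A)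
    (h : IsGoodSample S A M (eigenvalueTail S A / S)) (s : ℝ) (hs : 0 < s) :
    M + (eigenvalueTail S M / S + s) • (1 : Matrix (Fin N) (Fin N) ℝ) ≤
      (2 : ℝ) • (A + (eigenvalueTail S A / S + s) • 1) := by
  have hSp : (0 : ℝ) < S := by exact_mod_cast hS
  have hl0 : 0 ≤ eigenvalueTail S A / S := by
    have := eigenvalueTail_nonneg hA S
    positivity
  set l := eigenvalueTail S A / S with hl
  have h1 : eigenvalueTail S A = S * l := by rw [hl]; field_simp
  have h2 : eigenvalueTail S M / S ≤ (1001 / 1000) * l := by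
    rw [div_le_iff₀ hSp]
    have := h.tail_upper
    rw [h1] at this
    linarith
  have h3 := sub_le_iff_le_add.1 h.upper
  refine (add_le_add h3 (Matrix.smul_mono_left (nonneg_iff_posSemidef.2 PosSemidef.one)
    (add_le_add_left h2 s))).trans ?_
  rw [← sub_nonneg]
  have e : (2 : ℝ) • (A + (l + s) • (1 : Matrix (Fin N) (Fin N) ℝ)) -
      ((1 / 1000 : ℝ) • (A + l • 1) + A + ((1001 / 1000) * l + s) • 1) =
      (999 / 1000 : ℝ) • A + ((998 / 1000) * l + s) • (1 : Matrix (Fin N) (Fin N) ℝ) := by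
    module
  rw [e]
  refine add_nonneg ?_ (Matrix.smul_one_nonneg (by positivity))
  simpa using Matrix.smul_mono_right hA (show (0 : ℝ) ≤ 999 / 1000 by norm_num)

/-- `lower` and `tail_lower`: the ridge of the sample is at least 0.49 − 0.05 = 0.44 of that of A,
and 5/2 · (0.44 − 0.001) > 1. Scores computed from the sample are at most 5/2 times the true ones,
the direction that counting the selected points needs. -/
theorem IsGoodSample.le_add {S : ℕ} (hS : 1 ≤ S) {A M : Matrix (Fin N) (Fin N) ℝ} (hA : 0 ≤ A)
    (h : IsGoodSample S A M (eigenvalueTail S A / S)) (s : ℝ) (hs : 0 < s) :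
    A + (eigenvalueTail S A / S + s) • (1 : Matrix (Fin N) (Fin N) ℝ) ≤
      (5 / 2 : ℝ) • (M + (eigenvalueTail S M / S + s) • 1) := by
  have hSp : (0 : ℝ) < S := by exact_mod_cast hS
  have hl0 : 0 ≤ eigenvalueTail S A / S := by
    have := eigenvalueTail_nonneg hA S
    positivity
  set l := eigenvalueTail S A / S with hl
  have h1 : eigenvalueTail S A = S * l := by rw [hl]; field_simp
  have h2 : (44 / 100) * l ≤ eigenvalueTail S M / S := by
    rw [le_div_iff₀ hSp]
    have := h.tail_lower
    rw [h1] at this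
    linarith
  have h3 := neg_le_sub_iff_le_add.1 h.lower
  have h4 : A - (1 / 1000 : ℝ) • (A + l • 1) ≤ M := sub_le_iff_le_add.2 h3
  refine le_trans ?_ (Matrix.smul_mono_right (add_le_add h4
    (Matrix.smul_mono_left (nonneg_iff_posSemidef.2 PosSemidef.one)
      (add_le_add_left h2 s))) (by norm_num))
  rw [← sub_nonneg]
  have e : (5 / 2 : ℝ) • (A - (1 / 1000 : ℝ) • (A + l • 1) +
      ((44 / 100) * l + s) • (1 : Matrix (Fin N) (Fin N) ℝ)) - (A + (l + s) • 1) =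
      (5 / 2 * (999 / 1000) - 1 : ℝ) • A +
        ((5 / 2 * (44 / 100 - 1 / 1000) - 1) * l + 3 / 2 * s) •
          (1 : Matrix (Fin N) (Fin N) ℝ) := by
    module
  rw [e]
  refine add_nonneg ?_ (Matrix.smul_one_nonneg ?_)
  · simpa using Matrix.smul_mono_right hA (show (0 : ℝ) ≤ 5 / 2 * (999 / 1000) - 1 by norm_num)
  · have : (0 : ℝ) ≤ 5 / 2 * (44 / 100 - 1 / 1000) - 1 := by norm_num
    positivity

/-- The weights of the selected indices. -/
noncomputable def selectionWeights (p : Fin N → unitInterval) (A : Finset (Fin N)) (i : Fin N) : ℝ :=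
  if i ∈ A then 1 / Real.sqrt (p i) else 0

theorem selectionWeights_sq (p : Fin N → unitInterval) (A : Finset (Fin N)) (i : Fin N) :
    selectionWeights p A i ^ 2 = if i ∈ A then ((p i : ℝ))⁻¹ else 0 := by
  rw [selectionWeights]
  split_ifs
  · rw [div_pow, one_pow, Real.sq_sqrt (p i).2.1, one_div]
  · simp

theorem inclusionProb_of_notMem {S : ℕ} {κ δ : ℝ} {T : Finset (Fin N)} {i : Fin N} (hi : i ∉ T) :
    inclusionProb K S κ δ T w i = 0 := if_neg hi

theorem inclusionProb_eq {S : ℕ} {κ δ : ℝ} {T : Finset (Fin N)} {i : Fin N} (hi : i ∈ T) :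
    (inclusionProb K S κ δ T w i : ℝ) = max 0 (min 1
      (κ * approxLeverage K S w i * Real.log ((∑ j ∈ T, approxLeverage K S w j) / δ))) := by
  rw [inclusionProb, if_pos hi, Set.coe_projIcc]

/-- The leverage scores of the rows in `T` are at most twice their approximations. -/
theorem leverage_le_two_mul_approxLeverage (hK : K = B * Bᵀ) {S : ℕ} (T : Finset (Fin N))
    (hw : ∀ s : ℝ, 0 < s →
      weightedGram B w + (sampleRidge K S w + s) • (1 : Matrix (Fin N) (Fin N) ℝ) ≤
        (2 : ℝ) • (rowGram B T + (eigenvalueTail S (rowGram B T) / S + s) • 1))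
    {s : ℝ} (hs : 0 < s) {i : Fin N} (hi : i ∈ T) :
    B i ⬝ᵥ (rowGram B T + (eigenvalueTail S (rowGram B T) / S + s) •
      (1 : Matrix (Fin N) (Fin N) ℝ))⁻¹ *ᵥ B i ≤ 2 * approxLeverage K S w i := by
  have hA := rowGram_nonneg B T
  have hl0 : 0 ≤ eigenvalueTail S (rowGram B T) / S := by
    have := eigenvalueTail_nonneg hA S
    positivity
  have hω := sampleRidge_nonneg (w := w) hK S
  have hG := Matrix.posDef_add_smul_one hA (show 0 < eigenvalueTail S (rowGram B T) / S + s by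
    linarith)
  have h1 := hG.dotProduct_inv_mulVec_le (Matrix.posDef_add_smul_one (weightedGram_nonneg B w)
    (show 0 < sampleRidge K S w + s by linarith)) (by norm_num) (hw s hs) (B i)
  -- A row of T is one of the summands of the Gram matrix, so its score is at most 1 and the
  -- truncation of the estimates at 1 does no harm.
  have h2 : B i ⬝ᵥ (rowGram B T + (eigenvalueTail S (rowGram B T) / S + s) •
      (1 : Matrix (Fin N) (Fin N) ℝ))⁻¹ *ᵥ B i ≤ 1 := by
    rw [← hG.vecMulVec_le_smul_iff _ zero_le_one, one_smul]
    refine le_trans ?_ (le_add_of_nonneg_right (Matrix.smul_one_nonneg (by linarith)))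
    exact Finset.single_le_sum (f := fun i => vecMulVec (B i) (B i))
      (fun j _ => Matrix.vecMulVec_self_nonneg _) hi
  have h3 := min_ridgeLeverage_le_approxLeverage (w := w) hK S i hs
  change _ ≤ 2 * ridgeLeverage B w (sampleRidge K S w + s) i at h1
  refine le_trans ?_ (mul_le_mul_of_nonneg_left h3 (by norm_num))
  rw [mul_min_of_nonneg _ _ (by norm_num)]
  exact le_min (by linarith) h1

/-- Needed to keep log(∑ l̃ / δ) away from zero. The Gram matrix and the ridge are both at most the
trace t, so the true scores sum to at least t/(2t + s) and the estimates to at least half of that.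
-/
theorem quarter_le_sum_approxLeverage (hK : K = B * Bᵀ) {S : ℕ} (hS : 1 ≤ S) (T : Finset (Fin N))
    (hw : ∀ s : ℝ, 0 < s →
      weightedGram B w + (sampleRidge K S w + s) • (1 : Matrix (Fin N) (Fin N) ℝ) ≤
        (2 : ℝ) • (rowGram B T + (eigenvalueTail S (rowGram B T) / S + s) • 1))
    (hT : rowGram B T ≠ 0) : 1 / 4 ≤ ∑ j ∈ T, approxLeverage K S w j := by
  have hA := rowGram_nonneg B T
  have hSp : (1 : ℝ) ≤ S := by exact_mod_cast hS
  set t := (rowGram B T).trace with ht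
  have htpos : 0 < t := by
    have hpsd := nonneg_iff_posSemidef.1 hA
    refine lt_of_le_of_ne hpsd.trace_nonneg fun h => hT ?_
    exact hpsd.trace_eq_zero_iff.1 h.symm
  have htail := eigenvalueTail_nonneg hA S
  have hl : eigenvalueTail S (rowGram B T) / S ≤ t :=
    (div_le_self htail hSp).trans (eigenvalueTail_le_trace_self hA S)
  have hl0 : 0 ≤ eigenvalueTail S (rowGram B T) / S := by positivity
  set l := eigenvalueTail S (rowGram B T) / S with hldef
  set σ := ∑ j ∈ T, approxLeverage K S w j with hσ
  have hσ0 : 0 ≤ σ := Finset.sum_nonneg fun j _ => approxLeverage_nonneg hK S j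
  have htsum : t = ∑ i ∈ T, B i ⬝ᵥ B i := by
    rw [ht, rowGram, trace_sum]
    simp only [trace_vecMulVec]
  have key : ∀ s : ℝ, 0 < s → t ≤ (2 * t + s) * (2 * σ) := by
    intro s hs
    have hG := Matrix.posDef_add_smul_one hA (show 0 < l + s by linarith)
    have hGle : rowGram B T + (l + s) • (1 : Matrix (Fin N) (Fin N) ℝ) ≤ (2 * t + s) • 1 := by
      refine (add_le_add_left (Matrix.le_trace_smul_one hA) _).trans ?_
      rw [← add_smul]
      exact Matrix.smul_mono_left (nonneg_iff_posSemidef.2 PosSemidef.one) (by linarith)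
    have h1 : ∀ i ∈ T, B i ⬝ᵥ B i ≤ (2 * t + s) * (2 * approxLeverage K S w i) := fun i hi => by
      have h2 := (PosDef.one (n := Fin N) (R := ℝ)).dotProduct_inv_mulVec_le hG
        (show 0 ≤ 2 * t + s by linarith) hGle (B i)
      rw [inv_one, one_mulVec] at h2
      exact h2.trans (mul_le_mul_of_nonneg_left
        (leverage_le_two_mul_approxLeverage hK T hw hs hi) (by linarith))
    have h3 := Finset.sum_le_sum h1
    rw [← htsum, ← Finset.mul_sum, ← Finset.mul_sum] at h3
    exact h3
  by_contra hcon
  push Not at hcon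
  -- If σ < 1/4, the shift s = t(1 − 4σ) is positive and turns `key` into (1 − 4σ)(1 − 2σ) ≤ 0, a
  -- contradiction.
  have h1 : 0 < t * (1 - 4 * σ) := mul_pos htpos (by linarith)
  have h2 := key (t * (1 - 4 * σ)) h1
  nlinarith

end RecursiveSampling

/-! ### One sampling step, the recursion and the number of selected points. -/

section SamplingStep

open scoped MatrixOrder

variable {N : ℕ} {B K : Matrix (Fin N) (Fin N) ℝ} {w : Fin N → ℝ}

/-- Sampling by the approximate leverage scores gives a good sample. -/
theorem bernoulliProb_inclusionProb_not_isGoodSample (hK : K = B * Bᵀ) {S : ℕ} (hS : 1 ≤ S)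
    {κ δ : ℝ} (hκ : 100000000 ≤ κ) (hδ : 0 < δ) (hδ1 : δ < 1 / 32) (T : Finset (Fin N))
    (hw : ∀ s : ℝ, 0 < s →
      weightedGram B w + (sampleRidge K S w + s) • (1 : Matrix (Fin N) (Fin N) ℝ) ≤
        (2 : ℝ) • (rowGram B T + (eigenvalueTail S (rowGram B T) / S + s) • 1)) :
    bernoulliProb (fun i => (inclusionProb K S κ δ T w i : ℝ)) {A | ¬ IsGoodSample S (rowGram B T)
      (weightedGram B (selectionWeights (inclusionProb K S κ δ T w) A))
      (eigenvalueTail S (rowGram B T) / S)} ≤ δ := by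
  set P := inclusionProb K S κ δ T w with hP
  set p : Fin N → ℝ := fun i => P i with hp
  have hp0 : ∀ i, 0 ≤ p i := fun i => (P i).2.1
  have hp1 : ∀ i, p i ≤ 1 := fun i => (P i).2.2
  have hSp : (1 : ℝ) ≤ S := by exact_mod_cast hS
  have hA := rowGram_nonneg B T
  have htail := eigenvalueTail_nonneg hA S
  have hl0 : 0 ≤ eigenvalueTail S (rowGram B T) / S := by positivity
  set u : Fin N → Fin N → ℝ := fun i => if i ∈ T then B i else 0 with hu
  have huu : ∀ i, vecMulVec (u i) (u i) = if i ∈ T then vecMulVec (B i) (B i) else 0 := fun i => by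
    simp only [hu]
    split_ifs <;> simp
  have hAu : rowGram B T = ∑ i, vecMulVec (u i) (u i) := by
    simp only [huu, rowGram, Finset.sum_ite_mem, Finset.univ_inter]
  have hMu : ∀ A, weightedGram B (selectionWeights P A) =
      ∑ i, (if i ∈ A then (p i)⁻¹ else 0) • vecMulVec (u i) (u i) := fun A => by
    refine Finset.sum_congr rfl fun i _ => ?_
    rw [selectionWeights_sq, huu]
    by_cases hi : i ∈ T
    · rw [if_pos hi]
    · rw [if_neg hi, hP, inclusionProb_of_notMem hi]
      simp
  by_cases hT : rowGram B T = 0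
  · have hz : ∀ i, vecMulVec (u i) (u i) = 0 := fun i => by
      refine le_antisymm ?_ (Matrix.vecMulVec_self_nonneg _)
      rw [← hT, hAu]
      exact Finset.single_le_sum (f := fun i => vecMulVec (u i) (u i))
        (fun j _ => Matrix.vecMulVec_self_nonneg _) (Finset.mem_univ i)
    have hM0 : ∀ A, weightedGram B (selectionWeights P A) = rowGram B T := fun A => by
      rw [hMu, hT]
      simp [hz]
    have hempty : {A | ¬ IsGoodSample S (rowGram B T) (weightedGram B (selectionWeights P A))
      (eigenvalueTail S (rowGram B T) / S)} = ∅ := by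
      ext A
      simp only [Set.mem_ofPred_eq, Set.mem_empty_iff_false, iff_false, not_not]
      rw [hM0]
      exact isGoodSample_self S hA hl0
    rw [hempty]
    simpa [bernoulliProb, bernoulliExp] using hδ.le
  have hσ := quarter_le_sum_approxLeverage hK hS T hw hT
  set σ := ∑ j ∈ T, approxLeverage K S w j with hσdef
  set L := Real.log (σ / δ) with hL
  have hσδ : 8 ≤ σ / δ := by
    rw [le_div_iff₀ hδ]; linarith
  have hL1 : 1 ≤ L := by
    rw [hL, Real.le_log_iff_exp_le (by linarith)]
    linarith [Real.exp_one_lt_d9]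
  have hκL : 100000000 ≤ κ * L := by nlinarith
  set l := eigenvalueTail S (rowGram B T) / S with hl
  -- If p i < 1 no truncation has occurred, and twice the estimate, a bound for the true score, is
  -- exactly p i β with β = 2/(κL).
  have hpL : ∀ i ∈ T, p i < 1 → 2 * approxLeverage K S w i = p i * (2 / (κ * L)) := by
    intro i hi hpi
    have h0 := approxLeverage_nonneg (w := w) hK S i
    have h1 : p i = max 0 (min 1 (κ * approxLeverage K S w i * L)) := inclusionProb_eq hi
    have h2 : 0 ≤ κ * approxLeverage K S w i * L := by
      have : 0 ≤ κ * L * approxLeverage K S w i := mul_nonneg (by linarith) h0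
      linarith
    rw [max_eq_right (le_min zero_le_one h2)] at h1
    rw [h1] at hpi
    rw [h1, min_eq_right (by
      by_contra hcon
      push Not at hcon
      rw [min_eq_left hcon.le] at hpi
      exact lt_irrefl _ hpi)]
    field_simp
  refine le_trans (bernoulliProb_mono hp0 hp1 (F := {A | ¬ ∀ η, 0 < η → IsGoodSample S (rowGram B T)
      (weightedGram B (selectionWeights P A)) (l + η)}) fun A hA' hcon => hA' ?_)
    (bernoulliProb_not_forall_pos hp0 hp1 (fun η η' _ hηη' A h => h.mono (by linarith))
      fun η hη => ?_)
  · exact IsGoodSample.of_forall_pos ((nonneg_iff_posSemidef.1 hA).1.transpose_eq)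
      ((nonneg_iff_posSemidef.1 (weightedGram_nonneg _ _)).1.transpose_eq) hcon
  have hρ : 0 < l + η := by linarith
  have hG := Matrix.posDef_add_smul_one hA hρ
  have hlev : ∀ i ∈ T, B i ⬝ᵥ (rowGram B T + (l + η) • (1 : Matrix (Fin N) (Fin N) ℝ))⁻¹ *ᵥ B i ≤
      2 * approxLeverage K S w i := fun i hi => leverage_le_two_mul_approxLeverage hK T hw hη hi
  have h := bernoulliProb_not_isGoodSample hp0 hp1 hAu hS (β := 2 / (κ * L)) (d := 2 * σ) hρ
    (by
      rw [mul_add, hl, mul_div_cancel₀ _ (by positivity)]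
      have : 0 ≤ S * η := by positivity
      linarith) (by positivity)
    (by
      rw [← mul_div_assoc, div_le_iff₀ (by linarith)]
      norm_num
      linarith)
    (fun i hpi => by
      by_cases hi : i ∈ T
      · rw [huu, if_pos hi, ← hpL i hi hpi]
        exact (hG.vecMulVec_le (B i)).trans (Matrix.smul_mono_left
          (nonneg_iff_posSemidef.2 hG.posSemidef) (hlev i hi))
      · rw [huu, if_neg hi]
        have := Matrix.smul_mono_right (nonneg_iff_posSemidef.2 hG.posSemidef)
          (show 0 ≤ p i * (2 / (κ * L)) from mul_nonneg (hp0 i) (by positivity))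
        simpa using this)
    (by
      have e : rowGram B T = ∑ i, (if i ∈ T then (1 : ℝ) else 0) • vecMulVec (B i) (B i) := by
        simp [rowGram, ite_smul]
      nth_rw 2 [e]
      refine (le_of_eq (Matrix.trace_mul_sum_smul_vecMulVec _ _ fun i => B i)).trans ?_
      simp only [ite_mul, one_mul, zero_mul, Finset.sum_ite_mem, Finset.univ_inter]
      rw [hσdef, Finset.mul_sum]
      exact Finset.sum_le_sum hlev)
  simp only [hMu]
  refine h.trans ?_
  -- The exponent is κL/(16 · 10⁶), at least 3L for κ ≥ 10⁸. As σ ≥ 1/4, the prefactor is at most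
  -- 40σ, and 40σ(δ/σ)³ ≤ 640 δ³ ≤ δ.
  have hexp : Real.exp (-((1 / 1000) ^ 2 / (8 * (2 / (κ * L))))) ≤ (δ / σ) ^ 3 := by
    have e : (δ / σ) ^ 3 = Real.exp (-(3 * L)) := by
      rw [hL, ← Real.log_rpow (by linarith), ← Real.log_inv, Real.exp_log (by positivity),
        show δ / σ = (σ / δ)⁻¹ by rw [inv_div], inv_pow]
      norm_cast
    rw [e]
    refine Real.exp_le_exp.2 (neg_le_neg ?_)
    rw [show (1 / 1000 : ℝ) ^ 2 / (8 * (2 / (κ * L))) = κ * L / 16000000 by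
      field_simp; norm_num]
    rw [le_div_iff₀ (by norm_num)]
    nlinarith
  have h40 : 4 * (2 * σ) + 8 ≤ 40 * σ := by linarith
  calc (4 * (2 * σ) + 8) * Real.exp (-((1 / 1000) ^ 2 / (8 * (2 / (κ * L)))))
      ≤ (40 * σ) * (δ / σ) ^ 3 := by gcongr
    _ = 40 * δ ^ 3 / σ ^ 2 := by field_simp
    _ ≤ 40 * δ ^ 3 / (1 / 4) ^ 2 := by gcongr
    _ ≤ δ := by
      have h1 : δ ^ 2 ≤ (1 / 32) ^ 2 := by gcongr
      have h2 := mul_le_mul_of_nonneg_left h1 hδ.le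
      norm_num
      nlinarith

/-- The number of selected indices is of order `S log (S / δ)`. -/
theorem bernoulliProb_inclusionProb_card (hK : K = B * Bᵀ) {S : ℕ} (hS : 1 ≤ S)
    {κ δ : ℝ} (hκ : 0 < κ) (hδ : 0 < δ) (hδ1 : δ < 1 / 32)
    (hw : ∀ X : ℝ, 0 ≤ X → ∑ i, min 1 (X * approxLeverage K S w i) ≤
      96000000 * (S * Real.log (S / δ)) + 25 * S * X) :
    bernoulliProb (fun i => (inclusionProb K S κ δ Finset.univ w i : ℝ))
      {A | ¬ ((Finset.univ.filter fun i =>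
        selectionWeights (inclusionProb K S κ δ Finset.univ w) A i ≠ 0).card : ℝ) ≤
          2 * ((96000000 + 225 * κ) * (S * Real.log (S / δ)))} ≤ δ / 2 := by
  set P := inclusionProb K S κ δ Finset.univ w with hP
  set p : Fin N → ℝ := fun i => P i with hp
  have hp0 : ∀ i, 0 ≤ p i := fun i => (P i).2.1
  have hp1 : ∀ i, p i ≤ 1 := fun i => (P i).2.2
  have hSp : (1 : ℝ) ≤ S := by exact_mod_cast hS
  have hH := three_lt_log_div hS hδ hδ1
  set H := Real.log (S / δ) with hHdef
  have hl0 := fun i => approxLeverage_nonneg (w := w) hK S i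
  have hl1 := fun i => approxLeverage_le_one (w := w) hK S i
  set σ := ∑ j, approxLeverage K S w j with hσ
  have hσ0 : 0 ≤ σ := Finset.sum_nonneg fun j _ => hl0 j
  have hσle : σ ≤ 100000000 * (S * H) := by
    have h1 := hw 1 zero_le_one
    have h2 : ∀ i, min 1 (1 * approxLeverage K S w i) = approxLeverage K S w i := fun i => by
      rw [one_mul, min_eq_right (hl1 i)]
    simp only [h2] at h1
    nlinarith
  have hHle : H ≤ S / δ := (Real.log_le_sub_one_of_pos (by positivity)).trans (by linarith)
  -- σ ≤ 10⁸ S H and H ≤ S/δ give σ/δ ≤ 10⁸ (S/δ)², whose logarithm is at most 20 + 2H ≤ 9H because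
  -- H > 3.
  have hlog : Real.log (σ / δ) ≤ 9 * H := by
    rcases hσ0.lt_or_eq with h | h
    · have h1 : σ / δ ≤ 100000000 * (S / δ) ^ 2 := by
        calc σ / δ ≤ 100000000 * (S * H) / δ := by gcongr
          _ = 100000000 * ((S / δ) * H) := by ring
          _ ≤ 100000000 * ((S / δ) * (S / δ)) := by gcongr
          _ = _ := by ring
      have h2 := Real.log_le_log (by positivity) h1
      rw [Real.log_mul (by norm_num) (by positivity), Real.log_pow, ← hHdef] at h2
      have h3 : Real.log 100000000 ≤ 20 := by
        rw [Real.log_le_iff_le_exp (by norm_num), show (20 : ℝ) = (20 : ℕ) * 1 by norm_num,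
          Real.exp_nat_mul]
        have h4 : (2.7 : ℝ) ^ 20 ≤ Real.exp 1 ^ 20 :=
          pow_le_pow_left₀ (by norm_num) (by linarith [Real.exp_one_gt_d9]) 20
        refine le_trans ?_ h4
        norm_num
      push_cast at h2
      linarith
    · rw [← h]; simp; linarith
  have hple : ∀ i, p i ≤ min 1 (9 * κ * H * approxLeverage K S w i) := fun i => by
    have h1 : p i = max 0 (min 1 (κ * approxLeverage K S w i * Real.log (σ / δ))) :=
      inclusionProb_eq (Finset.mem_univ i)
    rw [h1]
    have h0 : 0 ≤ κ * approxLeverage K S w i := mul_nonneg hκ.le (hl0 i)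
    have h3 := mul_le_mul_of_nonneg_left hlog h0
    refine max_le (le_min zero_le_one ?_) (min_le_min_left _ (h3.trans (le_of_eq (by ring))))
    have : 0 ≤ κ * approxLeverage K S w i * (9 * H) := mul_nonneg h0 (by linarith)
    linarith
  set g := (96000000 + 225 * κ) * (S * H) with hg
  have hgle : ∑ i, p i ≤ g := by
    refine (Finset.sum_le_sum fun i _ => hple i).trans ((hw (9 * κ * H) (by positivity)).trans ?_)
    rw [hg]
    exact le_of_eq (by ring)
  have hgH : 96000000 * H ≤ g := by
    have h1 : H ≤ S * H := by nlinarith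
    rw [hg]
    have h2 : 0 ≤ 225 * κ * (S * H) := by positivity
    linarith
  have hg0 : 0 < g := by linarith
  -- With a = p each selected index counts (p i)⁻¹ p i = 1, so this concentrates the number of
  -- points; deviation at most g doubles the bound g on the mean.
  have h := bernoulliProb_sum_deviation hp0 hp1 hp0 (g := g) (β := 1 / g) (ε := 1) hg0
    (by positivity) one_pos le_rfl (by
      rw [mul_one_div, div_le_iff₀ hg0]; linarith) (fun i _ => by
      rw [mul_assoc, one_div, inv_mul_cancel₀ hg0.ne', mul_one]) hgle
  refine (bernoulliProb_mono hp0 hp1 fun A hA => ?_).trans (h.trans ?_)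
  · intro hcon
    refine hA ?_
    have h1 : ((Finset.univ.filter fun i => selectionWeights P A i ≠ 0).card : ℝ) ≤
        ∑ i, ((if i ∈ A then (p i)⁻¹ else 0) - 1) * p i + ∑ i, p i := by
      rw [← Finset.sum_add_distrib, Finset.card_filter]
      push_cast
      refine Finset.sum_le_sum fun i _ => ?_
      have e : ((if i ∈ A then (p i)⁻¹ else 0) - 1) * p i + p i =
          (if i ∈ A then (p i)⁻¹ else 0) * p i := by ring
      rw [e]
      split_ifs with h1 h2 h2
      · have : p i ≠ 0 := fun h0 => h1 (by
          rw [selectionWeights, if_pos h2]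
          change 1 / Real.sqrt (p i) = 0
          rw [h0]; simp)
        rw [inv_mul_cancel₀ this]
      · exact absurd (by rw [selectionWeights, if_neg h2]) h1
      · exact mul_nonneg (inv_nonneg.2 (hp0 i)) (hp0 i)
      · simp
    have h2 := (abs_le.1 hcon).2
    linarith
  · have e : -((1 : ℝ) ^ 2 / (4 * (1 / g))) = -(g / 4) := by field_simp
    rw [e]
    have h1 : Real.exp (-(g / 4)) ≤ (δ / S) ^ 2 := by
      have e2 : (δ / S) ^ 2 = Real.exp (-((2 : ℕ) * H)) := by
        rw [Real.exp_neg, Real.exp_nat_mul, hHdef, Real.exp_log (by positivity), ← inv_pow, inv_div]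
      rw [e2]
      refine Real.exp_le_exp.2 ?_
      push_cast
      linarith
    have h2 : (δ / S) ^ 2 ≤ δ ^ 2 := by
      have : δ / S ≤ δ := div_le_self hδ.le hSp
      gcongr
    nlinarith

/-- The recursive algorithm returns a good sample. -/
theorem recursiveRLS_not_isGoodSample (hK : K = B * Bᵀ) {S : ℕ} (hS : 1 ≤ S) {κ : ℝ}
    (hκ : 100000000 ≤ κ) (n : ℕ) : ∀ (δ : ℝ) (T : Finset (Fin N)), 0 < δ → δ < 1 / 32 →
      (recursiveRLS K S κ n δ T).toOuterMeasure {w | ¬ IsGoodSample S (rowGram B T)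
        (weightedGram B w) (eigenvalueTail S (rowGram B T) / S)} ≤ ENNReal.ofReal (3 / 2 * δ) := by
  have hpure : ∀ (δ : ℝ) (T : Finset (Fin N)),
      (PMF.pure fun i => if i ∈ T then (1 : ℝ) else 0).toOuterMeasure
        {w | ¬ IsGoodSample S (rowGram B T) (weightedGram B w)
          (eigenvalueTail S (rowGram B T) / S)} ≤ ENNReal.ofReal (3 / 2 * δ) := fun δ T => by
    rw [PMF.toOuterMeasure_pure_apply, if_neg]
    · exact zero_le
    · rw [Set.mem_ofPred_eq, not_not, weightedGram_ite]
      have := eigenvalueTail_nonneg (rowGram_nonneg B T) S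
      exact isGoodSample_self S (rowGram_nonneg B T) (by positivity)
  induction n with
  | zero => exact fun δ T _ _ => by rw [recursiveRLS]; exact hpure δ T
  | succ n ih =>
    intro δ T hδ hδ1
    rw [recursiveRLS]
    split_ifs with hT
    · exact hpure δ T
    -- No half sample is bad for accuracy: shrinking T to T' lowers Gram matrix and ridge alike, so
    -- a good sample of any T' overestimates the scores for T.
    refine (PMF.toOuterMeasure_bind_le _ _ _ ∅ (c := ENNReal.ofReal (3 / 2 * δ))
      fun T' _ hT' => ?_).trans (by simp)
    have hsub : T' ⊆ T := fun i hi => by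
      have := mem_of_independentSubset_ne_zero hT' hi
      by_contra hcon
      exact this (if_neg hcon)
    -- The constant 3/2 solves x = x/3 + 1: the failure probabilities of the levels form a geometric
    -- series of ratio 1/3.
    have e : ENNReal.ofReal (3 / 2 * δ) = ENNReal.ofReal (3 / 2 * (δ / 3)) + ENNReal.ofReal δ := by
      rw [← ENNReal.ofReal_add (by positivity) hδ.le]
      congr 1; ring
    rw [e]
    refine (PMF.toOuterMeasure_bind_le _ _ _ _ (c := ENNReal.ofReal δ)
      fun w hw _ => ?_).trans (add_le_add_left (ih (δ / 3) T' (by positivity) (by linarith)) _)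
    rw [Set.mem_ofPred_eq, not_not] at hw
    rw [PMF.toOuterMeasure_map_apply, independentSubset_toOuterMeasure]
    refine ENNReal.ofReal_le_ofReal ?_
    refine bernoulliProb_inclusionProb_not_isGoodSample hK hS hκ hδ hδ1 T fun s hs => ?_
    have h1 := hw.add_le hS (rowGram_nonneg B T') s hs
    rw [sampleRidge_eq hK]
    refine h1.trans (Matrix.smul_mono_right (add_le_add (rowGram_mono B hsub)
      (Matrix.smul_mono_left (nonneg_iff_posSemidef.2 PosSemidef.one) ?_)) (by norm_num))
    have := eigenvalueTail_mono (rowGram_nonneg B T') (rowGram_mono B hsub) S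
    gcongr

/-- The set of inducing points is small, and it supports a good sample. -/
theorem rlsInducingPoints_toOuterMeasure_le (hK : K = B * Bᵀ) {S : ℕ} (hS : 1 ≤ S) {κ δ : ℝ}
    (hκ : 100000000 ≤ κ) (hδ : 0 < δ) (hδ1 : δ < 1 / 32) :
    (rlsInducingPoints K S κ δ).toOuterMeasure {Z | ¬ ((Z.card : ℝ) <
      (200000000 + 450 * κ) * S * Real.log (S / δ) ∧ ∃ w : Fin N → ℝ, (∀ i, i ∉ Z → w i = 0) ∧
        IsGoodSample S (rowGram B Finset.univ) (weightedGram B w)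
          (eigenvalueTail S (rowGram B Finset.univ) / S))} ≤ ENNReal.ofReal (3 * δ) := by
  have hSp : (1 : ℝ) ≤ S := by exact_mod_cast hS
  have hH := three_lt_log_div hS hδ hδ1
  set H := Real.log (S / δ) with hHdef
  have hSH : 0 < S * H := by positivity
  rw [rlsInducingPoints, PMF.toOuterMeasure_map_apply]
  set good : (Fin N → ℝ) → Prop := fun w =>
    ((Finset.univ.filter fun i => w i ≠ 0).card : ℝ) ≤ 192 * (S * H) +
      2 * ((96000000 + 225 * κ) * (S * H)) ∧
    IsGoodSample S (rowGram B Finset.univ) (weightedGram B w)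
      (eigenvalueTail S (rowGram B Finset.univ) / S) with hgood
  have hsubset : ((fun w : Fin N → ℝ => Finset.univ.filter fun i => w i ≠ 0) ⁻¹'
      {Z : Finset (Fin N) | ¬ ((Z.card : ℝ) < (200000000 + 450 * κ) * S * H ∧
        ∃ w : Fin N → ℝ, (∀ i, i ∉ Z → w i = 0) ∧
        IsGoodSample S (rowGram B Finset.univ) (weightedGram B w)
          (eigenvalueTail S (rowGram B Finset.univ) / S))}) ⊆ {w | ¬ good w} := by
    intro w hw hgw
    refine hw ⟨hgw.1.trans_lt ?_, w, fun i hi => ?_, hgw.2⟩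
    · nlinarith
    · simpa using hi
  refine (measure_mono hsubset).trans ?_
  have hpure : ((Finset.univ : Finset (Fin N)).card : ℝ) ≤ 192 * Real.log (1 / δ) →
      (PMF.pure fun i => if i ∈ (Finset.univ : Finset (Fin N)) then (1 : ℝ) else 0).toOuterMeasure
        {w | ¬ good w} ≤ ENNReal.ofReal (3 * δ) := fun hcard => by
    rw [PMF.toOuterMeasure_pure_apply, if_neg]
    · exact zero_le
    · rw [Set.mem_ofPred_eq, not_not]
      refine ⟨?_, ?_⟩
      · have h1 : Real.log (1 / δ) ≤ H :=
          Real.log_le_log (by positivity) (by gcongr)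
        have h2 : H ≤ S * H := by nlinarith
        have h3 : ((Finset.univ.filter fun i : Fin N =>
            (if i ∈ (Finset.univ : Finset (Fin N)) then (1 : ℝ) else 0) ≠ 0).card : ℝ) ≤
            (Finset.univ : Finset (Fin N)).card := by
          exact_mod_cast Finset.card_filter_le _ _
        have h4 : 0 ≤ 2 * ((96000000 + 225 * κ) * (S * H)) := by positivity
        linarith
      · rw [weightedGram_ite]
        have := eigenvalueTail_nonneg (rowGram_nonneg B Finset.univ) S
        exact isGoodSample_self S (rowGram_nonneg B Finset.univ) (by positivity)
  have hlog0 : 0 ≤ Real.log (1 / δ) := Real.log_nonneg (by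
    rw [le_div_iff₀ hδ]; linarith)
  -- Only the outermost level is unrolled, because the number of points kept inside the recursive
  -- call is irrelevant; the random half is exploited just once.
  cases N with
  | zero =>
    rw [recursiveRLS]
    exact hpure (by
      rw [Finset.univ_eq_empty, Finset.card_empty, Nat.cast_zero]
      positivity)
  | succ n =>
    rw [recursiveRLS]
    split_ifs with hT
    · exact hpure hT
    -- δ/2 for the scores of the half, 3/2 · δ/3 for the recursive call, and δ + δ/2, rounded up to
    -- 2δ, for the final selection.
    have e : ENNReal.ofReal (3 * δ) = ENNReal.ofReal (δ / 2) + (ENNReal.ofReal (3 / 2 * (δ / 3)) +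
        ENNReal.ofReal (2 * δ)) := by
      rw [← ENNReal.ofReal_add (by positivity) (by positivity),
        ← ENNReal.ofReal_add (by positivity) (by positivity)]
      congr 1; ring
    rw [e]
    have hhalf := bernoulliProb_half_leverage B hS hδ hδ1
    refine (PMF.toOuterMeasure_bind_le _ _ _ _ fun T' hT' _ => ?_).trans
      (add_le_add_left ((independentSubset_toOuterMeasure _ _).trans_le
        (ENNReal.ofReal_le_ofReal (by simpa using hhalf))) _)
    rw [Set.mem_ofPred_eq, not_not] at hT'
    refine (PMF.toOuterMeasure_bind_le _ _ _ _ (c := ENNReal.ofReal (2 * δ))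
      fun w hw _ => ?_).trans (add_le_add_left (recursiveRLS_not_isGoodSample hK hS hκ n (δ / 3) T'
        (by positivity) (by linarith)) _)
    rw [Set.mem_ofPred_eq, not_not] at hw
    rw [PMF.toOuterMeasure_map_apply, independentSubset_toOuterMeasure]
    refine ENNReal.ofReal_le_ofReal ?_
    have hA' := rowGram_nonneg B T'
    have hl0 : 0 ≤ eigenvalueTail S (rowGram B T') / S := by
      have := eigenvalueTail_nonneg hA' S
      positivity
    have h1 := bernoulliProb_inclusionProb_not_isGoodSample (w := w) hK hS hκ hδ hδ1 Finset.univ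
      fun s hs => by
        have h1 := hw.add_le hS hA' s hs
        rw [sampleRidge_eq hK]
        refine h1.trans (Matrix.smul_mono_right (add_le_add (rowGram_mono B (Finset.subset_univ T'))
          (Matrix.smul_mono_left (nonneg_iff_posSemidef.2 PosSemidef.one) ?_)) (by norm_num))
        have := eigenvalueTail_mono hA' (rowGram_mono B (Finset.subset_univ T')) S
        gcongr
    have h2 := bernoulliProb_inclusionProb_card (w := w) hK hS (κ := κ) (by linarith) hδ hδ1
      fun X hX => by
        have hlim : Filter.Tendsto
            (fun s => ∑ i, min 1 (X * min 1 (ridgeLeverage B w (sampleRidge K S w + s) i)))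
            (nhdsWithin 0 (Set.Ioi 0)) (nhds (∑ i, min 1 (X * approxLeverage K S w i))) :=
          tendsto_finsetSum _ fun i _ => (tendsto_const_nhds.min
            ((tendsto_min_ridgeLeverage hK S i).const_mul X))
        refine le_of_tendsto hlim (Filter.eventually_of_mem self_mem_nhdsWithin fun s hs => ?_)
        have hs' : 0 < s := hs
        -- The scores computed from w are at most 5/2 times those relative to T'. The factor is
        -- absorbed into X, and 10 · 5/2 = 25.
        have h3 := hT' s hs' (X * (5 / 2)) (by positivity)
        refine le_trans (Finset.sum_le_sum fun i _ => ?_) (h3.trans (le_of_eq (by ring)))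
        refine min_le_min_left _ ?_
        rw [mul_assoc]
        refine mul_le_mul_of_nonneg_left ((min_le_right _ _).trans ?_) hX
        have hω := sampleRidge_nonneg (w := w) hK S
        refine (Matrix.posDef_add_smul_one (weightedGram_nonneg B w)
          (show 0 < sampleRidge K S w + s by linarith)).dotProduct_inv_mulVec_le
            (Matrix.posDef_add_smul_one hA' (show 0 < eigenvalueTail S (rowGram B T') / S + s by
              linarith)) (by norm_num) ?_ (B i)
        rw [sampleRidge_eq hK]
        exact hw.le_add hS hA' s hs'
    set P := inclusionProb K S κ δ Finset.univ w with hP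
    have hp0 : ∀ i, 0 ≤ (P i : ℝ) := fun i => (P i).2.1
    have hp1 : ∀ i, (P i : ℝ) ≤ 1 := fun i => (P i).2.2
    refine (bernoulliProb_mono hp0 hp1 fun A hA => ?_).trans
      ((bernoulliProb_union_le hp0 hp1 _ _).trans ((add_le_add h1 h2).trans (by linarith)))
    by_contra hcon
    simp only [Set.mem_union, Set.mem_ofPred_eq, not_or, not_not] at hcon
    refine hA ⟨hcon.2.trans ?_, hcon.1⟩
    have : 0 ≤ 192 * (S * H) := by positivity
    linarith

end SamplingStep

/-! ### From good samples to the Nyström error. -/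

section Nystrom

open scoped MatrixOrder

variable {ι n : Type*} [Fintype ι] [DecidableEq ι] [Fintype n] [DecidableEq n]

theorem symPinv_transpose (A : Matrix ι ι ℝ) : (symPinv A)ᵀ = symPinv A :=
  Matrix.IsHermitian.transpose_eq (cfc_predicate (fun r : ℝ => r⁻¹) A : IsSelfAdjoint _)

theorem mul_symPinv_mul_self {A : Matrix ι ι ℝ} (hA : A.IsHermitian) : A * symPinv A * A = A := by
  have hA' : IsSelfAdjoint A := hA
  have hc : ∀ f : ℝ → ℝ, ContinuousOn f (spectrum ℝ A) := fun f =>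
    (Matrix.finite_real_spectrum (A := A)).continuousOn f
  rw [symPinv]
  have e : cfc (id : ℝ → ℝ) A * cfc (fun r : ℝ => r⁻¹) A * cfc (id : ℝ → ℝ) A =
      cfc (id : ℝ → ℝ) A := by
    rw [← cfc_mul _ _ A (hc _) (hc _), ← cfc_mul _ _ A (hc _) (hc _)]
    refine cfc_congr fun r _ => ?_
    simp only [id]
    by_cases h : r = 0
    · simp [h]
    · rw [mul_inv_cancel₀ h, one_mul]
  rwa [cfc_id ℝ A] at e

theorem symPinv_mul_mul_symPinv {A : Matrix ι ι ℝ} (hA : A.IsHermitian) :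
    symPinv A * A * symPinv A = symPinv A := by
  have hA' : IsSelfAdjoint A := hA
  have hc : ∀ f : ℝ → ℝ, ContinuousOn f (spectrum ℝ A) := fun f =>
    (Matrix.finite_real_spectrum (A := A)).continuousOn f
  rw [symPinv]
  nth_rw 2 [← cfc_id ℝ A]
  rw [← cfc_mul _ _ A (hc _) (hc _), ← cfc_mul _ _ A (hc _) (hc _)]
  refine cfc_congr fun r _ => ?_
  simp only [id]
  by_cases h : r = 0
  · simp [h]
  · rw [inv_mul_cancel₀ h, one_mul]

/-- The orthogonal projection onto the row space of `Z`. -/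
noncomputable def rowProjection (Z : Matrix ι n ℝ) : Matrix n n ℝ := Zᵀ * symPinv (Z * Zᵀ) * Z

theorem rowProjection_transpose (Z : Matrix ι n ℝ) : (rowProjection Z)ᵀ = rowProjection Z := by
  rw [rowProjection, transpose_mul, transpose_mul, transpose_transpose, symPinv_transpose,
    Matrix.mul_assoc]

theorem isHermitian_mul_transpose (Z : Matrix ι n ℝ) : (Z * Zᵀ).IsHermitian :=
  Matrix.isHermitian_of_transpose_eq (by simp)

theorem rowProjection_mul_self (Z : Matrix ι n ℝ) :
    rowProjection Z * rowProjection Z = rowProjection Z := by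
  have h := symPinv_mul_mul_symPinv (isHermitian_mul_transpose Z)
  calc rowProjection Z * rowProjection Z
      = Zᵀ * (symPinv (Z * Zᵀ) * (Z * Zᵀ) * symPinv (Z * Zᵀ)) * Z := by
        simp only [rowProjection, Matrix.mul_assoc]
    _ = rowProjection Z := by rw [h, rowProjection]

/-- The difference Y of the two sides satisfies Y Yᵀ = 0. The argument allows Z Zᵀ to be singular,
as with repeated inducing points. -/
theorem mul_rowProjection (Z : Matrix ι n ℝ) : Z * rowProjection Z = Z := by
  have h := mul_symPinv_mul_self (isHermitian_mul_transpose Z)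
  set H := symPinv (Z * Zᵀ) with hH
  have h1 : (Z * rowProjection Z - Z) * (Z * rowProjection Z - Z)ᵀ = 0 := by
    rw [transpose_sub, transpose_mul, rowProjection_transpose]
    have e1 : Z * rowProjection Z * Zᵀ = Z * Zᵀ := by
      rw [rowProjection, ← hH]
      conv_rhs => rw [← h]
      simp only [Matrix.mul_assoc]
    rw [Matrix.sub_mul, Matrix.mul_sub, Matrix.mul_sub, Matrix.mul_assoc Z, ← Matrix.mul_assoc (rowProjection Z),
      rowProjection_mul_self, ← Matrix.mul_assoc Z, e1]
    simp
  have h2 : (Z * rowProjection Z - Z) * (Z * rowProjection Z - Z)ᴴ = 0 := by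
    rw [conjTranspose_eq_transpose_of_trivial]
    exact h1
  exact sub_eq_zero.1 (self_mul_conjTranspose_eq_zero.1 h2)

/-- Y and Yᵀ have the same operator norm; for rectangular Y this is Cauchy–Schwarz applied to |Yᵀu|²
= u ⬝ᵥ Y(Yᵀu). -/
theorem Matrix.mul_transpose_le_smul_one {Y : Matrix ι n ℝ} {c : ℝ} (hc : 0 ≤ c)
    (h : Yᵀ * Y ≤ c • 1) : Y * Yᵀ ≤ c • 1 := by
  rw [Matrix.le_iff_dotProduct (by simp) (by simp)]
  intro u
  set z := Yᵀ *ᵥ u with hz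
  have h1 := Matrix.dotProduct_mulVec_mono h z
  rw [smul_mulVec, one_mulVec, dotProduct_smul, smul_eq_mul, ← mulVec_mulVec] at h1
  rw [smul_mulVec, one_mulVec, dotProduct_smul, smul_eq_mul, ← mulVec_mulVec, ← hz]
  have h2 : u ⬝ᵥ Y *ᵥ z = z ⬝ᵥ z := by rw [dotProduct_mulVec, ← mulVec_transpose, ← hz]
  have h3 : z ⬝ᵥ Yᵀ *ᵥ (Y *ᵥ z) = (Y *ᵥ z) ⬝ᵥ (Y *ᵥ z) := by
    rw [dotProduct_mulVec, vecMul_transpose]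
  rw [h3] at h1
  have h4 : (u ⬝ᵥ Y *ᵥ z) ^ 2 ≤ (u ⬝ᵥ u) * ((Y *ᵥ z) ⬝ᵥ (Y *ᵥ z)) := by
    simp only [dotProduct, ← pow_two]
    exact Finset.sum_mul_sq_le_sq_mul_sq _ _ _
  rw [h2] at h4 ⊢
  have hzz : 0 ≤ z ⬝ᵥ z := Finset.sum_nonneg fun i _ => mul_self_nonneg _
  have huu : 0 ≤ u ⬝ᵥ u := Finset.sum_nonneg fun i _ => mul_self_nonneg _
  rcases hzz.lt_or_eq with h5 | h5
  · have h6 : (z ⬝ᵥ z) * (z ⬝ᵥ z) ≤ (c * (u ⬝ᵥ u)) * (z ⬝ᵥ z) := by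
      nlinarith [mul_le_mul_of_nonneg_left h1 huu]
    exact le_of_mul_le_mul_right h6 h5
  · rw [← h5]; positivity

variable {N : ℕ}

/-- The difference between a kernel matrix and its Nyström approximation. -/
noncomputable def nystromResidual (K : Matrix (Fin N) (Fin N) ℝ) (Z : Finset (Fin N)) :
    Matrix (Fin N) (Fin N) ℝ :=
  K - K.submatrix id (Subtype.val : Z → Fin N) *
    symPinv (K.submatrix (Subtype.val : Z → Fin N) (Subtype.val : Z → Fin N)) *
      K.submatrix (Subtype.val : Z → Fin N) id

/-- B may have any number of columns: the formula serves both for a square factor of K and for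
features shared with test points. -/
theorem nystromResidual_eq {K : Matrix (Fin N) (Fin N) ℝ} {B : Matrix (Fin N) n ℝ}
    (hK : K = B * Bᵀ) (Z : Finset (Fin N)) :
    nystromResidual K Z =
      B * (1 - rowProjection (B.submatrix (Subtype.val : Z → Fin N) id)) * Bᵀ := by
  have h1 : K.submatrix id (Subtype.val : Z → Fin N) =
      B * (B.submatrix (Subtype.val : Z → Fin N) id)ᵀ := by
    rw [hK]; ext i j; rfl
  have h2 : K.submatrix (Subtype.val : Z → Fin N) id =
      B.submatrix (Subtype.val : Z → Fin N) id * Bᵀ := by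
    rw [hK]; ext i j; rfl
  have h3 : K.submatrix (Subtype.val : Z → Fin N) (Subtype.val : Z → Fin N) =
      B.submatrix (Subtype.val : Z → Fin N) id * (B.submatrix (Subtype.val : Z → Fin N) id)ᵀ := by
    rw [hK]; ext i j; rfl
  rw [nystromResidual, h1, h2, h3, Matrix.mul_sub, Matrix.sub_mul, Matrix.mul_one, ← hK, rowProjection]
  simp only [Matrix.mul_assoc]

theorem rowGram_univ (B : Matrix (Fin N) (Fin N) ℝ) : rowGram B Finset.univ = Bᵀ * B := by
  have := weightedGram_eq B (fun _ => 1)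
  rw [show diagonal (fun _ : Fin N => (1 : ℝ)) = 1 from diagonal_one, Matrix.one_mul] at this
  rw [← this]
  simp [weightedGram, rowGram]

/-- If a good sample is supported on `Z`, then the Nyström approximation is accurate. -/
theorem IsGoodSample.nystromResidual_le {K B : Matrix (Fin N) (Fin N) ℝ} (hK : K = B * Bᵀ)
    {Z : Finset (Fin N)} {w : Fin N → ℝ} (hw : ∀ i, i ∉ Z → w i = 0) {S : ℕ} {l : ℝ} (hl : 0 ≤ l)
    (h : IsGoodSample S (rowGram B Finset.univ) (weightedGram B w) l) :
    nystromResidual K Z ≤ l • 1 := by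
  set Bz := B.submatrix (Subtype.val : Z → Fin N) id with hBz
  set P := 1 - rowProjection Bz with hP
  have hPt : Pᵀ = P := by rw [hP, transpose_sub, transpose_one, rowProjection_transpose]
  have hPP : P * P = P := by
    rw [hP, sub_mul, mul_sub, mul_sub, rowProjection_mul_self]; simp
  -- P annihilates the rows indexed by Z and the weights vanish elsewhere, so the sampled Gram
  -- matrix disappears when `lower` is compressed by P.
  have hMP : P * weightedGram B w = 0 := by
    rw [weightedGram, Matrix.mul_sum]
    refine Finset.sum_eq_zero fun i _ => ?_
    by_cases hi : i ∈ Z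
    · have h0 : Bz * P = 0 := by rw [hP, Matrix.mul_sub, Matrix.mul_one, mul_rowProjection, sub_self]
      have h1 : P *ᵥ B i = 0 := by
        rw [← hPt, mulVec_transpose]
        have := congrFun h0 ⟨i, hi⟩
        exact this
      rw [Matrix.mul_smul, mul_vecMulVec, h1, zero_vecMulVec, smul_zero]
    · rw [hw i hi]; simp
  have hP1 : P ≤ 1 := Matrix.le_one_of_idempotent hPt hPP
  have hA : rowGram B Finset.univ ≤ (1000 / 999 : ℝ) • weightedGram B w + (l / 999) • 1 := by
    have h1 := sub_le_iff_le_add.2 (neg_le_sub_iff_le_add.1 h.lower)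
    have h2 := Matrix.smul_mono_right h1 (show (0 : ℝ) ≤ 1000 / 999 by norm_num)
    have e : (1000 / 999 : ℝ) • (rowGram B Finset.univ -
        (1 / 1000 : ℝ) • (rowGram B Finset.univ + l • (1 : Matrix (Fin N) (Fin N) ℝ))) =
        rowGram B Finset.univ - (l / 999) • 1 := by
      module
    rw [e] at h2
    exact sub_le_iff_le_add.1 h2
  have h3 := Matrix.conj_mono hA P
  rw [hPt, Matrix.mul_add, Matrix.add_mul, Matrix.mul_smul, hMP, smul_zero, Matrix.zero_mul,
    zero_add, Matrix.mul_smul, Matrix.smul_mul, Matrix.mul_one, hPP, rowGram_univ] at h3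
  have h4 : (B * P)ᵀ * (B * P) ≤ l • 1 := by
    rw [transpose_mul, hPt, show P * Bᵀ * (B * P) = P * (Bᵀ * B) * P by simp only [Matrix.mul_assoc]]
    refine h3.trans ((Matrix.smul_mono_right hP1 (by positivity)).trans
      (Matrix.smul_mono_left (nonneg_iff_posSemidef.2 PosSemidef.one) ?_))
    linarith
  have h5 := Matrix.mul_transpose_le_smul_one hl h4
  rw [nystromResidual_eq hK, ← hBz, ← hP]
  rwa [transpose_mul, hPt, Matrix.mul_assoc, ← Matrix.mul_assoc P, hPP, ← Matrix.mul_assoc] at h5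

end Nystrom

/-! ### Divergence of product Gaussians from the standard one. -/

section GaussianDivergence

open InformationTheory
open scoped NNReal

/-- The logarithm of the density of `N(m, v)` with respect to `N(0, 1)`. -/
noncomputable def gaussianLogRatio (m : ℝ) (v : ℝ≥0) (x : ℝ) : ℝ :=
  x ^ 2 / 2 - (x - m) ^ 2 / (2 * v) - Real.log v / 2

theorem continuous_gaussianLogRatio (m : ℝ) (v : ℝ≥0) : Continuous (gaussianLogRatio m v) := by
  unfold gaussianLogRatio
  fun_prop

theorem gaussianReal_eq_withDensity (m : ℝ) {v : ℝ≥0} (hv : v ≠ 0) :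
    gaussianReal m v = (gaussianReal 0 1).withDensity
      fun x => ENNReal.ofReal (Real.exp (gaussianLogRatio m v x)) := by
  have hc := continuous_gaussianLogRatio m v
  rw [gaussianReal_of_var_ne_zero _ hv, gaussianReal_of_var_ne_zero _ one_ne_zero,
    ← withDensity_mul _ (measurable_gaussianPDF _ _) (by fun_prop)]
  congr 1
  funext x
  have hv' : (0 : ℝ) < v := by exact_mod_cast pos_iff_ne_zero.2 hv
  rw [Pi.mul_apply, gaussianPDF, gaussianPDF, ← ENNReal.ofReal_mul (gaussianPDFReal_nonneg _ _ _)]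
  congr 1
  rw [gaussianPDFReal, gaussianPDFReal, gaussianLogRatio]
  have e : Real.exp (-(x - m) ^ 2 / (2 * v)) = Real.sqrt v *
      Real.exp (-(x - 0) ^ 2 / (2 * (1 : ℝ≥0)) +
        (x ^ 2 / 2 - (x - m) ^ 2 / (2 * v) - Real.log v / 2)) := by
    have h1 : Real.sqrt v = Real.exp (Real.log v / 2) := by
      rw [Real.sqrt_eq_rpow, Real.rpow_def_of_pos hv']
      ring_nf
    rw [h1, ← Real.exp_add]
    congr 1
    push_cast
    ring
  have hpi : (0 : ℝ) ≤ 2 * Real.pi := by positivity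
  have h2 : Real.sqrt v ≠ 0 := (Real.sqrt_pos.2 hv').ne'
  rw [e, Real.sqrt_mul hpi, Real.sqrt_mul hpi, Real.exp_add, NNReal.coe_one, Real.sqrt_one]
  field_simp

theorem integrable_sq_sub_gaussianReal (m c : ℝ) (v : ℝ≥0) :
    Integrable (fun x => (x - c) ^ 2) (gaussianReal m v) := by
  have h := (memLp_id_gaussianReal (μ := m) (v := v) 2).sub (memLp_const c)
  have h2 := h.integrable_sq
  simpa using h2

theorem integral_sq_sub_gaussianReal (m c : ℝ) (v : ℝ≥0) :
    ∫ x, (x - c) ^ 2 ∂(gaussianReal m v) = v + (m - c) ^ 2 := by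
  have h1 : Integrable (fun x : ℝ => x) (gaussianReal m v) :=
    (memLp_id_gaussianReal (μ := m) (v := v) 1).integrable le_rfl
  have hvar : ∫ x, (x - m) ^ 2 ∂(gaussianReal m v) = v := by
    have := variance_fun_id_gaussianReal (μ := m) (v := v)
    rw [variance_eq_integral (by fun_prop), integral_id_gaussianReal] at this
    exact this
  have e : ∀ x : ℝ, (x - c) ^ 2 = (x - m) ^ 2 + (2 * (m - c) * x + ((m - c) ^ 2 - 2 * (m - c) * m)) :=
    fun x => by ring
  have h2 : Integrable (fun x : ℝ => 2 * (m - c) * x + ((m - c) ^ 2 - 2 * (m - c) * m))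
      (gaussianReal m v) := (h1.const_mul _).add (integrable_const _)
  rw [funext e, integral_add (integrable_sq_sub_gaussianReal m m v) h2,
    integral_add (h1.const_mul _) (integrable_const _), integral_const_mul, hvar,
    integral_id_gaussianReal, integral_const, measureReal_def, measure_univ, ENNReal.toReal_one,
    one_smul]
  ring

theorem integrable_gaussianLogRatio (m : ℝ) (v : ℝ≥0) :
    Integrable (gaussianLogRatio m v) (gaussianReal m v) := by
  have h0 := integrable_sq_sub_gaussianReal m 0 v
  simp only [sub_zero] at h0
  exact ((h0.div_const _).sub ((integrable_sq_sub_gaussianReal m m v).div_const _)).sub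
    (integrable_const _)

theorem integral_gaussianLogRatio (m : ℝ) {v : ℝ≥0} (hv : v ≠ 0) :
    ∫ x, gaussianLogRatio m v x ∂(gaussianReal m v) = (v + m ^ 2 - 1 - Real.log v) / 2 := by
  have hv' : (v : ℝ) ≠ 0 := by exact_mod_cast hv
  have h0 := integrable_sq_sub_gaussianReal m 0 v
  have e0 := integral_sq_sub_gaussianReal m 0 v
  simp only [sub_zero] at h0 e0
  unfold gaussianLogRatio
  have h1 : Integrable (fun x => x ^ 2 / 2 - (x - m) ^ 2 / (2 * v)) (gaussianReal m v) :=
    (h0.div_const _).sub ((integrable_sq_sub_gaussianReal m m v).div_const _)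
  rw [integral_sub h1 (integrable_const _), integral_sub (h0.div_const _)
      ((integrable_sq_sub_gaussianReal m m v).div_const _), integral_div, integral_div, e0,
    integral_sq_sub_gaussianReal, integral_const]
  simp only [sub_self, measureReal_def, measure_univ, ENNReal.toReal_one, smul_eq_mul]
  field_simp
  ring

variable {ι : Type*} [Fintype ι]

theorem pi_gaussianReal_eq_withDensity (m : ι → ℝ) {v : ι → ℝ≥0} (hv : ∀ i, v i ≠ 0) :
    Measure.pi (fun i => gaussianReal (m i) (v i)) =
      (Measure.pi fun _ : ι => gaussianReal 0 1).withDensity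
        fun x => ENNReal.ofReal (Real.exp (∑ i, gaussianLogRatio (m i) (v i) (x i))) := by
  refine Measure.pi_eq fun s hs => ?_
  have hint : ∀ i, Integrable (fun x => Real.exp (gaussianLogRatio (m i) (v i) x))
      (gaussianReal 0 1) := fun i => by
    have hc := continuous_gaussianLogRatio (m i) (v i)
    refine ⟨by fun_prop, ?_⟩
    rw [hasFiniteIntegral_iff_ofReal (Filter.Eventually.of_forall fun x => (Real.exp_pos _).le)]
    have h1 : gaussianReal (m i) (v i) Set.univ = 1 := measure_univ
    rw [gaussianReal_eq_withDensity _ (hv i), withDensity_apply _ MeasurableSet.univ,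
      Measure.restrict_univ] at h1
    rw [h1]
    exact ENNReal.one_lt_top
  have hint' : ∀ i, Integrable ((s i).indicator
      fun x => Real.exp (gaussianLogRatio (m i) (v i) x)) (gaussianReal 0 1) := fun i =>
    (hint i).indicator (hs i)
  have hnn : ∀ i x, 0 ≤ (s i).indicator (fun x => Real.exp (gaussianLogRatio (m i) (v i) x)) x :=
    fun i x => Set.indicator_nonneg (fun _ _ => (Real.exp_pos _).le) x
  have hone : ∀ i, gaussianReal (m i) (v i) (s i) = ENNReal.ofReal
      (∫ x, (s i).indicator (fun x => Real.exp (gaussianLogRatio (m i) (v i) x)) x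
        ∂(gaussianReal 0 1)) := fun i => by
    rw [ofReal_integral_eq_lintegral_ofReal (hint' i) (Filter.Eventually.of_forall (hnn i)),
      gaussianReal_eq_withDensity _ (hv i), withDensity_apply _ (hs i), ← lintegral_indicator (hs i)]
    refine lintegral_congr fun x => ?_
    by_cases hx : x ∈ s i <;> simp [hx]
  have hpi : MeasurableSet (Set.univ.pi s) := MeasurableSet.univ_pi hs
  simp_rw [hone]
  rw [← ENNReal.ofReal_prod_of_nonneg fun i _ => integral_nonneg (hnn i),
    ← integral_fintype_prod_eq_prod, ofReal_integral_eq_lintegral_ofReal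
      (Integrable.fintype_prod hint') (Filter.Eventually.of_forall fun x =>
        Finset.prod_nonneg fun i _ => hnn i (x i)), withDensity_apply _ hpi,
    ← lintegral_indicator hpi]
  refine lintegral_congr fun x => ?_
  by_cases hx : x ∈ Set.univ.pi s
  · rw [Set.indicator_of_mem hx, Real.exp_sum]
    congr 1
    refine Finset.prod_congr rfl fun i _ => ?_
    rw [Set.indicator_of_mem (hx i (Set.mem_univ i))]
  · rw [Set.indicator_of_notMem hx]
    simp only [Set.mem_univ_pi, not_forall] at hx
    obtain ⟨i, hi⟩ := hx
    rw [Finset.prod_eq_zero (Finset.mem_univ i) (Set.indicator_of_notMem hi _), ENNReal.ofReal_zero]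

/-- The product case suffices: a pair of nondegenerate Gaussian laws reduces to it by a linear
change of coordinates. -/
theorem klDiv_pi_gaussianReal (m : ι → ℝ) {v : ι → ℝ≥0} (hv : ∀ i, v i ≠ 0) :
    klDiv (Measure.pi fun i => gaussianReal (m i) (v i)) (Measure.pi fun _ => gaussianReal 0 1) =
      ENNReal.ofReal (∑ i, (v i + m i ^ 2 - 1 - Real.log (v i)) / 2) := by
  set P := Measure.pi fun i => gaussianReal (m i) (v i) with hP
  set Q := Measure.pi fun _ : ι => gaussianReal 0 1 with hQ
  have hd : P = Q.withDensity
      fun x => ENNReal.ofReal (Real.exp (∑ i, gaussianLogRatio (m i) (v i) (x i))) :=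
    pi_gaussianReal_eq_withDensity m hv
  have hc := fun i => continuous_gaussianLogRatio (m i) (v i)
  have hmeas : Measurable fun x : ι → ℝ =>
      ENNReal.ofReal (Real.exp (∑ i, gaussianLogRatio (m i) (v i) (x i))) := by fun_prop
  have hac : P ≪ Q := hd ▸ withDensity_absolutelyContinuous _ _
  have hllr : llr P Q =ᵐ[P] fun x => ∑ i, gaussianLogRatio (m i) (v i) (x i) := by
    have h1 : P.rnDeriv Q =ᵐ[Q]
        fun x => ENNReal.ofReal (Real.exp (∑ i, gaussianLogRatio (m i) (v i) (x i))) := by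
      rw [hd]
      exact Measure.rnDeriv_withDensity Q hmeas
    filter_upwards [hac.ae_le h1] with x hx
    rw [llr, hx, ENNReal.toReal_ofReal (Real.exp_pos _).le, Real.log_exp]
  have hint : ∀ i, Integrable (fun x : ι → ℝ => gaussianLogRatio (m i) (v i) (x i)) P := fun i =>
    integrable_comp_eval (μ := fun i => gaussianReal (m i) (v i))
      (integrable_gaussianLogRatio (m i) (v i))
  rw [klDiv_of_ac_of_integrable hac ((integrable_congr hllr).2 (integrable_finsetSum _ fun i _ => hint i)),
    integral_congr_ae hllr, integral_finsetSum _ fun i _ => hint i]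
  simp only [measureReal_def, measure_univ, ENNReal.toReal_one, add_sub_cancel_right]
  congr 1
  refine Finset.sum_congr rfl fun i _ => ?_
  rw [← integral_gaussianLogRatio (m i) (hv i)]
  exact integral_comp_eval (μ := fun i => gaussianReal (m i) (v i))
    (hc i).aestronglyMeasurable

end GaussianDivergence

/-! ### Linear images of Gaussian measures. -/

section GaussianMap

open InformationTheory
open scoped NNReal MatrixOrder

variable {ι κ : Type*} [Fintype ι] [DecidableEq ι] [Fintype κ] [DecidableEq κ]

/-- Both sides have the same characteristic function. M is arbitrary, so degenerate laws are
included. -/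
theorem map_pi_gaussianReal (m : κ → ℝ) (v : κ → ℝ≥0) (a : ι → ℝ) (M : Matrix ι κ ℝ) :
    (Measure.pi fun j => gaussianReal (m j) (v j)).map (fun z => WithLp.toLp 2 (a + M *ᵥ z)) =
      multivariateGaussian (WithLp.toLp 2 (a + M *ᵥ m))
        (M * diagonal (fun j => (v j : ℝ)) * Mᵀ) := by
  have hmeas : Measurable fun z : κ → ℝ => (WithLp.toLp 2 (a + M *ᵥ z) : EuclideanSpace ℝ ι) := by
    refine Continuous.measurable ?_
    fun_prop
  have hpsd : (M * diagonal (fun j => (v j : ℝ)) * Mᵀ).PosSemidef := by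
    have := (PosSemidef.diagonal (n := κ) (d := fun j => (v j : ℝ))
      (fun j => (v j).2)).mul_mul_conjTranspose_same M
    simpa using this
  have : IsProbabilityMeasure ((Measure.pi fun j => gaussianReal (m j) (v j)).map
      (fun z => (WithLp.toLp 2 (a + M *ᵥ z) : EuclideanSpace ℝ ι))) :=
    Measure.isProbabilityMeasure_map hmeas.aemeasurable
  refine Measure.ext_of_charFun (funext fun t => ?_)
  rw [charFun_multivariateGaussian hpsd, charFun_apply, integral_map hmeas.aemeasurable
    (by fun_prop)]
  set s : κ → ℝ := Mᵀ *ᵥ (fun i => t i) with hs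
  have hinner : ∀ x : ι → ℝ, inner ℝ (WithLp.toLp 2 x : EuclideanSpace ℝ ι) t =
      x ⬝ᵥ (fun i => t i) := fun x => by
    rw [PiLp.inner_apply]
    simp [dotProduct, mul_comm]
  have hMz : ∀ z : κ → ℝ, (M *ᵥ z) ⬝ᵥ (fun i => t i) = ∑ j, s j * z j := fun z => by
    rw [hs, mulVec_transpose, dotProduct_comm, dotProduct_mulVec]
    rfl
  have e1 : ∀ z : κ → ℝ, Complex.exp ((inner ℝ (WithLp.toLp 2 (a + M *ᵥ z) :
      EuclideanSpace ℝ ι) t : ℝ) * Complex.I) =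
      Complex.exp (((a ⬝ᵥ fun i => t i : ℝ) : ℂ) * Complex.I) *
        ∏ j, Complex.exp ((s j : ℂ) * (z j : ℂ) * Complex.I) := fun z => by
    rw [hinner, add_dotProduct, hMz, ← Complex.exp_sum, ← Complex.exp_add, Complex.ofReal_add,
      add_mul, Complex.ofReal_sum, Finset.sum_mul]
    simp only [Complex.ofReal_mul]
  simp_rw [e1]
  rw [integral_const_mul, integral_fintype_prod_eq_prod
    (f := fun j (x : ℝ) => Complex.exp ((s j : ℂ) * (x : ℂ) * Complex.I))]
  simp_rw [← charFun_apply_real, charFun_gaussianReal]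
  rw [← Complex.exp_sum, ← Complex.exp_add, real_inner_comm, hinner, add_dotProduct, hMz]
  have e2 : t ⬝ᵥ (M * diagonal (fun j => (v j : ℝ)) * Mᵀ) *ᵥ t = ∑ j, (v j : ℝ) * s j ^ 2 := by
    rw [← mulVec_mulVec, ← mulVec_mulVec, dotProduct_mulVec, ← mulVec_transpose]
    change s ⬝ᵥ diagonal (fun j => (v j : ℝ)) *ᵥ s = _
    simp only [dotProduct, mulVec_diagonal]
    exact Finset.sum_congr rfl fun j _ => by ring
  congr 1
  rw [e2, Finset.sum_sub_distrib, Complex.ofReal_add, add_mul, add_sub_assoc, Complex.ofReal_sum,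
    Complex.ofReal_sum, Finset.sum_mul, Finset.sum_div]
  simp only [Complex.ofReal_mul, Complex.ofReal_pow]

theorem Matrix.PosDef.exists_transpose_mul {S : Matrix κ κ ℝ} (hS : S.PosDef) :
    ∃ C : Matrix κ κ ℝ, S = Cᵀ * C ∧ IsUnit C.det := by
  obtain ⟨C, hC⟩ := CStarAlgebra.nonneg_iff_eq_star_mul_self.1
    (nonneg_iff_posSemidef.2 hS.posSemidef)
  have hC' : S = Cᵀ * C := by rw [hC]; simp [star_eq_conjTranspose]
  refine ⟨C, hC', ?_⟩
  have h1 := (Matrix.isUnit_iff_isUnit_det _).1 hS.isUnit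
  rw [hC', det_mul] at h1
  exact isUnit_of_mul_isUnit_right h1

/-- An upper bound for the divergence between images of nondegenerate Gaussian measures. -/
theorem klDiv_multivariateGaussian_le {S₁ S₀ : Matrix κ κ ℝ} (h₁ : S₁.PosDef) (h₀ : S₀.PosDef)
    (hdet : S₀.det ≤ S₁.det) (m₁ m₀ : κ → ℝ) (F : Matrix ι κ ℝ) :
    klDiv (multivariateGaussian (WithLp.toLp 2 (F *ᵥ m₁)) (F * S₁ * Fᵀ))
        (multivariateGaussian (WithLp.toLp 2 (F *ᵥ m₀)) (F * S₀ * Fᵀ)) ≤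
      ENNReal.ofReal (((S₀⁻¹ * S₁).trace - Fintype.card κ +
        (m₁ - m₀) ⬝ᵥ S₀⁻¹ *ᵥ (m₁ - m₀)) / 2) := by
  obtain ⟨C, hC, hCu⟩ := h₀.exists_transpose_mul
  have hCC : C⁻¹ * C = 1 := nonsing_inv_mul _ hCu
  have hCC' : C * C⁻¹ = 1 := mul_nonsing_inv _ hCu
  have hinv : S₀⁻¹ = C⁻¹ * C⁻¹ᵀ := by
    rw [hC, Matrix.mul_inv_rev, transpose_nonsing_inv]
  -- In coordinates where S₀ is the identity S₁ becomes W; diagonalising W leaves a product Gaussian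
  -- against the standard one.
  set W := C⁻¹ᵀ * S₁ * C⁻¹ with hW
  have hWpd : W.PosDef := by
    have hu : IsUnit C⁻¹ := by
      rw [Matrix.isUnit_iff_isUnit_det]
      exact isUnit_nonsing_inv_det _ hCu
    have := (Matrix.IsUnit.posDef_star_left_conjugate_iff (x := S₁) hu).2 h₁
    simpa [star_eq_conjTranspose] using this
  obtain ⟨U, hU1, hU2, hU3⟩ := hWpd.1.exists_orthogonal_diagonal
  set d := hWpd.1.eigenvalues with hd
  have hdpos : ∀ j, 0 < d j := fun j => hWpd.eigenvalues_pos j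
  set v : κ → ℝ≥0 := fun j => ⟨d j, (hdpos j).le⟩ with hv
  set z : κ → ℝ := Uᵀ *ᵥ (C⁻¹ᵀ *ᵥ (m₁ - m₀)) with hz
  have hS1 : S₁ = Cᵀ * W * C := by
    rw [hW]
    have e : Cᵀ * C⁻¹ᵀ = 1 := by rw [← transpose_mul, hCC, transpose_one]
    calc S₁ = (Cᵀ * C⁻¹ᵀ) * S₁ * (C⁻¹ * C) := by rw [e, hCC, one_mul, mul_one]
      _ = _ := by simp only [mul_assoc]
  have hmap1 := map_pi_gaussianReal z v (F *ᵥ m₀) (F * Cᵀ * U)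
  have hmap0 := map_pi_gaussianReal (fun _ : κ => 0) (fun _ => 1) (F *ᵥ m₀) (F * Cᵀ * U)
  have em1 : F *ᵥ m₀ + (F * Cᵀ * U) *ᵥ z = F *ᵥ m₁ := by
    have e : F * Cᵀ * U * Uᵀ * C⁻¹ᵀ = F := by
      rw [show F * Cᵀ * U * Uᵀ * C⁻¹ᵀ = F * (Cᵀ * (U * Uᵀ) * C⁻¹ᵀ) by
        simp only [Matrix.mul_assoc], hU1, Matrix.mul_one, ← transpose_mul, hCC, transpose_one,
        Matrix.mul_one]
    rw [hz, mulVec_mulVec, mulVec_mulVec, e, ← mulVec_add, add_sub_cancel]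
  have es1 : F * Cᵀ * U * diagonal (fun j => (v j : ℝ)) * (F * Cᵀ * U)ᵀ = F * S₁ * Fᵀ := by
    rw [hS1]
    conv_rhs => rw [hU3]
    simp only [transpose_mul, transpose_transpose, Matrix.mul_assoc]
    rfl
  have em0 : F *ᵥ m₀ + (F * Cᵀ * U) *ᵥ (fun _ => (0 : ℝ)) = F *ᵥ m₀ := by
    rw [show (fun _ : κ => (0 : ℝ)) = 0 from rfl, mulVec_zero, add_zero]
  have es0 : F * Cᵀ * U * (diagonal (fun _ => ((1 : ℝ≥0) : ℝ)) : Matrix κ κ ℝ) * (F * Cᵀ * U)ᵀ = F * S₀ * Fᵀ := by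
    rw [NNReal.coe_one, show diagonal (fun _ : κ => (1 : ℝ)) = 1 from diagonal_one, Matrix.mul_one,
      hC]
    simp only [transpose_mul, transpose_transpose]
    rw [Matrix.mul_assoc (F * Cᵀ), ← Matrix.mul_assoc U, hU1, Matrix.one_mul]
    simp only [Matrix.mul_assoc]
  rw [em1, es1] at hmap1
  rw [em0, es0] at hmap0
  rw [← hmap1, ← hmap0]
  have hmeas : Measurable fun y : κ → ℝ =>
      (WithLp.toLp 2 (F *ᵥ m₀ + (F * Cᵀ * U) *ᵥ y) : EuclideanSpace ℝ ι) := by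
    refine Continuous.measurable ?_
    fun_prop
  -- Data processing: passing to images cannot increase the divergence, whatever F is.
  refine (klDiv_map_le _ _ hmeas).trans ?_
  rw [klDiv_pi_gaussianReal z (fun j => by
    intro h0
    have := congrArg NNReal.toReal h0
    exact (hdpos j).ne' this)]
  refine ENNReal.ofReal_le_ofReal ?_
  have etr : ∑ j, d j = (S₀⁻¹ * S₁).trace := by
    have h : W.trace = ∑ j, d j := by rw [hWpd.1.trace_eq_sum_eigenvalues]; rfl
    rw [← h, hinv, hW, trace_mul_comm, mul_assoc]
  have eq : ∑ j, z j ^ 2 = (m₁ - m₀) ⬝ᵥ S₀⁻¹ *ᵥ (m₁ - m₀) := by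
    have : ∑ j, z j ^ 2 = z ⬝ᵥ z := by
      simp only [dotProduct, pow_two]
    have e2 : z ⬝ᵥ z = (C⁻¹ᵀ *ᵥ (m₁ - m₀)) ⬝ᵥ (C⁻¹ᵀ *ᵥ (m₁ - m₀)) := by
      rw [hz, dotProduct_mulVec, ← mulVec_transpose, transpose_transpose, mulVec_mulVec, hU1,
        one_mulVec]
    rw [this, e2, hinv, ← mulVec_mulVec, dotProduct_mulVec, dotProduct_mulVec _ C⁻¹,
      ← mulVec_transpose C⁻¹]
    rw [dotProduct_mulVec]
  -- The sum is log(det S₁ / det S₀), nonnegative by `hdet`; it enters the divergence with a minus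
  -- sign and is dropped.
  have elog : 0 ≤ ∑ j, Real.log (d j) := by
    rw [← Real.log_prod (fun j _ => (hdpos j).ne')]
    refine Real.log_nonneg ?_
    have e1 : W.det = ∏ j, d j := by
      rw [hWpd.1.det_eq_prod_eigenvalues]; simp [hd]
    rw [← e1]
    have e2 : S₀.det * W.det = S₁.det := by
      rw [hS1, hC]
      simp only [det_mul, det_transpose]
      ring
    have h0 := h₀.det_pos
    by_contra hcon
    push Not at hcon
    nlinarith
  have : ∑ j, ((v j : ℝ) + z j ^ 2 - 1 - Real.log (v j)) / 2 =
      (∑ j, d j + ∑ j, z j ^ 2 - Fintype.card κ - ∑ j, Real.log (d j)) / 2 := by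
    rw [← Finset.sum_div, Finset.sum_sub_distrib, Finset.sum_sub_distrib, Finset.sum_add_distrib]
    simp
    rfl
  rw [this, etr, eq]
  linarith

end GaussianMap

/-! ### Posteriors for full and for compressed features. -/

section PosteriorDivergence

open InformationTheory
open scoped NNReal MatrixOrder

variable {ι κ n : Type*} [Fintype ι] [DecidableEq ι] [Fintype κ] [DecidableEq κ] [Fintype n]
  [DecidableEq n]

theorem Matrix.PosDef.det_le_det {X Y : Matrix n n ℝ} (hX : X.PosDef) (hY : Y.PosDef)
    (h : X ≤ Y) : X.det ≤ Y.det := by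
  obtain ⟨C, hC, hCu⟩ := hY.exists_transpose_mul
  have hCC : C⁻¹ * C = 1 := nonsing_inv_mul _ hCu
  have hCC' : C * C⁻¹ = 1 := mul_nonsing_inv _ hCu
  have e : Cᵀ * C⁻¹ᵀ = 1 := by rw [← transpose_mul, hCC, transpose_one]
  have e' : C⁻¹ᵀ * Cᵀ = 1 := by rw [← transpose_mul, hCC', transpose_one]
  set W := C⁻¹ᵀ * X * C⁻¹ with hW
  have hW0 : 0 ≤ W := by
    have := Matrix.conj_mono' (nonneg_iff_posSemidef.2 hX.posSemidef) C⁻¹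
    simpa using this
  have hW1 : W ≤ (1 : ℝ) • 1 := by
    have h1 := Matrix.conj_mono' h C⁻¹
    rw [hC, show C⁻¹ᵀ * (Cᵀ * C) * C⁻¹ = (C⁻¹ᵀ * Cᵀ) * (C * C⁻¹) by simp only [mul_assoc], e', hCC',
      one_mul] at h1
    rwa [one_smul]
  have hWp := nonneg_iff_posSemidef.1 hW0
  have hdet : W.det ≤ 1 := by
    rw [hWp.1.det_eq_prod_eigenvalues]
    exact Finset.prod_le_one (fun i _ => hWp.eigenvalues_nonneg i)
      fun i _ => (hWp.1.le_smul_one_iff 1).1 hW1 i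
  have hXW : X.det = Y.det * W.det := by
    have : X = Cᵀ * W * C := by
      calc X = (Cᵀ * C⁻¹ᵀ) * X * (C⁻¹ * C) := by rw [e, hCC, one_mul, mul_one]
        _ = _ := by simp only [hW, mul_assoc]
    rw [this, hC]
    simp only [det_mul, det_transpose]
    ring
  rw [hXW]
  nlinarith [hY.det_pos]

/-- The posterior covariance of standard Gaussian weights, given noisy observations of `B g`. -/
noncomputable def weightPosteriorCov (B : Matrix ι κ ℝ) (σ2 : ℝ) : Matrix κ κ ℝ :=
  1 - Bᵀ * (B * Bᵀ + σ2 • (1 : Matrix ι ι ℝ))⁻¹ * B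

theorem posDef_mul_transpose_add (B : Matrix ι κ ℝ) {σ2 : ℝ} (hσ : 0 < σ2) :
    (B * Bᵀ + σ2 • (1 : Matrix ι ι ℝ)).PosDef :=
  Matrix.posDef_add_smul_one (nonneg_iff_posSemidef.2
    (by simpa using posSemidef_self_mul_conjTranspose B)) hσ

theorem posDef_one_add_smul (B : Matrix ι κ ℝ) {c : ℝ} (hc : 0 ≤ c) :
    (1 + c • (Bᵀ * B)).PosDef :=
  PosDef.one.add_posSemidef (by
    have : (Bᵀ * B).PosSemidef := by simpa using posSemidef_conjTranspose_mul_self B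
    exact this.smul hc)

/-- Woodbury's identity: the posterior covariance is the inverse of the weight-space precision 1 +
σ⁻²BᵀB. -/
theorem weightPosteriorCov_mul (B : Matrix ι κ ℝ) {σ2 : ℝ} (hσ : 0 < σ2) :
    (1 + σ2⁻¹ • (Bᵀ * B)) * weightPosteriorCov B σ2 = 1 := by
  have hu := (Matrix.isUnit_iff_isUnit_det _).1 (posDef_mul_transpose_add B hσ).isUnit
  have h1 := mul_nonsing_inv _ hu
  set W := (B * Bᵀ + σ2 • (1 : Matrix ι ι ℝ))⁻¹ with hW
  have h2 : B * Bᵀ * W = 1 - σ2 • W := by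
    rw [Matrix.add_mul, Matrix.smul_mul, Matrix.one_mul] at h1
    rw [← h1, add_sub_cancel_right]
  rw [weightPosteriorCov, ← hW, Matrix.mul_sub, Matrix.mul_one, Matrix.add_mul, Matrix.one_mul,
    Matrix.smul_mul]
  have h3 : Bᵀ * B * (Bᵀ * W * B) = Bᵀ * B - σ2 • (Bᵀ * W * B) := by
    rw [show Bᵀ * B * (Bᵀ * W * B) = Bᵀ * (B * Bᵀ * W) * B by simp only [Matrix.mul_assoc], h2,
      Matrix.mul_sub, Matrix.mul_one, Matrix.sub_mul, Matrix.mul_smul, Matrix.smul_mul]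
  rw [h3, smul_sub, smul_smul, inv_mul_cancel₀ hσ.ne', one_smul]
  abel

theorem weightPosteriorCov_eq_inv (B : Matrix ι κ ℝ) {σ2 : ℝ} (hσ : 0 < σ2) :
    weightPosteriorCov B σ2 = (1 + σ2⁻¹ • (Bᵀ * B))⁻¹ :=
  (inv_eq_right_inv (weightPosteriorCov_mul B hσ)).symm

theorem posDef_weightPosteriorCov (B : Matrix ι κ ℝ) {σ2 : ℝ} (hσ : 0 < σ2) :
    (weightPosteriorCov B σ2).PosDef := by
  rw [weightPosteriorCov_eq_inv B hσ]
  exact (posDef_one_add_smul B (inv_pos.2 hσ).le).inv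

theorem inv_weightPosteriorCov (B : Matrix ι κ ℝ) {σ2 : ℝ} (hσ : 0 < σ2) :
    (weightPosteriorCov B σ2)⁻¹ = 1 + σ2⁻¹ • (Bᵀ * B) :=
  inv_eq_left_inv (weightPosteriorCov_mul B hσ)

/-- Compressing the features by a projection increases the posterior covariance. -/
theorem det_weightPosteriorCov_le (B : Matrix ι κ ℝ) {σ2 : ℝ} (hσ : 0 < σ2) {P : Matrix κ κ ℝ}
    (hPt : Pᵀ = P) (hPP : P * P = P) :
    (weightPosteriorCov B σ2).det ≤ (weightPosteriorCov (B * P) σ2).det := by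
  have hc : 0 ≤ σ2⁻¹ := (inv_pos.2 hσ).le
  have hdet : ∀ A : Matrix ι κ ℝ, (weightPosteriorCov A σ2).det =
      ((1 + σ2⁻¹ • (A * Aᵀ)).det)⁻¹ := fun A => by
    rw [weightPosteriorCov_eq_inv A hσ, det_nonsing_inv, Ring.inverse_eq_inv']
    congr 1
    rw [← Matrix.smul_mul, ← Matrix.mul_smul, ← det_one_add_mul_comm]
  have hpd : ∀ A : Matrix ι κ ℝ, (1 + σ2⁻¹ • (A * Aᵀ)).PosDef := fun A => by
    have := posDef_one_add_smul Aᵀ hc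
    rwa [transpose_transpose] at this
  rw [hdet, hdet]
  refine inv_anti₀ (hpd _).det_pos (Matrix.PosDef.det_le_det (hpd _) (hpd _) ?_)
  have h1 : B * P * (B * P)ᵀ ≤ B * Bᵀ := by
    have := Matrix.conj_mono (Matrix.le_one_of_idempotent hPt hPP) B
    rw [Matrix.mul_one] at this
    rwa [transpose_mul, hPt, Matrix.mul_assoc, ← Matrix.mul_assoc P, hPP, ← Matrix.mul_assoc]
  exact add_le_add_right (Matrix.smul_mono_right h1 hc) 1

/-- The divergence between the posteriors for compressed and for full features. -/
theorem klDiv_posterior_le (F : Matrix n κ ℝ) (B : Matrix ι κ ℝ) {σ2 : ℝ} (hσ : 0 < σ2)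
    {P : Matrix κ κ ℝ} (hPt : Pᵀ = P) (hPP : P * P = P) (y : ι → ℝ) :
    klDiv (multivariateGaussian
          (WithLp.toLp 2 (F *ᵥ ((B * P)ᵀ *ᵥ ((B * P * (B * P)ᵀ + σ2 • 1)⁻¹ *ᵥ y))))
          (F * weightPosteriorCov (B * P) σ2 * Fᵀ))
        (multivariateGaussian
          (WithLp.toLp 2 (F *ᵥ (Bᵀ *ᵥ ((B * Bᵀ + σ2 • 1)⁻¹ *ᵥ y))))
          (F * weightPosteriorCov B σ2 * Fᵀ)) ≤
      ENNReal.ofReal (((B * (1 - P) * Bᵀ).trace / σ2 +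
        (y ⬝ᵥ (B * P * (B * P)ᵀ + σ2 • 1)⁻¹ *ᵥ y - y ⬝ᵥ (B * Bᵀ + σ2 • 1)⁻¹ *ᵥ y)) / 2) := by
  refine (klDiv_multivariateGaussian_le (posDef_weightPosteriorCov (B * P) hσ)
    (posDef_weightPosteriorCov B hσ) (det_weightPosteriorCov_le B hσ hPt hPP) _ _ F).trans
    (le_of_eq ?_)
  congr 2
  have hσ0 := hσ.ne'
  set Q := B * P * (B * P)ᵀ with hQ
  have hQ' : Q = B * P * Bᵀ := by
    rw [hQ, transpose_mul, hPt, Matrix.mul_assoc, ← Matrix.mul_assoc P, hPP, ← Matrix.mul_assoc]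
  have hQt : Qᵀ = Q := by rw [hQ]; simp
  have hPQ : (Q + σ2 • (1 : Matrix ι ι ℝ)).PosDef := posDef_mul_transpose_add (B * P) hσ
  have hPK : (B * Bᵀ + σ2 • (1 : Matrix ι ι ℝ)).PosDef := posDef_mul_transpose_add B hσ
  set a := (Q + σ2 • (1 : Matrix ι ι ℝ))⁻¹ *ᵥ y with ha
  set b := (B * Bᵀ + σ2 • (1 : Matrix ι ι ℝ))⁻¹ *ᵥ y with hb
  have ha1 : Q *ᵥ a + σ2 • a = y := by
    have := hPQ.mulVec_inv_mulVec y
    rwa [add_mulVec, smul_mulVec, one_mulVec] at this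
  have hb1 : (B * Bᵀ) *ᵥ b + σ2 • b = y := by
    have := hPK.mulVec_inv_mulVec y
    rwa [add_mulVec, smul_mulVec, one_mulVec] at this
  clear_value a b
  rw [inv_weightPosteriorCov B hσ]
  -- The product differs from 1 by σ⁻²(BᵀB − PBᵀBP) times a covariance of the form 1 − P(⋯)P.
  -- Against P(⋯)P the matrix BᵀB and its compression have equal traces, so only tr(BᵀB − PBᵀBP)
  -- survives.
  have htrace : ((1 + σ2⁻¹ • (Bᵀ * B)) * weightPosteriorCov (B * P) σ2).trace - Fintype.card κ =
      (B * (1 - P) * Bᵀ).trace / σ2 := by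
    have h1 := weightPosteriorCov_mul (B * P) hσ
    have h2 : (1 + σ2⁻¹ • (Bᵀ * B)) * weightPosteriorCov (B * P) σ2 =
        1 + σ2⁻¹ • ((Bᵀ * B - (B * P)ᵀ * (B * P)) * weightPosteriorCov (B * P) σ2) := by
      have e : 1 + σ2⁻¹ • (Bᵀ * B) = (1 + σ2⁻¹ • ((B * P)ᵀ * (B * P))) +
          σ2⁻¹ • (Bᵀ * B - (B * P)ᵀ * (B * P)) := by
        rw [smul_sub]
        abel
      rw [e, Matrix.add_mul, h1, Matrix.smul_mul]
    have h3 : ((Bᵀ * B - (B * P)ᵀ * (B * P)) * weightPosteriorCov (B * P) σ2).trace =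
        (B * (1 - P) * Bᵀ).trace := by
      have e1 : (B * P)ᵀ = P * Bᵀ := by rw [transpose_mul, hPt]
      rw [weightPosteriorCov, ← hQ]
      set W := (Q + σ2 • (1 : Matrix ι ι ℝ))⁻¹ with hW
      rw [Matrix.mul_sub, Matrix.mul_one, trace_sub, e1]
      have e2 : (Bᵀ * B - P * Bᵀ * (B * P)).trace = (B * (1 - P) * Bᵀ).trace := by
        rw [trace_sub, Matrix.mul_sub, Matrix.mul_one, Matrix.sub_mul, trace_sub,
          trace_mul_comm Bᵀ B, trace_mul_comm (P * Bᵀ), ← Matrix.mul_assoc, Matrix.mul_assoc B P P,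
          hPP]
      have e3 : ((Bᵀ * B - P * Bᵀ * (B * P)) * (P * Bᵀ * W * (B * P))).trace = 0 := by
        rw [Matrix.sub_mul, trace_sub, sub_eq_zero]
        have e4 : P * Bᵀ * (B * P) * (P * Bᵀ * W * (B * P)) =
            P * (Bᵀ * B * (P * Bᵀ * W * (B * P))) := by
          rw [show P * Bᵀ * (B * P) * (P * Bᵀ * W * (B * P)) =
            P * Bᵀ * B * ((P * P) * Bᵀ * W * (B * P)) by simp only [Matrix.mul_assoc], hPP]
          simp only [Matrix.mul_assoc]
        rw [e4, trace_mul_comm P]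
        congr 1
        simp only [Matrix.mul_assoc, hPP]
      rw [e2, e3, sub_zero]
    rw [h2, trace_add, trace_one, trace_smul, h3, smul_eq_mul]
    field_simp
    ring
  rw [htrace]
  congr 1
  -- the quadratic form
  set u := (B * P)ᵀ *ᵥ a with hu
  set w := Bᵀ *ᵥ b with hw
  have hBu : B *ᵥ u = Q *ᵥ a := by
    rw [hu, mulVec_mulVec, transpose_mul, hPt, ← Matrix.mul_assoc, ← hQ']
  have huu : u ⬝ᵥ u = a ⬝ᵥ Q *ᵥ a := by
    conv_lhs => rw [hu, dotProduct_mulVec, vecMul_transpose]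
    rw [mulVec_mulVec, ← hQ, dotProduct_comm]
  have hdot : ∀ (c d : κ → ℝ), c ⬝ᵥ (1 + σ2⁻¹ • (Bᵀ * B)) *ᵥ d =
      c ⬝ᵥ d + σ2⁻¹ * ((B *ᵥ c) ⬝ᵥ (B *ᵥ d)) := fun c d => by
    rw [add_mulVec, one_mulVec, dotProduct_add, smul_mulVec, dotProduct_smul, smul_eq_mul,
      ← mulVec_mulVec, dotProduct_mulVec c, vecMul_transpose]
  -- The normal equation for the exact posterior mean w. It reduces the terms with w to inner
  -- products with Bᵀy, and the quadratic form collapses to y ⬝ᵥ a − y ⬝ᵥ b.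
  have hw1 : (1 + σ2⁻¹ • (Bᵀ * B)) *ᵥ w = σ2⁻¹ • (Bᵀ *ᵥ y) := by
    have e : (Bᵀ * B) *ᵥ (Bᵀ *ᵥ b) = Bᵀ *ᵥ ((B * Bᵀ) *ᵥ b) := by
      simp only [mulVec_mulVec, Matrix.mul_assoc]
    rw [add_mulVec, one_mulVec, smul_mulVec, hw, e, ← hb1, mulVec_add, mulVec_smul, smul_add,
      smul_smul, inv_mul_cancel₀ hσ0, one_smul, add_comm]
  have hsymm : w ⬝ᵥ (1 + σ2⁻¹ • (Bᵀ * B)) *ᵥ u = u ⬝ᵥ (1 + σ2⁻¹ • (Bᵀ * B)) *ᵥ w := by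
    rw [hdot, hdot, dotProduct_comm w u, dotProduct_comm (B *ᵥ w)]
  have huy : u ⬝ᵥ Bᵀ *ᵥ y = y ⬝ᵥ y - σ2 * (y ⬝ᵥ a) := by
    rw [dotProduct_mulVec, vecMul_transpose, hBu, ← sub_eq_iff_eq_add.2 ha1.symm, sub_dotProduct,
      smul_dotProduct, smul_eq_mul, dotProduct_comm a]
  have hwy : w ⬝ᵥ Bᵀ *ᵥ y = y ⬝ᵥ y - σ2 * (y ⬝ᵥ b) := by
    rw [dotProduct_mulVec, vecMul_transpose, hw, mulVec_mulVec, ← sub_eq_iff_eq_add.2 hb1.symm,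
      sub_dotProduct, smul_dotProduct, smul_eq_mul, dotProduct_comm b]
  have huSu : u ⬝ᵥ (1 + σ2⁻¹ • (Bᵀ * B)) *ᵥ u = σ2⁻¹ * (y ⬝ᵥ y - σ2 * (y ⬝ᵥ a)) := by
    rw [hdot, huu, hBu]
    have e1 : Q *ᵥ a = y - σ2 • a := by rw [← sub_eq_iff_eq_add.2 ha1.symm]
    rw [e1]
    simp only [dotProduct_sub, sub_dotProduct, dotProduct_smul, smul_dotProduct, smul_eq_mul,
      dotProduct_comm a y]
    field_simp
    ring
  rw [mulVec_sub, dotProduct_sub, sub_dotProduct, sub_dotProduct, hsymm, huSu, hw1,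
    dotProduct_smul, dotProduct_smul, huy, hwy, smul_eq_mul, smul_eq_mul]
  field_simp
  ring

end PosteriorDivergence

/-! ### The variational approximation as a posterior for compressed features. -/

section SparseApproximation

open InformationTheory
open scoped MatrixOrder

theorem Matrix.PosSemidef.exists_mul_transpose {ι : Type*} [Fintype ι] [DecidableEq ι]
    {A : Matrix ι ι ℝ} (hA : A.PosSemidef) : ∃ C : Matrix ι ι ℝ, A = C * Cᵀ := by
  obtain ⟨C, hC⟩ := CStarAlgebra.nonneg_iff_eq_mul_star_self.1 (nonneg_iff_posSemidef.2 hA)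
  exact ⟨C, by rw [hC, star_eq_conjTranspose, conjTranspose_eq_transpose_of_trivial]⟩

variable {D N : ℕ} {k : EuclideanSpace ℝ (Fin D) → EuclideanSpace ℝ (Fin D) → ℝ}

/-- Finitely many points of two families have a common finite-dimensional feature map. -/
theorem IsCovarianceFunction.exists_features (hk : IsCovarianceFunction k) {n : ℕ}
    (t : Fin n → EuclideanSpace ℝ (Fin D)) (x : Fin N → EuclideanSpace ℝ (Fin D)) :
    ∃ (F : Matrix (Fin n) (Fin n ⊕ Fin N) ℝ) (B : Matrix (Fin N) (Fin n ⊕ Fin N) ℝ),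
      (∀ i j, k (t i) (t j) = F i ⬝ᵥ F j) ∧ (∀ i j, k (t i) (x j) = F i ⬝ᵥ B j) ∧
      (∀ i j, k (x i) (t j) = B i ⬝ᵥ F j) ∧ ∀ i j, k (x i) (x j) = B i ⬝ᵥ B j := by
  obtain ⟨C, hC⟩ := (hk.submatrix (Sum.elim t x)).exists_mul_transpose
  have h : ∀ a b, k (Sum.elim t x a) (Sum.elim t x b) = C a ⬝ᵥ C b := fun a b =>
    congrFun (congrFun hC a) b
  exact ⟨C.submatrix Sum.inl id, C.submatrix Sum.inr id, fun i j => h (Sum.inl i) (Sum.inl j),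
    fun i j => h (Sum.inl i) (Sum.inr j), fun i j => h (Sum.inr i) (Sum.inl j),
    fun i j => h (Sum.inr i) (Sum.inr j)⟩

/-- The divergence of the best sparse variational approximation is at most that of the posterior
for the Nyström approximation of the kernel matrix. -/
theorem sparseKL_le (hk : IsCovarianceFunction k) {σ2 : ℝ} (hσ : 0 < σ2)
    (x : Fin N → EuclideanSpace ℝ (Fin D)) (y : EuclideanSpace ℝ (Fin N)) (Z : Finset (Fin N)) :
    sparseKL k σ2 x y Z ≤ ENNReal.ofReal
      (((nystromResidual (kernelMatrix k x) Z).trace / σ2 +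
        ((fun i => y i) ⬝ᵥ (kernelMatrix k x - nystromResidual (kernelMatrix k x) Z + σ2 • 1)⁻¹ *ᵥ
            (fun i => y i) -
          (fun i => y i) ⬝ᵥ (kernelMatrix k x + σ2 • 1)⁻¹ *ᵥ (fun i => y i))) / 2) := by
  set K := kernelMatrix k x with hKdef
  set R := nystromResidual K Z with hR
  set W := (K - R + σ2 • (1 : Matrix (Fin N) (Fin N) ℝ))⁻¹ with hW
  set Kzx := K.submatrix (Subtype.val : Z → Fin N) id with hKzx
  set Kzz := K.submatrix (Subtype.val : Z → Fin N) (Subtype.val : Z → Fin N) with hKzz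
  set y' : Fin N → ℝ := fun i => y i with hy'
  have hind : inducingMatrix k x Z = Kzz := rfl
  -- the objects in terms of features
  have key : ∀ {n : ℕ} (t : Fin n → EuclideanSpace ℝ (Fin D)),
      ∃ (F : Matrix (Fin n) (Fin n ⊕ Fin N) ℝ) (B : Matrix (Fin N) (Fin n ⊕ Fin N) ℝ),
        (∀ i j, k (t i) (t j) = (F * Fᵀ) i j) ∧ (∀ i j, k (t i) (x j) = (F * Bᵀ) i j) ∧
        (∀ i j, k (x i) (t j) = (B * Fᵀ) i j) ∧ K = B * Bᵀ := by
    intro n t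
    obtain ⟨F, B, h1, h2, h3, h4⟩ := hk.exists_features t x
    exact ⟨F, B, h1, h2, h3, Matrix.ext h4⟩
  have hfeat : ∀ {n : ℕ} (B : Matrix (Fin N) (Fin n ⊕ Fin N) ℝ), K = B * Bᵀ →
      ∀ Bz : Matrix Z (Fin n ⊕ Fin N) ℝ, Bz = B.submatrix (Subtype.val : Z → Fin N) id →
      Kzz = Bz * Bzᵀ ∧ Kzx = Bz * Bᵀ ∧
      B * rowProjection Bz * (B * rowProjection Bz)ᵀ = K - R := by
    intro n B hB Bz hBz
    refine ⟨by rw [hKzz, hB, hBz]; rfl, by rw [hKzx, hB, hBz]; rfl, ?_⟩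
    rw [hR, nystromResidual_eq hB, ← hBz, transpose_mul, rowProjection_transpose,
      Matrix.mul_assoc, ← Matrix.mul_assoc (rowProjection Bz), rowProjection_mul_self,
      Matrix.mul_sub, Matrix.sub_mul, Matrix.mul_one, hB, sub_sub_cancel, Matrix.mul_assoc]
  -- No test points are involved, so features with n = 0 suffice; in them the matrix is the image
  -- under Bz of the compressed posterior covariance.
  have hC : (Kzz - Kzx * W * Kzxᵀ).PosSemidef := by
    obtain ⟨F, B, -, -, -, hB⟩ := key (fun i : Fin 0 => i.elim0)
    obtain ⟨e1, e2, e3⟩ := hfeat B hB _ rfl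
    set Bz := B.submatrix (Subtype.val : Z → Fin N) id
    have h := (posDef_weightPosteriorCov (B * rowProjection Bz) hσ).posSemidef
    have h' := h.mul_mul_conjTranspose_same Bz
    rw [conjTranspose_eq_transpose_of_trivial] at h'
    convert! h' using 1
    rw [weightPosteriorCov, e3, ← hW, Matrix.mul_sub, Matrix.sub_mul, Matrix.mul_one, ← e1, e2]
    congr 1
    have e4 : Bz * (B * rowProjection Bz)ᵀ = Bz * Bᵀ := by
      rw [transpose_mul, rowProjection_transpose, ← Matrix.mul_assoc, mul_rowProjection]
    have e5 : B * rowProjection Bz * Bzᵀ = B * Bzᵀ := by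
      have := congrArg transpose e4
      simpa [Matrix.mul_assoc] using this
    calc Bz * Bᵀ * W * (Bz * Bᵀ)ᵀ = (Bz * Bᵀ) * W * (B * Bzᵀ) := by simp
      _ = (Bz * (B * rowProjection Bz)ᵀ) * W * (B * rowProjection Bz * Bzᵀ) := by rw [e4, e5]
      _ = _ := by simp only [Matrix.mul_assoc]
  -- The witness for q is the law of f(Z) given y in the model with data covariance K − R; extended
  -- by the prior conditional law it is the posterior for the features B P.
  refine iInf_le_of_le (Kzx *ᵥ (W *ᵥ y')) (iInf_le_of_le (Kzz - Kzx * W * Kzxᵀ)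
    (iInf_le_of_le hC ?_))
  refine iSup_le fun n => iSup_le fun t => ?_
  obtain ⟨F, B, hFF, hFB, hBF, hB⟩ := key t
  obtain ⟨e1, e2, e3⟩ := hfeat B hB _ rfl
  set Bz := B.submatrix (Subtype.val : Z → Fin N) id with hBz
  set P := rowProjection Bz with hP
  have hPt : Pᵀ = P := rowProjection_transpose Bz
  have hPP : P * P = P := rowProjection_mul_self Bz
  have hPdef : P = Bzᵀ * symPinv (Bz * Bzᵀ) * Bz := rfl
  have hmain := klDiv_posterior_le F B hσ hPt hPP y'
  have htr : B * (1 - P) * Bᵀ = R := by rw [hR, nystromResidual_eq hB]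
  rw [e3, ← hB, ← hW, htr] at hmain
  have hFz : ∀ i, (fun j : Z => k (t i) (x j)) = (F * Bzᵀ) i := fun i => by
    funext j; exact hFB i j
  have hzF : ∀ j, (fun i : Z => k (x i) (t j)) = fun i => (Bz * Fᵀ) i j := fun j => by
    funext i; exact hBF i j
  have hFx : ∀ i, (fun j => k (t i) (x j)) = (F * Bᵀ) i := fun i => funext fun j => hFB i j
  have hxF : ∀ j, (fun i => k (x i) (t j)) = fun i => (B * Fᵀ) i j := fun j =>
    funext fun i => hBF i j
  have hent : ∀ {α β : Type} [Fintype α] [Fintype β] (X : Matrix (Fin n) α ℝ) (Y : Matrix α β ℝ)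
      (V : Matrix β (Fin n) ℝ) (i j : Fin n), X i ⬝ᵥ (Y *ᵥ fun a => V a j) = (X * Y * V) i j := by
    intro α β _ _ X Y V i j
    rw [Matrix.mul_assoc]
    rfl
  have hPB : P * Bᵀ = Bzᵀ * symPinv (Bz * Bzᵀ) * (Bz * Bᵀ) := by
    rw [hPdef, Matrix.mul_assoc _ Bz]
  have hBP : B * P = (Bz * Bᵀ)ᵀ * symPinv (Bz * Bzᵀ) * Bz := by
    have := congrArg transpose hPB
    simp only [transpose_mul, hPt, symPinv_transpose, transpose_transpose] at this
    rw [this, transpose_mul, transpose_transpose, Matrix.mul_assoc _ (symPinv _)]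
  have hm1 : (fun i => variationalMean k x Z (Kzx *ᵥ (W *ᵥ y')) (t i)) =
      F *ᵥ ((B * P)ᵀ *ᵥ (W *ᵥ y')) := by
    funext i
    rw [variationalMean, hFz, hind, e1, e2, transpose_mul, hPt, hPB]
    change ((F * Bzᵀ) *ᵥ _) i = _
    simp only [mulVec_mulVec, Matrix.mul_assoc]
  have hm2 : (fun i => posteriorMean k σ2 x y (t i)) =
      F *ᵥ (Bᵀ *ᵥ ((K + σ2 • (1 : Matrix (Fin N) (Fin N) ℝ))⁻¹ *ᵥ y')) := by
    funext i
    rw [posteriorMean, hFx, ← hKdef, ← hy']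
    change ((F * Bᵀ) *ᵥ _) i = _
    simp only [mulVec_mulVec, Matrix.mul_assoc]
  have hc1 : (Matrix.of fun i j => variationalCov k x Z (Kzz - Kzx * W * Kzxᵀ) (t i) (t j)) =
      F * weightPosteriorCov (B * P) σ2 * Fᵀ := by
    ext i j
    rw [of_apply, variationalCov, hFz, hzF, hind, hFF, hent, ← Matrix.add_apply]
    rw [sub_sub_cancel_left, weightPosteriorCov, e3, ← hW, Matrix.mul_sub F, Matrix.sub_mul,
      Matrix.mul_one, sub_eq_add_neg, transpose_mul, hPt, hPB, hBP, e1, e2]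
    simp only [Matrix.mul_assoc, Matrix.neg_mul, Matrix.mul_neg]
  have hc2 : (Matrix.of fun i j => posteriorCov k σ2 x (t i) (t j)) =
      F * weightPosteriorCov B σ2 * Fᵀ := by
    ext i j
    rw [of_apply, posteriorCov, hFx, hxF, hFF, hent, ← Matrix.sub_apply]
    rw [weightPosteriorCov, ← hB, Matrix.mul_sub, Matrix.sub_mul, Matrix.mul_one, ← hKdef]
    simp only [Matrix.mul_assoc]
  rw [hm1, hm2, hc1, hc2]
  exact hmain

end SparseApproximation

/-! ### The divergence under a uniform bound on the Nyström error. -/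

section AccurateApproximation

open scoped MatrixOrder

variable {N : ℕ}

theorem nystromResidual_le_self {K : Matrix (Fin N) (Fin N) ℝ} (hK : K.PosSemidef)
    (Z : Finset (Fin N)) : nystromResidual K Z ≤ K := by
  obtain ⟨B, hB⟩ := hK.exists_mul_transpose
  rw [nystromResidual_eq hB]
  set P := rowProjection (B.submatrix (Subtype.val : Z → Fin N) id) with hP
  have hP0 : 0 ≤ P := Matrix.nonneg_of_idempotent (rowProjection_transpose _)
    (rowProjection_mul_self _)
  have h := Matrix.conj_mono (sub_le_self 1 hP0) B
  rwa [Matrix.mul_one, ← hB] at h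

theorem Matrix.PosDef.dotProduct_inv_add_smul_le {K : Matrix (Fin N) (Fin N) ℝ} (hK : 0 ≤ K)
    {σ2 : ℝ} (hσ : 0 < σ2) (y : Fin N → ℝ) :
    y ⬝ᵥ (K + σ2 • 1)⁻¹ *ᵥ y ≤ (y ⬝ᵥ y) / σ2 := by
  have h1 : (σ2 • (1 : Matrix (Fin N) (Fin N) ℝ)).PosDef := PosDef.one.smul hσ
  have h := PosDef.dotProduct_inv_mulVec_le (Matrix.posDef_add_smul_one hK hσ) h1 zero_le_one
    (by rw [one_smul]; exact le_add_of_nonneg_left hK) y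
  have h2 : (σ2 • (1 : Matrix (Fin N) (Fin N) ℝ))⁻¹ = σ2⁻¹ • 1 :=
    inv_eq_left_inv (by simp [hσ.ne'])
  rw [h2, one_mul, smul_mulVec, one_mulVec, dotProduct_smul, smul_eq_mul] at h
  rwa [div_eq_inv_mul]

variable {D : ℕ} {k : EuclideanSpace ℝ (Fin D) → EuclideanSpace ℝ (Fin D) → ℝ}

theorem IsCovarianceFunction.posSemidef_kernelMatrix (hk : IsCovarianceFunction k)
    (x : Fin N → EuclideanSpace ℝ (Fin D)) : (kernelMatrix k x).PosSemidef :=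
  hk.submatrix x

/-- R ≤ l gives tr R ≤ l N and K + σ² ≤ (1 + l/σ²)(K − R + σ²), so the two quadratic forms differ by
at most l/σ² times the exact one. Keeping yᵀ(K + σ²)⁻¹y in the bound serves both assumptions on y.
-/
theorem sparseKL_le_of_nystromResidual_le (hk : IsCovarianceFunction k) {σ2 : ℝ} (hσ : 0 < σ2)
    (x : Fin N → EuclideanSpace ℝ (Fin D)) (y : EuclideanSpace ℝ (Fin N)) {Z : Finset (Fin N)}
    {l : ℝ} (hl : 0 ≤ l) (h : nystromResidual (kernelMatrix k x) Z ≤ l • 1) :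
    sparseKL k σ2 x y Z ≤ ENNReal.ofReal (l / σ2 *
      (N + (fun i => y i) ⬝ᵥ (kernelMatrix k x + σ2 • 1)⁻¹ *ᵥ (fun i => y i)) / 2) := by
  have hK := hk.posSemidef_kernelMatrix x
  refine (sparseKL_le hk hσ x y Z).trans (ENNReal.ofReal_le_ofReal ?_)
  set K := kernelMatrix k x
  set R := nystromResidual K Z
  have hRK : 0 ≤ K - R := sub_nonneg.2 (nystromResidual_le_self hK Z)
  have htr : R.trace ≤ l * N := by
    have := Matrix.trace_mono h
    simpa [trace_smul] using this
  have hG := Matrix.posDef_add_smul_one hRK hσ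
  have hH := Matrix.posDef_add_smul_one (nonneg_iff_posSemidef.2 hK) hσ
  have hlσ : 0 ≤ l / σ2 := div_nonneg hl hσ.le
  have hHG : K + σ2 • (1 : Matrix (Fin N) (Fin N) ℝ) ≤ (1 + l / σ2) • (K - R + σ2 • 1) := by
    have e : (1 + l / σ2) • (K - R + σ2 • (1 : Matrix (Fin N) (Fin N) ℝ)) =
        (K + σ2 • 1) + (l • 1 - R) + (l / σ2) • (K - R) := by
      have : (l / σ2) • σ2 • (1 : Matrix (Fin N) (Fin N) ℝ) = l • 1 := by
        rw [smul_smul, div_mul_cancel₀ _ hσ.ne']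
      rw [add_smul, one_smul, smul_add, this]
      abel
    rw [e, add_assoc]
    exact le_add_of_nonneg_right (add_nonneg (sub_nonneg.2 h) (smul_nonneg hlσ hRK))
  have hq := PosDef.dotProduct_inv_mulVec_le hG hH (by positivity) hHG (fun i => y i)
  have h2 : R.trace / σ2 ≤ l / σ2 * N := by
    rw [div_mul_eq_mul_div]
    gcongr
  linarith

/-- The second moments of y are the entries of H, so the mean is tr(H⁻¹H). -/
theorem lintegral_dotProduct_inv_multivariateGaussian {H : Matrix (Fin N) (Fin N) ℝ}
    (hH : H.PosDef) :
    ∫⁻ y, ENNReal.ofReal ((fun i => y i) ⬝ᵥ H⁻¹ *ᵥ (fun i => y i)) ∂(multivariateGaussian 0 H) =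
      N := by
  have hL2 : MemLp id 2 (multivariateGaussian (0 : EuclideanSpace ℝ (Fin N)) H) :=
    IsGaussian.memLp_two_id
  have hi : ∀ i, MemLp (fun y : EuclideanSpace ℝ (Fin N) => y i) 2
      (multivariateGaussian (0 : EuclideanSpace ℝ (Fin N)) H) := fun i =>
    hL2.continuousLinearMap_comp (EuclideanSpace.proj (𝕜 := ℝ) i)
  have hij : ∀ i j, Integrable (fun y : EuclideanSpace ℝ (Fin N) => y i * y j)
      (multivariateGaussian (0 : EuclideanSpace ℝ (Fin N)) H) := fun i j =>
    (hi i).integrable_mul (hi j)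
  have hmean : ∀ i, ∫ y : EuclideanSpace ℝ (Fin N), y i ∂(multivariateGaussian 0 H) = 0 := by
    intro i
    have := (EuclideanSpace.proj i : EuclideanSpace ℝ (Fin N) →L[ℝ] ℝ).integral_comp_comm
      (hL2.integrable (by norm_num))
    simpa using this
  have hcov : ∀ i j, ∫ y : EuclideanSpace ℝ (Fin N), y i * y j ∂(multivariateGaussian 0 H) =
      H i j := by
    intro i j
    have := covariance_eval_multivariateGaussian (μ := 0) hH.posSemidef i j
    rw [covariance, hmean, hmean] at this
    simpa using this
  have e : ∀ y : EuclideanSpace ℝ (Fin N), (fun i => y i) ⬝ᵥ H⁻¹ *ᵥ (fun i => y i) =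
      ∑ i, ∑ j, H⁻¹ i j * (y i * y j) := by
    intro y
    simp only [dotProduct, mulVec, Finset.mul_sum]
    exact Finset.sum_congr rfl fun i _ => Finset.sum_congr rfl fun j _ => by ring
  have hint : ∀ i ∈ Finset.univ, Integrable (fun y : EuclideanSpace ℝ (Fin N) =>
      ∑ j, H⁻¹ i j * (y i * y j)) (multivariateGaussian (0 : EuclideanSpace ℝ (Fin N)) H) :=
    fun i _ => integrable_finsetSum _ fun j _ => (hij i j).const_mul _
  rw [← ofReal_integral_eq_lintegral_ofReal]
  · simp_rw [e]
    rw [integral_finsetSum _ hint]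
    have : ∀ i, ∫ y : EuclideanSpace ℝ (Fin N), ∑ j, H⁻¹ i j * (y i * y j)
        ∂(multivariateGaussian 0 H) = (H⁻¹ * H) i i := by
      intro i
      rw [integral_finsetSum _ fun j _ => (hij i j).const_mul _, mul_apply]
      refine Finset.sum_congr rfl fun j _ => ?_
      rw [integral_const_mul, hcov, ← hH.1.apply i j]
      rfl
    simp_rw [this]
    rw [nonsing_inv_mul _ ((Matrix.isUnit_iff_isUnit_det _).1 hH.isUnit)]
    simp
  · simp_rw [e]
    exact integrable_finsetSum _ hint
  · exact Filter.Eventually.of_forall fun y => hH.dotProduct_inv_mulVec_nonneg _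

end AccurateApproximation

/-! ### Eigenvectors belonging to an eigenvalue sequence. -/

section EigenvalueSequence

variable {H : Type*} [NormedAddCommGroup H] [InnerProductSpace ℝ H] [CompleteSpace H]

/-- Eigenvectors of `A ∘ J` and `J ∘ A` with a nonzero eigenvalue correspond to each other. -/
theorem rank_eigenspace_comp_comm {V W : Type*} [AddCommGroup V] [Module ℝ V] [AddCommGroup W]
    [Module ℝ W] (A : V →ₗ[ℝ] W) (J : W →ₗ[ℝ] V) {r : ℝ} (hr : r ≠ 0) :
    Cardinal.toENat (Module.rank ℝ (Module.End.eigenspace (J ∘ₗ A) r)) =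
      Cardinal.toENat (Module.rank ℝ (Module.End.eigenspace (A ∘ₗ J) r)) := by
  have hA : ∀ z ∈ Module.End.eigenspace (J ∘ₗ A) r, A z ∈ Module.End.eigenspace (A ∘ₗ J) r := by
    intro z hz
    rw [Module.End.mem_eigenspace_iff] at hz ⊢
    simp only [LinearMap.comp_apply] at hz ⊢
    rw [hz, map_smul]
  have hJ : ∀ z ∈ Module.End.eigenspace (A ∘ₗ J) r, J z ∈ Module.End.eigenspace (J ∘ₗ A) r := by
    intro z hz
    rw [Module.End.mem_eigenspace_iff] at hz ⊢
    simp only [LinearMap.comp_apply] at hz ⊢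
    rw [hz, map_smul]
  have e : Module.End.eigenspace (J ∘ₗ A) r ≃ₗ[ℝ] Module.End.eigenspace (A ∘ₗ J) r :=
    LinearEquiv.ofLinearMap (A.restrict hA) (r⁻¹ • J.restrict hJ)
    (by
      ext ⟨z, hz⟩
      rw [Module.End.mem_eigenspace_iff] at hz
      simp only [LinearMap.comp_apply] at hz
      simp [LinearMap.restrict_apply, hz, smul_smul, hr])
    (by
      ext ⟨z, hz⟩
      rw [Module.End.mem_eigenspace_iff] at hz
      simp only [LinearMap.comp_apply] at hz
      simp [LinearMap.restrict_apply, hz, smul_smul, hr])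
  have := e.lift_rank_eq
  have h2 := congrArg Cardinal.toENat this
  rwa [Cardinal.toENat_lift, Cardinal.toENat_lift] at h2

/-- A compact positive operator has an orthonormal family of eigenvectors for its positive
eigenvalues; every vector orthogonal to it is in the kernel. -/
theorem IsEigenvalueSequence.exists_eigenvectors {C : H →L[ℝ] H} (hC : IsCompactOperator C)
    (hs : C.IsSymmetric) (hpos : ∀ u, 0 ≤ inner ℝ (C u) u) {lam : ℕ → ℝ}
    (hlam : IsEigenvalueSequence C.toLinearMap lam) :
    ∃ h : {m // 0 < lam m} → H, Orthonormal ℝ h ∧ (∀ m, C (h m) = lam m • h m) ∧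
      ∀ u, (∀ m, inner ℝ (h m) u = 0) → C u = 0 := by
  -- Compactness makes the eigenspace for r > 0 finite-dimensional, with as many dimensions as there
  -- are m with lam m = r, so an orthonormal basis can be indexed by these m and the bases glued
  -- over r.
  have hb : ∀ r : ℝ, ∃ e : {m // lam m = r} → H, 0 < r → Orthonormal ℝ e ∧
      Submodule.span ℝ (Set.range e) = Module.End.eigenspace C.toLinearMap r := by
    intro r
    by_cases hr : 0 < r
    swap
    · exact ⟨0, fun h => absurd h hr⟩
    have hfin : FiniteDimensional ℝ (Module.End.eigenspace C.toLinearMap r) :=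
      ContinuousLinearMap.finite_dimensional_eigenspace hC r hr.ne'
    have h1 := hlam.2.2 r hr
    rw [← Module.finrank_eq_rank, Cardinal.toENat_nat] at h1
    have hsf : Finite {m // lam m = r} := (Set.finite_of_encard_eq_coe h1).to_subtype
    have : Fintype {m // lam m = r} := Fintype.ofFinite _
    have h2 : Module.finrank ℝ (Module.End.eigenspace C.toLinearMap r) =
        Fintype.card {m // lam m = r} := by
      have h3 : {m : ℕ | lam m = r}.encard = (Fintype.card {m // lam m = r} : ℕ∞) := by
        rw [← Nat.card_eq_fintype_card]
        exact ENat.card_eq_coe_natCard {m // lam m = r}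
      rw [h3] at h1
      exact_mod_cast h1.symm
    let b := (stdOrthonormalBasis ℝ (Module.End.eigenspace C.toLinearMap r)).reindex
      ((finCongr h2).trans (Fintype.equivFin _).symm)
    refine ⟨fun m => b m, fun _ => ⟨?_, ?_⟩⟩
    · exact b.orthonormal.comp_linearIsometry (Submodule.subtypeₗᵢ _)
    · have h4 := congrArg (Submodule.map (Submodule.subtype _)) b.toBasis.span_eq
      rw [Submodule.map_span, Submodule.map_top, Submodule.range_subtype, ← Set.range_comp] at h4
      refine Eq.trans ?_ h4
      congr 2
  choose e he using hb
  have hmem : ∀ (r : ℝ), 0 < r → ∀ m : {m // lam m = r}, C (e r m) = r • e r m := by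
    intro r hr m
    have : e r m ∈ Module.End.eigenspace C.toLinearMap r := by
      rw [← (he r hr).2]
      exact Submodule.subset_span ⟨m, rfl⟩
    exact Module.End.mem_eigenspace_iff.1 this
  have hCs : ∀ u z, inner ℝ (C u) z = inner ℝ u (C z) := fun u z => hs u z
  refine ⟨fun m => e (lam m) ⟨m, rfl⟩, ?_, fun m => hmem _ m.2 _, ?_⟩
  · rw [orthonormal_iff_ite]
    rintro ⟨m, hm⟩ ⟨n, hn⟩
    by_cases hmn : lam m = lam n
    · have h1 := orthonormal_iff_ite.1 (he (lam m) hm).1 ⟨m, rfl⟩ ⟨n, hmn.symm⟩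
      have h2 : ∀ (r : ℝ) (hr : lam n = r), e r ⟨n, hr⟩ = e (lam n) ⟨n, rfl⟩ := by
        rintro r rfl; rfl
      rw [h2] at h1
      simpa using h1
    · rw [if_neg (fun h => hmn (by rw [Subtype.mk.inj h]))]
      have h1 := hCs (e (lam m) ⟨m, rfl⟩) (e (lam n) ⟨n, rfl⟩)
      rw [hmem _ hm, hmem _ hn, real_inner_smul_left, real_inner_smul_right] at h1
      have h2 : (lam m - lam n) * inner ℝ (e (lam m) ⟨m, rfl⟩) (e (lam n) ⟨n, rfl⟩) = 0 := by
        linarith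
      exact (mul_eq_zero.1 h2).resolve_left (sub_ne_zero.2 hmn)
  · intro u hu
    have hbot := ContinuousLinearMap.orthogonalComplement_iSup_eigenspaces_eq_bot hC hs
    -- C u, unlike u, is also orthogonal to the kernel. Negative eigenvalues do not occur and
    -- positive ones are covered by the hypothesis on u, so the spectral theorem forces C u = 0.
    have : C u ∈ (⨆ r, Module.End.eigenspace C.toLinearMap r)ᗮ := by
      rw [← Submodule.iInf_orthogonal, Submodule.mem_iInf]
      intro r
      rw [Submodule.mem_orthogonal]
      intro z hz
      have hz' : C z = r • z := Module.End.mem_eigenspace_iff.1 hz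
      rw [← hCs, hz', real_inner_smul_left]
      rcases lt_trichotomy r 0 with hr | hr | hr
      · have h1 := hpos z
        rw [hz', real_inner_smul_left, real_inner_self_eq_norm_sq] at h1
        have h2 : ‖z‖ ^ 2 = 0 := le_antisymm (by nlinarith [sq_nonneg ‖z‖]) (sq_nonneg _)
        rw [norm_eq_zero.1 (pow_eq_zero_iff two_ne_zero |>.1 h2), inner_zero_left, mul_zero]
      · rw [hr, zero_mul]
      · rw [← (he r hr).2] at hz
        have h1 : inner ℝ z u = 0 := by
          clear hz'
          induction hz using Submodule.span_induction with
          | mem z hz =>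
            obtain ⟨⟨m, hm⟩, rfl⟩ := hz
            subst hm
            exact hu ⟨m, hr⟩
          | zero => exact inner_zero_left _
          | add a b _ _ ha hb => rw [inner_add_left, ha, hb, add_zero]
          | smul c a _ ha => rw [real_inner_smul_left, ha, mul_zero]
        rw [h1, mul_zero]
    rw [hbot] at this
    exact (Submodule.mem_bot ℝ).1 this

end EigenvalueSequence

/-! ### The covariance operator of a bounded continuous feature map. -/

section FeatureCovariance

variable {E H : Type*} [TopologicalSpace E] [SecondCountableTopology E] [MeasurableSpace E]
  [OpensMeasurableSpace E] [NormedAddCommGroup H] [InnerProductSpace ℝ H] [CompleteSpace H]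

/-- The operator `h ↦ ∫ ⟪ψ x, h⟫ ψ x ∂μ`. -/
noncomputable def featureCovariance (ψ : E → H) (μ : Measure E) : H →L[ℝ] H :=
  ∫ x, InnerProductSpace.rankOne ℝ (ψ x) (ψ x) ∂μ

variable {ψ : E → H} (hψ : Continuous ψ) {v : ℝ} (hv : ∀ x, ‖ψ x‖ ^ 2 ≤ v) (μ : Measure E)
  [IsProbabilityMeasure μ]

include hψ hv in
theorem integrable_rankOne : Integrable (fun x => InnerProductSpace.rankOne ℝ (ψ x) (ψ x)) μ := by
  refine Integrable.of_bound (C := v) ?_ (Filter.Eventually.of_forall fun x => ?_)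
  · have : Continuous fun x => InnerProductSpace.rankOne ℝ (ψ x) (ψ x) :=
      ((InnerProductSpace.rankOne ℝ).continuous.comp hψ).clm_apply hψ
    exact this.aestronglyMeasurable
  · rw [InnerProductSpace.norm_rankOne, ← pow_two]
    exact hv x

include hψ hv in
theorem featureCovariance_apply (u : H) :
    featureCovariance ψ μ u = ∫ x, inner ℝ (ψ x) u • ψ x ∂μ := by
  rw [featureCovariance, ContinuousLinearMap.integral_apply (integrable_rankOne hψ hv μ)]
  rfl

include hψ hv in
theorem integrable_inner_smul (u : H) : Integrable (fun x => inner ℝ (ψ x) u • ψ x) μ :=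
  (integrable_rankOne hψ hv μ).apply_continuousLinearMap u

include hψ hv in
theorem inner_featureCovariance (u w : H) :
    inner ℝ (featureCovariance ψ μ u) w = ∫ x, inner ℝ (ψ x) u * inner ℝ (ψ x) w ∂μ := by
  rw [featureCovariance_apply hψ hv, real_inner_comm,
    ← integral_inner (integrable_inner_smul hψ hv μ u)]
  refine integral_congr_ae (Filter.Eventually.of_forall fun x => ?_)
  simp only [real_inner_smul_right, real_inner_comm w]

include hψ hv in
theorem featureCovariance_isSymmetric : (featureCovariance ψ μ).IsSymmetric := by
  intro u w
  change inner ℝ (featureCovariance ψ μ u) w = inner ℝ u (featureCovariance ψ μ w)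
  rw [real_inner_comm (featureCovariance ψ μ w), inner_featureCovariance hψ hv,
    inner_featureCovariance hψ hv]
  simp only [mul_comm]

-- The operator is an average of rank-one operators, and compact operators form a closed convex set.
include hψ hv in
theorem isCompactOperator_featureCovariance : IsCompactOperator (featureCovariance ψ μ) := by
  have hconv : Convex ℝ {T : H →L[ℝ] H | IsCompactOperator T} := by
    intro S hS T hT a b _ _ _
    exact (hS.smul a).add (hT.smul b)
  have hclosed : IsClosed {T : H →L[ℝ] H | IsCompactOperator T} :=
    isClosed_setOfPred_isCompactOperator
  refine Convex.integral_mem hconv hclosed (Filter.Eventually.of_forall fun x => ?_)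
    (integrable_rankOne hψ hv μ)
  have h1 : IsCompactOperator (ContinuousLinearMap.toSpanSingleton ℝ (ψ x)) :=
    (isCompactOperator_id (E := ℝ)).clm_comp (ContinuousLinearMap.toSpanSingleton ℝ (ψ x))
  exact h1.comp_clm (innerSL ℝ (ψ x))

-- The h m are orthonormal eigenvectors, with 0 where lam m = 0. A vector u orthogonal to all of
-- them is in the kernel, so ∫⟪ψ x, u⟫² = 0 and, by continuity, ⟪ψ x, u⟫ = 0 for every x in the
-- support of μ. On this set of full measure Parseval's identity needs no other basis vectors.
include hψ hv in
theorem exists_eigenfeatures {lam : ℕ → ℝ}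
    (hlam : IsEigenvalueSequence (featureCovariance ψ μ).toLinearMap lam) :
    ∃ h : ℕ → H, (∀ (w : H) (s : Finset ℕ), ∑ m ∈ s, inner ℝ (h m) w ^ 2 ≤ ‖w‖ ^ 2) ∧
      (∀ m, ∫ x, inner ℝ (h m) (ψ x) ^ 2 ∂μ = lam m) ∧
      ∀ᵐ x ∂μ, HasSum (fun m => inner ℝ (h m) (ψ x) ^ 2) (‖ψ x‖ ^ 2) := by
  set C := featureCovariance ψ μ with hC
  have hinner := fun u w => inner_featureCovariance hψ hv μ u w
  obtain ⟨h', ho, hCh, hker⟩ := hlam.exists_eigenvectors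
    (isCompactOperator_featureCovariance hψ hv μ) (featureCovariance_isSymmetric hψ hv μ)
    (fun u => by
      rw [hinner]
      exact integral_nonneg fun x => mul_self_nonneg _)
  set h : ℕ → H := fun m => if hm : 0 < lam m then h' ⟨m, hm⟩ else 0 with hh
  have hpos : ∀ m : {m // 0 < lam m}, h m = h' m := fun m => dif_pos m.2
  have hzero : ∀ m, ¬ 0 < lam m → h m = 0 := fun m hm => dif_neg hm
  refine ⟨h, fun w s => ?_, fun m => ?_, ?_⟩
  · have h1 := ho.sum_inner_products_le (s := s.subtype fun m => 0 < lam m) w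
    refine le_trans (le_of_eq ?_) h1
    have h2 : ∀ m : {m // 0 < lam m}, ‖inner ℝ (h' m) w‖ ^ 2 = inner ℝ (h m) w ^ 2 := fun m => by
      rw [hpos, Real.norm_eq_abs, sq_abs]
    simp_rw [h2]
    rw [Finset.sum_subtype_eq_sum_filter (s := s) (p := fun m => 0 < lam m)
      (fun m => inner ℝ (h m) w ^ 2), Finset.sum_filter]
    refine Finset.sum_congr rfl fun m _ => ?_
    split_ifs with hm
    · rfl
    · rw [hzero m hm, inner_zero_left, zero_pow two_ne_zero]
  · by_cases hm : 0 < lam m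
    · have h1 := hinner (h m) (h m)
      rw [hpos ⟨m, hm⟩, hCh, real_inner_smul_left, real_inner_self_eq_norm_sq, ho.1] at h1
      simp only [one_pow, mul_one] at h1
      rw [h1, hpos ⟨m, hm⟩]
      refine integral_congr_ae (Filter.Eventually.of_forall fun x => ?_)
      simp only [pow_two, real_inner_comm]
    · have : lam m = 0 := le_antisymm (not_lt.1 hm) (hlam.2.1 m)
      simp [hzero m hm, this]
  · filter_upwards [Measure.support_mem_ae (μ := μ)] with x hx
    obtain ⟨w, b, hsw, hb⟩ := ho.toSubtypeRange.exists_hilbertBasis_extension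
    have hperp : ∀ u, (∀ m, inner ℝ (h' m) u = 0) → inner ℝ u (ψ x) = 0 := by
      intro u hu
      have hCu := hinner u u
      rw [hker u hu, inner_zero_left] at hCu
      have hae : (fun x => inner ℝ (ψ x) u * inner ℝ (ψ x) u) =ᵐ[μ] 0 := by
        refine (integral_eq_zero_iff_of_nonneg (fun x => mul_self_nonneg _) ?_).1 hCu.symm
        have := Integrable.inner_const (𝕜 := ℝ) (integrable_inner_smul hψ hv μ u) u
        refine this.congr (Filter.Eventually.of_forall fun x => ?_)
        simp only [real_inner_smul_left]
      by_contra hne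
      have hopen : IsOpen {z | inner ℝ u (ψ z) ≠ 0} :=
        isOpen_ne_fun (by fun_prop) continuous_const
      have h1 := (Measure.mem_support_iff_forall x).1 hx _ (hopen.mem_nhds hne)
      refine h1.ne' ?_
      rw [← nonpos_iff_eq_zero]
      refine (measure_mono ?_).trans (ae_iff.1 hae).le
      intro z hz hz'
      refine hz ?_
      rw [real_inner_comm]
      exact mul_self_eq_zero.1 hz'
    have h1 := b.hasSum_inner_mul_inner (ψ x) (ψ x)
    rw [real_inner_self_eq_norm_sq] at h1
    set j : {m // 0 < lam m} → w := fun m => ⟨h' m, hsw ⟨m, rfl⟩⟩ with hj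
    have hjinj : Function.Injective j := fun a c hac =>
      ho.linearIndependent.injective (congrArg Subtype.val hac)
    have h2 := (hjinj.hasSum_iff (f := fun i => inner ℝ (ψ x) (b i) * inner ℝ (b i) (ψ x))
      (a := ‖ψ x‖ ^ 2) (by
        intro z hz
        have h3 : inner ℝ (b z) (ψ x) = 0 := by
          refine hperp _ fun m => ?_
          have h4 : b (j m) = h' m := by rw [hb]
          rw [← h4, b.orthonormal.2 (fun e => hz ⟨m, e⟩)]
        rw [h3, mul_zero])).2 h1
    have h5 : ((fun i => inner ℝ (ψ x) (b i) * inner ℝ (b i) (ψ x)) ∘ j) =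
        (fun m => inner ℝ (h m) (ψ x) ^ 2) ∘ Subtype.val := by
      funext m
      have h4 : b (j m) = h' m := by rw [hb]
      simp only [Function.comp_apply, h4, hpos, real_inner_comm (ψ x), pow_two]
    rw [h5] at h2
    refine (Subtype.val_injective.hasSum_iff fun m hm => ?_).1 h2
    have : ¬ 0 < lam m := fun h0 => hm ⟨⟨m, h0⟩, rfl⟩
    rw [hzero m this, inner_zero_left, zero_pow two_ne_zero]

end FeatureCovariance

/-! ### Feature maps of kernels and an integrated Mercer theorem. -/

section FeatureMap

variable {D : ℕ} {k : EuclideanSpace ℝ (Fin D) → EuclideanSpace ℝ (Fin D) → ℝ}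

/-- A covariance function is the Gram function of a feature map into a Hilbert space. -/
theorem IsCovarianceFunction.exists_featureMap (hk : IsCovarianceFunction k) :
    ∃ (H : Type) (_ : NormedAddCommGroup H) (_ : InnerProductSpace ℝ H) (_ : CompleteSpace H)
      (ψ : EuclideanSpace ℝ (Fin D) → H), ∀ x y, inner ℝ (ψ x) (ψ y) = k x y := by
  set K : Matrix (EuclideanSpace ℝ (Fin D)) (EuclideanSpace ℝ (Fin D)) (ℝ →L[ℝ] ℝ) :=
    Matrix.of fun x y => k x y • (1 : ℝ →L[ℝ] ℝ) with hK
  have hsymm : ∀ x y, k y x = k x y := fun x y => by simpa using hk.1.apply x y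
  have hKp : K.PosSemidef := by
    have hherm : K.IsHermitian := by
      ext x y : 2
      rw [conjTranspose_apply, hK, of_apply, of_apply, hsymm, star_smul, star_one]
      rfl
    refine ((RKHS.posSemidef_tfae (K := K)).out 0 2 rfl rfl).2 ⟨hherm, fun f => ?_⟩
    have := hk.2 f
    simp only [hK, of_apply, star_trivial] at this ⊢
    simp only [Finsupp.sum, RCLike.re_to_real, _root_.smul_apply] at this ⊢
    refine this.trans_eq (Finset.sum_congr rfl fun i _ => Finset.sum_congr rfl fun j _ => ?_)
    simp [hsymm i j]
    ring
  have : Fact K.PosSemidef := ⟨hKp⟩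
  refine ⟨RKHS.OfKernel K, inferInstance, inferInstance, inferInstance,
    fun x => RKHS.kerFun (RKHS.OfKernel K) x (1 : ℝ), fun x y => ?_⟩
  rw [← RKHS.kernel_inner, RKHS.OfKernel.kernel_ofKernel]
  simp [hK, hsymm]

theorem continuous_of_inner_continuous {E H : Type*} [TopologicalSpace E] [NormedAddCommGroup H]
    [InnerProductSpace ℝ H] {ψ : E → H} (h : Continuous fun z : E × E => inner ℝ (ψ z.1) (ψ z.2)) :
    Continuous ψ := by
  rw [continuous_iff_continuousAt]
  intro x
  rw [ContinuousAt, tendsto_iff_norm_sub_tendsto_zero]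
  have e : ∀ y, ‖ψ y - ψ x‖ = √(inner ℝ (ψ y) (ψ y) - 2 * inner ℝ (ψ y) (ψ x) +
      inner ℝ (ψ x) (ψ x)) := fun y => by
    rw [real_inner_self_eq_norm_sq, real_inner_self_eq_norm_sq, ← norm_sub_sq_real,
      Real.sqrt_sq (norm_nonneg _)]
  simp_rw [e]
  have h1 : Continuous fun y => inner ℝ (ψ y) (ψ y) := h.comp (by fun_prop : Continuous fun y => (y, y))
  have h2 : Continuous fun y => inner ℝ (ψ y) (ψ x) := h.comp (by fun_prop : Continuous fun y => (y, x))
  have h3 : Continuous fun y => √(inner ℝ (ψ y) (ψ y) - 2 * inner ℝ (ψ y) (ψ x) +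
      inner ℝ (ψ x) (ψ x)) := by fun_prop
  have := h3.tendsto x
  rwa [show inner ℝ (ψ x) (ψ x) - 2 * inner ℝ (ψ x) (ψ x) + inner ℝ (ψ x) (ψ x) = (0 : ℝ) by ring,
    Real.sqrt_zero] at this

theorem memLp_inner_feature {E H : Type*} [TopologicalSpace E] [SecondCountableTopology E]
    [MeasurableSpace E] [OpensMeasurableSpace E] [NormedAddCommGroup H] [InnerProductSpace ℝ H]
    {ψ : E → H} (hψ : Continuous ψ) {v : ℝ} (hv : ∀ x, ‖ψ x‖ ^ 2 ≤ v) (μ : Measure E)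
    [IsFiniteMeasure μ] (u : H) : MemLp (fun x => inner ℝ (ψ x) u) 2 μ := by
  have hc : Continuous fun x => inner ℝ (ψ x) u := by fun_prop
  refine MemLp.of_bound (C := √v * ‖u‖) hc.aestronglyMeasurable
    (Filter.Eventually.of_forall fun x => ?_)
  refine (norm_inner_le_norm _ _).trans ?_
  gcongr
  exact Real.le_sqrt_of_sq_le (hv x)

/-- The kernel operator on `L²(μ)` and the covariance of the features have the same positive
eigenvalues. -/
theorem isEigenvalueSequence_featureCovariance
    (hcont : Continuous fun z : EuclideanSpace ℝ (Fin D) × EuclideanSpace ℝ (Fin D) => k z.1 z.2)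
    {v : ℝ} (hbd : ∀ x y, |k x y| ≤ v) (μ : Measure (EuclideanSpace ℝ (Fin D)))
    [IsProbabilityMeasure μ] {H : Type*} [NormedAddCommGroup H] [InnerProductSpace ℝ H]
    [CompleteSpace H] {ψ : EuclideanSpace ℝ (Fin D) → H} (hψ : Continuous ψ)
    (hinner : ∀ x y, inner ℝ (ψ x) (ψ y) = k x y) {lam : ℕ → ℝ}
    (hlam : IsEigenvalueSequence (kernelOperator k hcont v hbd μ) lam) :
    IsEigenvalueSequence (featureCovariance ψ μ).toLinearMap lam := by
  have hv : ∀ x, ‖ψ x‖ ^ 2 ≤ v := fun x => by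
    rw [← real_inner_self_eq_norm_sq, hinner]
    exact (le_abs_self _).trans (hbd x x)
  have hJi : ∀ g : Lp ℝ 2 μ, Integrable (fun x => g x • ψ x) μ := fun g => by
    have hgi : Integrable (fun x => g x) μ := (Lp.memLp g).integrable (by norm_num)
    refine hgi.smul_bdd (√v) hψ.aestronglyMeasurable
      (Filter.Eventually.of_forall fun x => Real.le_sqrt_of_sq_le (hv x))
  let A : H →ₗ[ℝ] Lp ℝ 2 μ :=
    { toFun := fun u => (memLp_inner_feature hψ hv μ u).toLp
      map_add' := fun u w => by
        rw [← MemLp.toLp_add]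
        exact MemLp.toLp_congr _ _ (Filter.Eventually.of_forall fun x => inner_add_right _ _ _)
      map_smul' := fun r u => by
        rw [RingHom.id_apply, ← MemLp.toLp_const_smul]
        exact MemLp.toLp_congr _ _
          (Filter.Eventually.of_forall fun x => real_inner_smul_right _ _ _) }
  let J : Lp ℝ 2 μ →ₗ[ℝ] H :=
    { toFun := fun g => ∫ x, g x • ψ x ∂μ
      map_add' := fun f g => by
        rw [← integral_add (hJi f) (hJi g)]
        refine integral_congr_ae ?_
        filter_upwards [Lp.coeFn_add f g] with x hx
        rw [hx, Pi.add_apply, add_smul]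
      map_smul' := fun r g => by
        rw [RingHom.id_apply, ← integral_smul]
        refine integral_congr_ae ?_
        filter_upwards [Lp.coeFn_smul r g] with x hx
        rw [hx, Pi.smul_apply, smul_eq_mul, mul_smul] }
  -- A and J are adjoint to each other; A J is the kernel operator and J A the feature covariance,
  -- so their eigenspaces for positive eigenvalues have equal dimensions.
  have hT : kernelOperator k hcont v hbd μ = A ∘ₗ J := by
    ext1 g
    refine MemLp.toLp_congr (kernelOperator_memLp k hcont v hbd μ g)
      (memLp_inner_feature hψ hv μ (J g)) (Filter.Eventually.of_forall fun x => ?_)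
    change _ = inner ℝ (ψ x) (∫ x, g x • ψ x ∂μ)
    rw [← integral_inner (hJi g)]
    refine integral_congr_ae (Filter.Eventually.of_forall fun z => ?_)
    simp only [real_inner_smul_right, hinner, mul_comm]
  have hC : (featureCovariance ψ μ).toLinearMap = J ∘ₗ A := by
    ext1 u
    change featureCovariance ψ μ u = ∫ x, ((memLp_inner_feature hψ hv μ u).toLp) x • ψ x ∂μ
    rw [featureCovariance_apply hψ hv]
    refine integral_congr_ae ?_
    filter_upwards [(memLp_inner_feature hψ hv μ u).coeFn_toLp] with x hx
    rw [hx]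
  refine ⟨hlam.1, hlam.2.1, fun r hr => ?_⟩
  rw [hlam.2.2 r hr, hT, hC, rank_eigenspace_comp_comm A J hr.ne']

/-- Mercer's theorem, integrated over the diagonal: functions `g m` whose squares integrate to the
eigenvalues and whose tensor squares can be split off from the kernel. -/
theorem IsEigenvalueSequence.exists_mercer (hk : IsCovarianceFunction k)
    (hcont : Continuous fun z : EuclideanSpace ℝ (Fin D) × EuclideanSpace ℝ (Fin D) => k z.1 z.2)
    {v : ℝ} (hbd : ∀ x y, |k x y| ≤ v) (μ : Measure (EuclideanSpace ℝ (Fin D)))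
    [IsProbabilityMeasure μ] {lam : ℕ → ℝ}
    (hlam : IsEigenvalueSequence (kernelOperator k hcont v hbd μ) lam) :
    Summable lam ∧ ∃ g : ℕ → EuclideanSpace ℝ (Fin D) → ℝ, (∀ m, Continuous (g m)) ∧
      (∀ (S : ℕ) {N : ℕ} (x : Fin N → EuclideanSpace ℝ (Fin D)),
        (kernelMatrix k x - ∑ m ∈ Finset.range S,
          vecMulVec (fun i => g m (x i)) (fun i => g m (x i))).PosSemidef) ∧
      ∀ S : ℕ, ∫⁻ x, ENNReal.ofReal (k x x - ∑ m ∈ Finset.range S, g m x ^ 2) ∂μ =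
        ENNReal.ofReal (∑' m, lam (S + m)) := by
  obtain ⟨H, _, _, _, ψ, hinner⟩ := hk.exists_featureMap
  have hψ : Continuous ψ := continuous_of_inner_continuous (by simpa only [hinner] using hcont)
  have hself : ∀ x, ‖ψ x‖ ^ 2 = k x x := fun x => by
    rw [← real_inner_self_eq_norm_sq, hinner]
  have hv : ∀ x, ‖ψ x‖ ^ 2 ≤ v := fun x => by
    rw [hself]
    exact (le_abs_self _).trans (hbd x x)
  obtain ⟨h, hbessel, hint, hsum⟩ := exists_eigenfeatures hψ hv μ
    (isEigenvalueSequence_featureCovariance hcont hbd μ hψ hinner hlam)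
  have hgc : ∀ m, Continuous fun x => inner ℝ (h m) (ψ x) := fun m => by fun_prop
  have hgi : ∀ m, Integrable (fun x => inner ℝ (h m) (ψ x) ^ 2) μ := fun m => by
    refine Integrable.of_bound (C := v) ((hgc m).pow 2).aestronglyMeasurable
      (Filter.Eventually.of_forall fun x => ?_)
    rw [Real.norm_of_nonneg (sq_nonneg _)]
    have := hbessel (ψ x) {m}
    rw [Finset.sum_singleton] at this
    exact this.trans (hv x)
  have hki : Integrable (fun x => k x x) μ := by
    refine Integrable.of_bound (C := v) ?_ (Filter.Eventually.of_forall fun x => hbd x x)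
    exact (hcont.comp (by fun_prop : Continuous fun x => (x, x))).aestronglyMeasurable
  have hsl : Summable lam := by
    refine summable_of_sum_range_le (c := v) hlam.2.1 fun n => ?_
    simp_rw [← hint]
    rw [← integral_finsetSum _ fun m _ => hgi m]
    refine (integral_mono (integrable_finsetSum _ fun m _ => hgi m) (integrable_const v)
      fun x => (hbessel (ψ x) _).trans (hv x)).trans ?_
    simp
  refine ⟨hsl, fun m x => inner ℝ (h m) (ψ x), hgc, fun S N x => ?_, fun S => ?_⟩
  -- Positive semidefiniteness is Bessel's inequality for ∑ a_i ψ(x_i).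
  · refine PosSemidef.of_dotProduct_mulVec_nonneg ?_ fun a => ?_
    · refine (hk.posSemidef_kernelMatrix x).1.sub (Matrix.isHermitian_of_transpose_eq ?_)
      rw [transpose_sum]
      exact Finset.sum_congr rfl fun m _ => transpose_vecMulVec _ _
    · have h1 := hbessel (∑ i, a i • ψ (x i)) (Finset.range S)
      rw [star_trivial, sub_mulVec, dotProduct_sub, sub_nonneg]
      refine (le_of_eq ?_).trans (h1.trans (le_of_eq ?_))
      · rw [sum_mulVec, dotProduct_sum]
        refine Finset.sum_congr rfl fun m _ => ?_
        rw [vecMulVec_mulVec, inner_sum, pow_two]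
        simp only [real_inner_smul_right, dotProduct, Pi.smul_apply, op_smul_eq_smul, smul_eq_mul,
          mul_comm (a _), Finset.mul_sum, Finset.sum_mul]
        rw [Finset.sum_comm]
        refine Finset.sum_congr rfl fun i _ => Finset.sum_congr rfl fun j _ => ?_
        ring
      · rw [← real_inner_self_eq_norm_sq, sum_inner]
        simp only [inner_sum, real_inner_smul_left, real_inner_smul_right, hinner, dotProduct,
          mulVec, Finset.mul_sum, kernelMatrix, of_apply]
        exact Finset.sum_congr rfl fun i _ => Finset.sum_congr rfl fun j _ => by ring
  · have hr : ∀ x, 0 ≤ k x x - ∑ m ∈ Finset.range S, inner ℝ (h m) (ψ x) ^ 2 := fun x => by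
      rw [← hself, sub_nonneg]
      exact hbessel _ _
    have hsi : Integrable (fun x => ∑ m ∈ Finset.range S, inner ℝ (h m) (ψ x) ^ 2) μ :=
      integrable_finsetSum _ fun m _ => hgi m
    -- The trace formula: Parseval's identity, valid almost everywhere, is integrated term by term.
    have htot : ∫ x, k x x ∂μ = ∑' m, lam m := by
      have h1 := hasSum_integral_of_summable_integral_norm hgi (by
        simp_rw [Real.norm_of_nonneg (sq_nonneg _), hint]
        exact hsl)
      simp_rw [hint] at h1
      rw [h1.tsum_eq]
      refine integral_congr_ae ?_
      filter_upwards [hsum] with x hx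
      rw [hx.tsum_eq, hself]
    have hlint := ofReal_integral_eq_lintegral_ofReal (hki.sub hsi) (Filter.Eventually.of_forall hr)
    refine hlint.symm.trans (congrArg ENNReal.ofReal ?_)
    simp only [Pi.sub_apply]
    rw [integral_sub hki hsi, htot, integral_finsetSum _ fun m _ => hgi m]
    simp_rw [hint]
    rw [← hsl.sum_add_tsum_nat_add S, add_sub_cancel_left]
    simp_rw [add_comm S]

end FeatureMap

/-! ### The tail of the kernel matrix after removing S Mercer terms. -/

section TailBound

open scoped MatrixOrder

theorem trace_rowProjection_le {ι n : Type*} [Fintype ι] [DecidableEq ι] [Fintype n]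
    [DecidableEq n] (G : Matrix ι n ℝ) : (rowProjection G).trace ≤ Fintype.card ι := by
  set A := G * Gᵀ with hA
  have hAh : A.IsHermitian := isHermitian_mul_transpose G
  have hAs : IsSelfAdjoint A := hAh
  have hcomm : symPinv A * A = A * symPinv A := by
    have := cfc_commute_cfc (fun r : ℝ => r⁻¹) (id : ℝ → ℝ) A
    rw [cfc_id ℝ A] at this
    exact this
  have ht : (symPinv A * A)ᵀ = symPinv A * A := by
    rw [transpose_mul, symPinv_transpose, hAh.transpose_eq, hcomm]
  have hi : symPinv A * A * (symPinv A * A) = symPinv A * A := by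
    rw [← mul_assoc, symPinv_mul_mul_symPinv hAh]
  have h := Matrix.trace_mono (Matrix.le_one_of_idempotent ht hi)
  rw [trace_one] at h
  rwa [rowProjection, Matrix.mul_assoc, trace_mul_comm, Matrix.mul_assoc, ← hA]

variable {N : ℕ}

/-- Ky Fan's principle with P the projection onto the span of the g m, of trace at most S: 1 − P
annihilates GᵀG, hence tr((1 − P)K) = tr((1 − P)(K − GᵀG)) ≤ tr(K − GᵀG). The g m may be linearly
dependent. -/
theorem eigenvalueTail_le_trace_sub {K : Matrix (Fin N) (Fin N) ℝ} {S : ℕ} (g : ℕ → Fin N → ℝ)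
    (h : (K - ∑ m ∈ Finset.range S, vecMulVec (g m) (g m)).PosSemidef) :
    eigenvalueTail S K ≤ ∑ i, (K i i - ∑ m ∈ Finset.range S, g m i ^ 2) := by
  set G : Matrix (Fin S) (Fin N) ℝ := Matrix.of fun m i => g m i with hG
  have hGG : ∑ m ∈ Finset.range S, vecMulVec (g m) (g m) = Gᵀ * G := by
    ext i j
    rw [Matrix.sum_apply, mul_apply, Finset.sum_range]
    rfl
  have hGp : (0 : Matrix (Fin N) (Fin N) ℝ) ≤ Gᵀ * G := by
    have := posSemidef_conjTranspose_mul_self G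
    rw [conjTranspose_eq_transpose_of_trivial] at this
    exact nonneg_iff_posSemidef.2 this
  set P := rowProjection G with hP
  have hP1 : P ≤ 1 := Matrix.le_one_of_idempotent (rowProjection_transpose _)
    (rowProjection_mul_self _)
  have hP0 : 0 ≤ P := Matrix.nonneg_of_idempotent (rowProjection_transpose _)
    (rowProjection_mul_self _)
  have hR : 0 ≤ K - Gᵀ * G := by
    rw [← hGG]
    exact nonneg_iff_posSemidef.2 h
  have hK : 0 ≤ K := by
    have := add_nonneg hR hGp
    rwa [sub_add_cancel] at this
  have h1 := eigenvalueTail_le_trace hK hP0 hP1 (S := S) (by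
    simpa using trace_rowProjection_le G)
  refine h1.trans ?_
  have h2 : ((1 - P) * K).trace = ((1 - P) * (K - Gᵀ * G)).trace := by
    have h3 : (1 - P) * (Gᵀ * G) = 0 := by
      have h4 : P * Gᵀ = Gᵀ := by
        have := congrArg transpose (mul_rowProjection G)
        rwa [transpose_mul, rowProjection_transpose] at this
      rw [← Matrix.mul_assoc, Matrix.sub_mul, Matrix.one_mul, h4, sub_self, Matrix.zero_mul]
    rw [mul_sub, h3, sub_zero]
  have h5 := Matrix.trace_mul_mono hR (sub_le_self 1 hP0)
  rw [h2]
  rw [Matrix.mul_one, trace_mul_comm] at h5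
  refine h5.trans (le_of_eq ?_)
  rw [← hGG, trace]
  refine Finset.sum_congr rfl fun i _ => ?_
  simp [Matrix.sum_apply, vecMulVec_apply, pow_two]

end TailBound

/-! ### Markov's inequality and the joint union bound. -/

section Probability

/-- Markov's inequality, including the case of a vanishing expectation. -/
theorem measure_not_le_div_le {α : Type*} [MeasurableSpace α] {μ : Measure α} {f : α → ℝ}
    (hf : Measurable f) {a δ : ℝ} (ha : 0 ≤ a) (hδ : 0 < δ)
    (h : ∫⁻ x, ENNReal.ofReal (f x) ∂μ ≤ ENNReal.ofReal a) :
    μ {x | ¬ f x ≤ a / δ} ≤ ENNReal.ofReal δ := by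
  rcases ha.eq_or_lt with rfl | ha
  · rw [ENNReal.ofReal_zero, nonpos_iff_eq_zero, lintegral_eq_zero_iff hf.ennreal_ofReal] at h
    refine le_trans (le_of_eq ?_) zero_le
    refine measure_mono_null (fun x hx => ?_) (ae_iff.1 h)
    rw [zero_div] at hx
    have hx' : 0 < f x := not_le.1 hx
    simpa using hx'
  · have hpos : 0 < a / δ := div_pos ha hδ
    calc μ {x | ¬ f x ≤ a / δ} ≤ μ {x | ENNReal.ofReal (a / δ) ≤ ENNReal.ofReal (f x)} :=
          measure_mono fun x hx => ENNReal.ofReal_le_ofReal (not_le.1 hx).le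
      _ ≤ (∫⁻ x, ENNReal.ofReal (f x) ∂μ) / ENNReal.ofReal (a / δ) :=
          meas_ge_le_lintegral_div hf.ennreal_ofReal.aemeasurable (by simpa using hpos)
            ENNReal.ofReal_ne_top
      _ ≤ ENNReal.ofReal a / ENNReal.ofReal (a / δ) := by gcongr
      _ = ENNReal.ofReal δ := by
          rw [← ENNReal.ofReal_div_of_pos hpos]
          congr 1
          field_simp

variable {D N : ℕ}

/-- A union bound over the covariates, the algorithm and the observations. -/
theorem le_jointProb {ν : Measure (Fin N → EuclideanSpace ℝ (Fin D))} [IsProbabilityMeasure ν]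
    {alg : (Fin N → EuclideanSpace ℝ (Fin D)) → PMF (Finset (Fin N))}
    {η : (Fin N → EuclideanSpace ℝ (Fin D)) → Measure (EuclideanSpace ℝ (Fin N))}
    [∀ x, IsProbabilityMeasure (η x)]
    {event : (Fin N → EuclideanSpace ℝ (Fin D)) → Finset (Fin N) →
      EuclideanSpace ℝ (Fin N) → Prop}
    {X : (Fin N → EuclideanSpace ℝ (Fin D)) → Prop}
    {A : (Fin N → EuclideanSpace ℝ (Fin D)) → Finset (Fin N) → Prop}
    {Y : (Fin N → EuclideanSpace ℝ (Fin D)) → EuclideanSpace ℝ (Fin N) → Prop}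
    {a b c : ℝ} (ha : 0 ≤ a) (hb : 0 ≤ b) (hc : 0 ≤ c)
    (hXm : MeasurableSet {x | ¬ X x}) (hX : ν {x | ¬ X x} ≤ ENNReal.ofReal a)
    (hA : ∀ x, (alg x).toOuterMeasure {Z | ¬ A x Z} ≤ ENNReal.ofReal b)
    (hY : ∀ᵐ x ∂ν, η x {y | ¬ Y x y} ≤ ENNReal.ofReal c)
    (h : ∀ x Z y, X x → A x Z → Y x y → event x Z y) :
    ENNReal.ofReal (1 - (a + b + c)) ≤ jointProb ν alg η event := by
  classical
  set I : (Fin N → EuclideanSpace ℝ (Fin D)) → ℝ≥0∞ :=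
    fun x => ∑ Z : Finset (Fin N), alg x Z * η x {y | event x Z y} with hI
  have hpt : ∀ᵐ x ∂ν, 1 ≤ I x +
      ({x | ¬ X x}.indicator 1 x + (ENNReal.ofReal b + ENNReal.ofReal c)) := by
    filter_upwards [hY] with x hYx
    by_cases hx : X x
    swap
    · rw [Set.indicator_of_mem (by exact hx)]
      exact le_add_left (le_add_right le_rfl)
    have hsum : ∑ Z, alg x Z = 1 := by
      rw [← tsum_fintype (L := SummationFilter.unconditional _)]
      exact (alg x).tsum_coe
    have hterm : ∀ Z, alg x Z ≤ alg x Z * η x {y | event x Z y} +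
        ({Z | ¬ A x Z}.indicator (alg x) Z + alg x Z * ENNReal.ofReal c) := by
      intro Z
      by_cases hZ : A x Z
      · have h1 : (1 : ℝ≥0∞) ≤ η x {y | event x Z y} + ENNReal.ofReal c := by
          rw [← measure_univ (μ := η x)]
          refine (measure_mono (t := {y | event x Z y} ∪ {y | ¬ Y x y}) fun y _ => ?_).trans
            ((measure_union_le _ _).trans (add_le_add_right hYx _))
          by_cases hy : Y x y
          · exact Or.inl (h x Z y hx hZ hy)
          · exact Or.inr hy
        calc alg x Z = alg x Z * 1 := (mul_one _).symm
          _ ≤ alg x Z * (η x {y | event x Z y} + ENNReal.ofReal c) := by gcongr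
          _ ≤ _ := by
            rw [mul_add]
            gcongr
            exact le_add_left le_rfl
      · rw [Set.indicator_of_mem (by exact hZ)]
        exact le_add_left (le_add_right le_rfl)
    calc (1 : ℝ≥0∞) = ∑ Z, alg x Z := hsum.symm
      _ ≤ ∑ Z, (alg x Z * η x {y | event x Z y} +
          ({Z | ¬ A x Z}.indicator (alg x) Z + alg x Z * ENNReal.ofReal c)) :=
        Finset.sum_le_sum fun Z _ => hterm Z
      _ = I x + ((alg x).toOuterMeasure {Z | ¬ A x Z} + ENNReal.ofReal c) := by
        rw [Finset.sum_add_distrib, Finset.sum_add_distrib, ← Finset.sum_mul, hsum, one_mul,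
          PMF.toOuterMeasure_apply_fintype]
      _ ≤ I x + (ENNReal.ofReal b + ENNReal.ofReal c) := by
        gcongr
        exact hA x
      _ ≤ I x + ({x | ¬ X x}.indicator 1 x + (ENNReal.ofReal b + ENNReal.ofReal c)) :=
        add_le_add_right le_add_self _
  have hmeas : Measurable fun x => {x | ¬ X x}.indicator
      (1 : (Fin N → EuclideanSpace ℝ (Fin D)) → ℝ≥0∞) x +
      (ENNReal.ofReal b + ENNReal.ofReal c) :=
    (measurable_one.indicator hXm).add_const _
  have h1 := lintegral_mono_ae hpt
  -- Only the error terms have to be measurable here; nothing is needed about the integrand of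
  -- `jointProb`.
  rw [lintegral_add_right _ hmeas, lintegral_add_right _ measurable_const, lintegral_const,
    lintegral_const, measure_univ, mul_one, mul_one, lintegral_indicator_one hXm] at h1
  rw [ENNReal.ofReal_sub _ (by positivity), ENNReal.ofReal_one, tsub_le_iff_right,
    ENNReal.ofReal_add (by positivity) hc, ENNReal.ofReal_add ha hb, add_assoc (ENNReal.ofReal a)]
  refine h1.trans ?_
  rw [jointProb]
  gcongr

end Probability

/-! ### Assembly of the theorem. -/

section Accuracy

open scoped MatrixOrder

variable {D N : ℕ} {k : EuclideanSpace ℝ (Fin D) → EuclideanSpace ℝ (Fin D) → ℝ}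

/-- With high probability the algorithm selects few points and the divergence is small. -/
theorem rlsInducingPoints_sparseKL_le (hk : IsCovarianceFunction k) {σ2 : ℝ} (hσ : 0 < σ2)
    {S : ℕ} (hS : 1 ≤ S) {κ δ : ℝ} (hκ : 100000000 ≤ κ) (hδ : 0 < δ) (hδ1 : δ < 1 / 32)
    (x : Fin N → EuclideanSpace ℝ (Fin D)) :
    (rlsInducingPoints (kernelMatrix k x) S κ δ).toOuterMeasure
      {Z | ¬ ((Z.card : ℝ) < (200000000 + 450 * κ) * S * Real.log (S / δ) ∧
        ∀ y, sparseKL k σ2 x y Z ≤ ENNReal.ofReal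
          (eigenvalueTail S (kernelMatrix k x) / S / σ2 *
            (N + (fun i => y i) ⬝ᵥ (kernelMatrix k x + σ2 • 1)⁻¹ *ᵥ (fun i => y i)) / 2))} ≤
      ENNReal.ofReal (3 * δ) := by
  have hK := hk.posSemidef_kernelMatrix x
  obtain ⟨B, hB⟩ := hK.exists_mul_transpose
  have htail : eigenvalueTail S (rowGram B Finset.univ) = eigenvalueTail S (kernelMatrix k x) := by
    rw [rowGram_univ, hB, eigenvalueTail_mul_transpose_comm]
  refine le_trans (measure_mono ?_) (rlsInducingPoints_toOuterMeasure_le hB hS hκ hδ hδ1)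
  refine fun Z hZ h => hZ ?_
  obtain ⟨hcard, w, hw, hgood⟩ := h
  refine ⟨hcard, fun y => ?_⟩
  rw [htail] at hgood
  have hl : 0 ≤ eigenvalueTail S (kernelMatrix k x) / S :=
    div_nonneg (eigenvalueTail_nonneg (nonneg_iff_posSemidef.2 hK) S) (Nat.cast_nonneg S)
  exact sparseKL_le_of_nystromResidual_le hk hσ x y hl (hgood.nystromResidual_le hB hw hl)

/-- With high probability over the covariates, the tail of the spectrum of the kernel matrix is
controlled by that of the kernel operator. -/
theorem measure_eigenvalueTail_kernelMatrix_le (hk : IsCovarianceFunction k)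
    (hcont : Continuous fun z : EuclideanSpace ℝ (Fin D) × EuclideanSpace ℝ (Fin D) => k z.1 z.2)
    {v : ℝ} (hbd : ∀ x y, |k x y| ≤ v) (μ : Measure (EuclideanSpace ℝ (Fin D)))
    [IsProbabilityMeasure μ] {ν : Measure (Fin N → EuclideanSpace ℝ (Fin D))}
    (hν : ∀ n, ν.map (fun x => x n) = μ) {lam : ℕ → ℝ}
    (hlam : IsEigenvalueSequence (kernelOperator k hcont v hbd μ) lam) (S : ℕ) {δ : ℝ}
    (hδ : 0 < δ) :
    ∃ X : (Fin N → EuclideanSpace ℝ (Fin D)) → Prop, MeasurableSet {x | ¬ X x} ∧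
      ν {x | ¬ X x} ≤ ENNReal.ofReal δ ∧
      ∀ x, X x → eigenvalueTail S (kernelMatrix k x) ≤ N * (∑' m, lam (S + m)) / δ := by
  obtain ⟨-, g, hgc, hpsd, hint⟩ := hlam.exists_mercer hk hcont hbd μ
  set r : EuclideanSpace ℝ (Fin D) → ℝ := fun x => k x x - ∑ m ∈ Finset.range S, g m x ^ 2 with hr
  have hr0 : ∀ x, 0 ≤ r x := fun x => by
    have := (hpsd S (fun _ : Fin 1 => x)).diag_nonneg (i := 0)
    simpa [kernelMatrix, Matrix.sum_apply, vecMulVec_apply, ← pow_two, hr] using this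
  have hrm : Measurable r := by
    have h1 : Continuous fun x => k x x := hcont.comp (by fun_prop : Continuous fun x => (x, x))
    have h2 : Continuous r := by fun_prop
    exact h2.measurable
  have hT : 0 ≤ ∑' m, lam (S + m) := tsum_nonneg fun m => hlam.2.1 _
  have hfm : Measurable fun x : Fin N → EuclideanSpace ℝ (Fin D) => ∑ i, r (x i) := by fun_prop
  refine ⟨fun x => ∑ i, r (x i) ≤ N * (∑' m, lam (S + m)) / δ,
    (measurableSet_le hfm measurable_const).compl, ?_, fun x hx => ?_⟩
  · refine measure_not_le_div_le hfm (by positivity) hδ ?_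
    -- By additivity only the marginals matter: the mean is N times the tail of the operator
    -- spectrum, however the covariates depend on each other.
    have h1 : ∀ x : Fin N → EuclideanSpace ℝ (Fin D), ENNReal.ofReal (∑ i, r (x i)) =
        ∑ i, ENNReal.ofReal (r (x i)) := fun x =>
      ENNReal.ofReal_sum_of_nonneg fun i _ => hr0 _
    simp_rw [h1]
    rw [lintegral_finsetSum _ fun i _ => by fun_prop]
    have h2 : ∀ i, ∫⁻ x : Fin N → EuclideanSpace ℝ (Fin D), ENNReal.ofReal (r (x i)) ∂ν =
        ENNReal.ofReal (∑' m, lam (S + m)) := fun i => by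
      rw [← hint S, ← hν i, lintegral_map hrm.ennreal_ofReal (measurable_pi_apply i)]
    simp_rw [h2]
    rw [Finset.sum_const, Finset.card_univ, Fintype.card_fin, nsmul_eq_mul,
      ENNReal.ofReal_mul (Nat.cast_nonneg N), ENNReal.ofReal_natCast]
  · exact (eigenvalueTail_le_trace_sub (fun m i => g m (x i)) (hpsd S x)).trans hx

/-- The bound for a kernel matrix with small spectral tail and observations of small norm. -/
theorem accuracy_bound_le {N S τ T q Q δ σ2 : ℝ} (hN : 0 ≤ N) (hS : 0 < S) (hσ : 0 < σ2)
    (hδ : 0 < δ) (hδ1 : δ ≤ 1) (hT : 0 ≤ T) (hτ : τ ≤ N * T / δ) (hq0 : 0 ≤ q)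
    (hq : q ≤ Q / δ) :
    τ / S / σ2 * (N + q) / 2 ≤ 1 / 2 * (N + Q) * (N * T) / (S * δ ^ 2 * σ2) := by
  have h1 : N + q ≤ (N + Q) / δ := by
    rw [add_div]
    exact add_le_add ((le_div_iff₀ hδ).2 (mul_le_of_le_one_right hN hδ1)) hq
  calc τ / S / σ2 * (N + q) / 2 ≤ N * T / δ / S / σ2 * ((N + Q) / δ) / 2 := by gcongr
    _ = _ := by field_simp

end Accuracy

theorem mainTheorem4 :
    ∃ κ₀ : ℝ, 0 < κ₀ ∧ ∀ κ : ℝ, κ₀ ≤ κ → ∃ c : ℝ, 0 < c ∧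
      ∀ (D N S : ℕ) (_ : 1 ≤ S) (δ : ℝ) (_ : 0 < δ) (_ : δ < 1 / 32)
        (k : EuclideanSpace ℝ (Fin D) → EuclideanSpace ℝ (Fin D) → ℝ)
        (hk : IsCovarianceFunction k)
        (hcont : Continuous
          fun z : EuclideanSpace ℝ (Fin D) × EuclideanSpace ℝ (Fin D) => k z.1 z.2)
        (v : ℝ) (hv : ∀ x, k x x < v)
        (σ2 : ℝ) (_ : 0 < σ2)
        (p : EuclideanSpace ℝ (Fin D) → ℝ) (_ : Measurable p) (_ : ∀ x, 0 ≤ p x)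
        (μ : Measure (EuclideanSpace ℝ (Fin D))) [IsProbabilityMeasure μ]
        (_ : μ = volume.withDensity fun x => ENNReal.ofReal (p x))
        (ν : Measure (Fin N → EuclideanSpace ℝ (Fin D))) [IsProbabilityMeasure ν]
        (_ : ∀ n, ν.map (fun x => x n) = μ)
        (lam : ℕ → ℝ)
        (_ : IsEigenvalueSequence (kernelOperator k hcont v (hk.abs_le hv) μ) lam),
        Summable lam ∧
        (∀ (R : ℝ) (_ : 0 ≤ R)
            (η : Kernel (Fin N → EuclideanSpace ℝ (Fin D)) (EuclideanSpace ℝ (Fin N)))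
            [IsMarkovKernel η]
            (_ : ∀ᵐ x ∂ν, ∫⁻ y, ‖y‖ₑ ^ 2 ∂(η x) ≤ ENNReal.ofReal (R * N)),
          ENNReal.ofReal (1 - 5 * δ) ≤
            jointProb ν (fun x => rlsInducingPoints (kernelMatrix k x) S κ δ) η
              (fun x Z y => (Z.card : ℝ) < c * S * Real.log (S / δ) ∧
                sparseKL k σ2 x y Z ≤ ENNReal.ofReal
                  (1 / 2 * (N + R * N / σ2) * (N * ∑' m, lam (S + m)) / (S * δ ^ 2 * σ2)))) ∧
        ENNReal.ofReal (1 - 5 * δ) ≤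
          jointProb ν (fun x => rlsInducingPoints (kernelMatrix k x) S κ δ)
            (fun x => multivariateGaussian 0 (kernelMatrix k x + σ2 • 1))
            (fun x Z y => (Z.card : ℝ) < c * S * Real.log (S / δ) ∧
              sparseKL k σ2 x y Z ≤ ENNReal.ofReal
                (N ^ 2 * (∑' m, lam (S + m)) / (S * δ ^ 2 * σ2))) := by
  -- The size constant is twice 96 · 10⁶ + 225 κ, with room for the base case and the strict
  -- inequality.
  refine ⟨100000000, by norm_num, fun κ hκ => ⟨200000000 + 450 * κ, by linarith, ?_⟩⟩
  intro D N S hS δ hδ hδ1 k hk hcont v hv σ2 hσ p _ _ μ _ _ ν _ hν lam hlam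
  have hS0 : (0 : ℝ) < S := by exact_mod_cast hS
  have hT : 0 ≤ ∑' m, lam (S + m) := tsum_nonneg fun m => hlam.2.1 _
  have hN : (0 : ℝ) ≤ N := Nat.cast_nonneg N
  obtain ⟨X, hXm, hX, htail⟩ := measure_eigenvalueTail_kernelMatrix_le hk hcont (hk.abs_le hv) μ hν
    hlam S hδ
  have hH : ∀ x : Fin N → EuclideanSpace ℝ (Fin D), (kernelMatrix k x + σ2 • 1).PosDef := fun x =>
    PosDef.posSemidef_add (hk.posSemidef_kernelMatrix x) (PosDef.one.smul hσ)
  refine ⟨(hlam.exists_mercer hk hcont (hk.abs_le hv) μ).1, fun R hR η _ hη => ?_, ?_⟩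
  -- δ for the covariates, 3δ for the algorithm and δ for the observations.
  · rw [show 1 - 5 * δ = 1 - (δ + 3 * δ + δ) by ring]
    refine le_jointProb (Y := fun _ y => ‖y‖ ^ 2 ≤ R * N / δ) hδ.le (by positivity) hδ.le hXm hX
      (fun x => rlsInducingPoints_sparseKL_le hk hσ hS hκ hδ hδ1 x) ?_ ?_
    · filter_upwards [hη] with x hx
      refine measure_not_le_div_le (by fun_prop) (by positivity) hδ (le_trans (le_of_eq ?_) hx)
      refine lintegral_congr fun y => ?_
      rw [ENNReal.ofReal_pow (norm_nonneg _), ofReal_norm]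
    · rintro x Z y hx ⟨hcard, hKL⟩ hy
      refine ⟨hcard, (hKL y).trans (ENNReal.ofReal_le_ofReal ?_)⟩
      refine accuracy_bound_le hN hS0 hσ hδ (by linarith) hT (htail x hx)
        ((hH x).dotProduct_inv_mulVec_nonneg _) ?_
      refine (PosDef.dotProduct_inv_add_smul_le (by
        open scoped MatrixOrder in
        exact nonneg_iff_posSemidef.2 (hk.posSemidef_kernelMatrix x)) hσ _).trans ?_
      have h1 : (fun i => y i) ⬝ᵥ (fun i => y i) = ‖y‖ ^ 2 := by
        rw [EuclideanSpace.real_norm_sq_eq]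
        simp [dotProduct, pow_two]
      rw [h1, div_right_comm]
      gcongr
  · rw [show 1 - 5 * δ = 1 - (δ + 3 * δ + δ) by ring]
    -- Here Markov's inequality is applied to the quadratic form itself, whose mean is N; then 1/2 ·
    -- (N + N) · N = N².
    refine le_jointProb (Y := fun x y => (fun i => y i) ⬝ᵥ (kernelMatrix k x + σ2 • 1)⁻¹ *ᵥ
      (fun i => y i) ≤ N / δ) hδ.le (by positivity) hδ.le hXm hX
      (fun x => rlsInducingPoints_sparseKL_le hk hσ hS hκ hδ hδ1 x)
      (Filter.Eventually.of_forall fun x => ?_) ?_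
    · refine measure_not_le_div_le ?_ hN hδ ?_
      · simp only [dotProduct, mulVec]
        fun_prop
      · rw [lintegral_dotProduct_inv_multivariateGaussian (hH x), ENNReal.ofReal_natCast]
    · rintro x Z y hx ⟨hcard, hKL⟩ hy
      refine ⟨hcard, (hKL y).trans (ENNReal.ofReal_le_ofReal ?_)⟩
      refine (accuracy_bound_le hN hS0 hσ hδ (by linarith) hT (htail x hx)
        ((hH x).dotProduct_inv_mulVec_nonneg _) hy).trans (le_of_eq ?_)
      ring
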